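/- For $\mathbb F\in\{\mathbb R,\mathbb C\}$, let a polynomial vector over $\mathbb F$ be a tuple $f=(f_1,f_2,f_3,f_4)$ of forms $f_j\in\mathbb F[x_0,x_1,x_2]_{d_j}$ with $(d_1,d_2,d_3,d_4)=(2,3,3,3)$. A Waring decomposition of $f$ over $\mathbb F$ with $k$ summands consists of linear forms $\ell_1,\dots,\ell_k\in\mathbb F[x_0,x_1,x_2]_1$ and, for each $j$, scalars $(\lambda_1^j,\dots,\lambda_k^j)\in\mathbb F^k\setminus\{0\}$ such that $f_j=\sum_{i=1}^k\lambda_i^j\ell_i^{d_j}$ for $j=1,\dots,4$. The rank of $f$ over $\mathbb F$ is the minimal such $k$, and a vector $f$ of rank $k$ is Waring identifiable over $\mathbb F$ if its decomposition over $\mathbb F$ with $k$ summands is unique up to reordering and rescaling, i.e. up to permuting the indices $i$ and replacing $(\ell_i,\lambda_i^j)$ by $(c_i\ell_i,c_i^{-d_j}\lambda_i^j)$ with $c_i\in\mathbb F\setminus\{0\}$. Let $\mathbb P^{35}_{\mathbb R}$ be the projective space of non-zero real polynomial vectors $f$ up to a common non-zero real factor, with its Euclidean topology. There exists a non-empty Euclidean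 open set $U\subset\mathbb P^{35}_{\mathbb R}$ such that every $f\in U$ has rank $6$ over $\mathbb C$ and rank $6$ over $\mathbb R$, is Waring identifiable over $\mathbb R$, and is not Waring identifiable over $\mathbb C$. More precisely, up to reordering and rescaling, every $f\in U$ has exactly two Waring decompositions over $\mathbb C$ with $6$ summands: one with real linear forms and real scalars, and one which is not real (not equal to a real one up to reordering and rescaling) but is self-conjugate, i.e. fixed by complex conjugation up to reordering and rescaling. -/

import Mathlib

open scoped LinearAlgebra.Projectivization Topology

/-- Polynomial vectors `(f_1, …, f_r)` over `F`: the component `f_j` is a form of degree `d j`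
in the `n + 1` variables `x_0, …, x_n`. -/
abbrev PolyVec (F : Type) [Field F] (n : ℕ) {r : ℕ} (d : Fin r → ℕ) : Type :=
  ∀ j : Fin r, MvPolynomial.homogeneousSubmodule (Fin (n + 1)) F (d j)

/-- Change of scalars for polynomial vectors along a field homomorphism. -/
noncomputable def PolyVec.map {F K : Type} [Field F] [Field K] (φ : F →+* K) {n r : ℕ}
    {d : Fin r → ℕ} (f : PolyVec F n d) : PolyVec K n d :=
  fun j => ⟨MvPolynomial.map φ (f j : MvPolynomial (Fin (n + 1)) F),
    MvPolynomial.IsHomogeneous.map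
      ((MvPolynomial.mem_homogeneousSubmodule _ _).1 (f j).2) φ⟩

/-- The Euclidean topology on the (finite-dimensional) space of real polynomial vectors:
convergence of all coefficients. -/
noncomputable abbrev PolyVec.euclideanTopology (n : ℕ) {r : ℕ} (d : Fin r → ℕ) :
    TopologicalSpace (PolyVec ℝ n d) :=
  TopologicalSpace.induced
    (fun f (p : Fin r × (Fin (n + 1) →₀ ℕ)) =>
      MvPolynomial.coeff p.2 (f p.1 : MvPolynomial (Fin (n + 1)) ℝ))
    Pi.topologicalSpace

/-- The Euclidean topology on the projective space of real polynomial vectors: the quotient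
topology from the space of non-zero polynomial vectors. -/
noncomputable abbrev PolyVec.projectiveTopology (n : ℕ) {r : ℕ} (d : Fin r → ℕ) :
    TopologicalSpace (ℙ ℝ (PolyVec ℝ n d)) :=
  TopologicalSpace.coinduced
    (fun f : {f : PolyVec ℝ n d // f ≠ 0} => Projectivization.mk ℝ f.1 f.2)
    (TopologicalSpace.induced Subtype.val (PolyVec.euclideanTopology n d))

/-- The data of a candidate simultaneous Waring decomposition with `k` summands: linear forms
`ℓ_1, …, ℓ_k` in `n + 1` variables and scalars `lam i j` (for the `i`-th summand of the `j`-th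
component). -/
structure WaringData (F : Type) [Field F] (n r k : ℕ) where
  form : Fin k → MvPolynomial.homogeneousSubmodule (Fin (n + 1)) F 1
  lam : Fin k → Fin r → F

namespace WaringData

/-- The data `D` is a simultaneous Waring decomposition of `f`: for every component `j`, the
vector of scalars `(lam 1 j, …, lam k j)` is non-zero and `f_j = ∑ i, lam i j • ℓ_i ^ d_j`. -/
def IsDecompositionOf {F : Type} [Field F] {n r k : ℕ} {d : Fin r → ℕ}
    (D : WaringData F n r k) (f : PolyVec F n d) : Prop :=
  ∀ j : Fin r, (fun i : Fin k => D.lam i j) ≠ 0 ∧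
    (f j : MvPolynomial (Fin (n + 1)) F) =
      ∑ i : Fin k, D.lam i j • (D.form i : MvPolynomial (Fin (n + 1)) F) ^ d j

/-- Equality of decompositions up to reordering and rescaling: after a permutation, each linear
form `ℓ_i` is multiplied by some `c_i ≠ 0` and each scalar `lam i j` is divided by `c_i ^ d_j`. -/
def Equivalent {F : Type} [Field F] {n r k : ℕ} (d : Fin r → ℕ)
    (D E : WaringData F n r k) : Prop :=
  ∃ (σ : Equiv.Perm (Fin k)) (c : Fin k → F), ∀ i : Fin k, c i ≠ 0 ∧
    E.form (σ i) = c i • D.form i ∧ ∀ j : Fin r, E.lam (σ i) j * c i ^ d j = D.lam i j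

/-- Application of a field homomorphism to all linear forms and scalars. -/
noncomputable def map {F K : Type} [Field F] [Field K] (φ : F →+* K) {n r k : ℕ}
    (D : WaringData F n r k) : WaringData K n r k where
  form i := ⟨MvPolynomial.map φ (D.form i : MvPolynomial (Fin (n + 1)) F),
    MvPolynomial.IsHomogeneous.map
      ((MvPolynomial.mem_homogeneousSubmodule _ _).1 (D.form i).2) φ⟩
  lam i j := φ (D.lam i j)

/-- A complex decomposition is real if, up to reordering and rescaling, all its linear forms and
scalars are real. -/
def IsReal {n r k : ℕ} (d : Fin r → ℕ) (D : WaringData ℂ n r k) : Prop :=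
  ∃ E : WaringData ℝ n r k, Equivalent d (E.map Complex.ofRealHom) D

/-- A complex decomposition is self-conjugate if it is fixed, up to reordering and rescaling, by
complex conjugation. -/
def IsSelfConjugate {n r k : ℕ} (d : Fin r → ℕ) (D : WaringData ℂ n r k) : Prop :=
  Equivalent d (D.map (starRingEnd ℂ)) D

end WaringData

/-- `f` has Waring rank `k` over `F`: `k` is the minimal number of summands in a decomposition. -/
def HasWaringRank {F : Type} [Field F] {n r : ℕ} {d : Fin r → ℕ} (f : PolyVec F n d)
    (k : ℕ) : Prop :=
  IsLeast {m : ℕ | ∃ D : WaringData F n r m, D.IsDecompositionOf f} k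

/-- `f` is Waring identifiable over `F`: its decomposition with the minimal number of summands is
unique up to reordering and rescaling. -/
def WaringIdentifiable {F : Type} [Field F] {n r : ℕ} {d : Fin r → ℕ}
    (f : PolyVec F n d) : Prop :=
  ∃ k : ℕ, HasWaringRank f k ∧
    ∀ D E : WaringData F n r k, D.IsDecompositionOf f → E.IsDecompositionOf f →
      WaringData.Equivalent d D E

/-- The degrees `2, 3, 3, 3`. -/
def degrees2333 : Fin 4 → ℕ := ![2, 3, 3, 3]

/-! The three cubics of a polynomial vector amount to a linear functional on forms of bidegree (1,3)
in two groups of three variables, and a decomposition writes this functional as a sum of evaluations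
at the points (λ_i, ℓ_i). The quadric adds no condition: when six points impose independent
conditions on conics, its six weights exist and are unique (`exists_quadratic_weights`). The task is
therefore to count the families of six points of P² × P² with prescribed (1,3)-moments.

Let D be one such family. Splitting (1,3) as (1,1) + (0,2) shows that fewer points never suffice
(`card_le_of_sameMoments`), and that any other family G lies on the zero set C of the three bilinear
forms through D (`eval_eq_zero_of_sameMoments`). For general D this C is an elliptic curve on which
forms of bidegree (1,3) have degree 12. Equality of the two sums of evaluations is a linear relation
among evaluations on C. By the residue theorem it comes from a form t of bidegree (1,3) cutting out
D + G, and it fixes the derivatives of t along C at D up to a common factor. If s cuts out D + D'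
for one further solution D', then t - c s vanishes doubly on D for some c. For general D a form of
bidegree (1,3) doing so vanishes on C, so G = D'. `ResidualPair` collects the linear-algebra facts
that this argument needs, with no curve theory, and `ResidualPair.unique` carries it out.

A general pair is found by perturbing a degenerate one. The curve becomes the hexagon of lines x_c
y_c = 0 (c = 0, 1, 2), and `baseForm` cuts it in twelve explicit points, six real (`realBase`) and
six forming three conjugate pairs (`complexBase`), with equal moments. The conditions in
`ResidualPair` are rank conditions, hence open among pairs with equal moments
(`eventually_residualPair`). The moment map is a submersion at both families (`map_moments_nhds`),
so each real moment vector near the base one has a real solution near `realBase` and a complex one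
near `complexBase`. These are all the solutions. The second is not real, since it has a linear form
that is not proportional to a real one. Its conjugate is again a solution and cannot be the real
one, so it is self-conjugate. -/

/-! ### Bihomogeneous forms on P² × P² and their directional derivatives -/

section BihomogeneousForms

open MvPolynomial

variable {k : Type*} [Field k]

/-- The monomial `u ^ α * l ^ β` in two groups of three variables. -/
noncomputable def biMonomial (k : Type*) [Field k] (α β : Fin 3 → ℕ) :
    MvPolynomial (Fin 3 ⊕ Fin 3) k :=
  (∏ i, X (Sum.inl i) ^ α i) * ∏ i, X (Sum.inr i) ^ β i

/-- The bihomogeneous forms of bidegree `(a, b)` in two groups of three variables. -/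
noncomputable def biForms (k : Type*) [Field k] (a b : ℕ) :
    Submodule k (MvPolynomial (Fin 3 ⊕ Fin 3) k) :=
  Submodule.span k {P | ∃ α β : Fin 3 → ℕ, ∑ i, α i = a ∧ ∑ i, β i = b ∧ P = biMonomial k α β}

theorem biMonomial_mem {α β : Fin 3 → ℕ} {a b : ℕ} (hα : ∑ i, α i = a) (hβ : ∑ i, β i = b) :
    biMonomial k α β ∈ biForms k a b :=
  Submodule.subset_span ⟨α, β, hα, hβ, rfl⟩

theorem biForms_le {a b : ℕ} {R : Submodule k (MvPolynomial (Fin 3 ⊕ Fin 3) k)}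
    (h : ∀ α β : Fin 3 → ℕ, ∑ i, α i = a → ∑ i, β i = b → biMonomial k α β ∈ R) :
    biForms k a b ≤ R := by
  refine Submodule.span_le.2 ?_
  rintro _ ⟨α, β, hα, hβ, rfl⟩
  exact h α β hα hβ

theorem biMonomial_mul (α β α' β' : Fin 3 → ℕ) :
    biMonomial k α β * biMonomial k α' β' = biMonomial k (α + α') (β + β') := by
  simp only [biMonomial, Pi.add_apply, pow_add, Finset.prod_mul_distrib]
  ring

theorem biForms_mul_mem {a b c d e f : ℕ} {P Q : MvPolynomial (Fin 3 ⊕ Fin 3) k}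
    (hP : P ∈ biForms k a b) (hQ : Q ∈ biForms k c d) (he : a + c = e := by rfl)
    (hf : b + d = f := by rfl) : P * Q ∈ biForms k e f := by
  subst he hf
  have h := Submodule.mul_mem_mul hP hQ
  rw [biForms, biForms, Submodule.span_mul_span] at h
  refine Submodule.span_mono ?_ h
  rintro _ ⟨_, ⟨α, β, hα, hβ, rfl⟩, _, ⟨α', β', hα', hβ', rfl⟩, rfl⟩
  refine ⟨α + α', β + β', ?_, ?_, biMonomial_mul ..⟩ <;>
    simp [Finset.sum_add_distrib, *]

theorem X_inl_mem (i : Fin 3) : (X (Sum.inl i) : MvPolynomial (Fin 3 ⊕ Fin 3) k) ∈ biForms k 1 0 :=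
  Submodule.subset_span ⟨Pi.single i 1, 0, by simp, by simp, by
    simp [biMonomial, Pi.single_apply, pow_ite]⟩

theorem X_inr_mem (i : Fin 3) : (X (Sum.inr i) : MvPolynomial (Fin 3 ⊕ Fin 3) k) ∈ biForms k 0 1 :=
  Submodule.subset_span ⟨0, Pi.single i 1, by simp, by simp, by
    simp [biMonomial, Pi.single_apply, pow_ite]⟩

theorem one_mem_biForms : (1 : MvPolynomial (Fin 3 ⊕ Fin 3) k) ∈ biForms k 0 0 :=
  Submodule.subset_span ⟨0, 0, by simp, by simp, by simp [biMonomial]⟩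

theorem biForms_pow_mem {a b : ℕ} {P : MvPolynomial (Fin 3 ⊕ Fin 3) k}
    (hP : P ∈ biForms k a b) (n : ℕ) : P ^ n ∈ biForms k (n * a) (n * b) := by
  induction n with
  | zero => simpa using one_mem_biForms
  | succ n ih =>
    rw [pow_succ, Nat.succ_mul, Nat.succ_mul]
    exact biForms_mul_mem ih hP

instance finiteDimensional_biForms (a b : ℕ) : FiniteDimensional k (biForms k a b) := by
  have key : ∀ n : ℕ, {α : Fin 3 → ℕ | ∑ i, α i = n}.Finite := fun n =>
    (Set.finite_Iic (fun _ : Fin 3 => n)).subset fun α (hα : _ = n) i =>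
      hα ▸ Finset.single_le_sum (f := α) (fun _ _ => Nat.zero_le _) (Finset.mem_univ i)
  refine FiniteDimensional.span_of_finite k ?_
  refine (((key a).prod (key b)).image fun x => biMonomial k x.1 x.2).subset ?_
  rintro _ ⟨α, β, hα, hβ, rfl⟩
  exact ⟨(α, β), ⟨hα, hβ⟩, rfl⟩

/-- Rescaling of the two groups of coordinates of a point. -/
def biScale (c c' : k) (z : Fin 3 ⊕ Fin 3 → k) : Fin 3 ⊕ Fin 3 → k :=
  Sum.elim (fun i => c * z (Sum.inl i)) (fun i => c' * z (Sum.inr i))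

theorem eval_biScale {a b : ℕ} {P : MvPolynomial (Fin 3 ⊕ Fin 3) k} (hP : P ∈ biForms k a b)
    (c c' : k) (z : Fin 3 ⊕ Fin 3 → k) :
    eval (biScale c c' z) P = c ^ a * c' ^ b * eval z P := by
  induction hP using Submodule.span_induction with
  | mem P h =>
    obtain ⟨α, β, rfl, rfl, rfl⟩ := h
    simp only [biMonomial, biScale, map_mul, map_prod, map_pow, eval_X, Sum.elim_inl,
      Sum.elim_inr, mul_pow, Finset.prod_mul_distrib, Finset.prod_pow_eq_pow_sum]
    ring
  | zero => simp
  | add P Q _ _ hP hQ => rw [map_add, hP, hQ, map_add]; ring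
  | smul r P _ hP => rw [smul_eval, hP, smul_eval]; ring

/-- The derivative of a polynomial at `z` in the direction `τ`. -/
noncomputable def dirDeriv (z τ : Fin 3 ⊕ Fin 3 → k) :
    MvPolynomial (Fin 3 ⊕ Fin 3) k →ₗ[k] k :=
  ∑ i, τ i • ((aeval z).toLinearMap ∘ₗ (pderiv i).toLinearMap)

theorem dirDeriv_apply (z τ : Fin 3 ⊕ Fin 3 → k) (P : MvPolynomial (Fin 3 ⊕ Fin 3) k) :
    dirDeriv z τ P = ∑ i, τ i * eval z (pderiv i P) := by
  simp [dirDeriv, LinearMap.sum_apply, aeval_eq_eval]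

theorem dirDeriv_mul (z τ : Fin 3 ⊕ Fin 3 → k) (P Q : MvPolynomial (Fin 3 ⊕ Fin 3) k) :
    dirDeriv z τ (P * Q) = dirDeriv z τ P * eval z Q + eval z P * dirDeriv z τ Q := by
  simp only [dirDeriv_apply, Derivation.leibniz, smul_eq_mul, map_add, map_mul, Finset.sum_mul,
    Finset.mul_sum, ← Finset.sum_add_distrib]
  exact Finset.sum_congr rfl fun i _ => by ring

theorem dirDeriv_X (z τ : Fin 3 ⊕ Fin 3 → k) (i : Fin 3 ⊕ Fin 3) :
    dirDeriv z τ (X i) = τ i := by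
  classical
  rw [dirDeriv_apply, Finset.sum_eq_single i]
  · simp
  · intro j _ hj
    simp [pderiv_X, hj.symm]
  · simp

end BihomogeneousForms

/-! ### Families with equal moments: lower bound and bilinear forms -/

section Uniqueness

open MvPolynomial

variable {k : Type*} [Field k]

/-- Two points with the same image in the product of two projective planes. -/
def BiProportional (z w : Fin 3 ⊕ Fin 3 → k) : Prop :=
  ∃ c c' : k, c ≠ 0 ∧ c' ≠ 0 ∧ z = biScale c c' w

/-- Two families of points with the same sum of evaluations on forms of bidegree `(1, 3)`. -/
def SameMoments {m n : ℕ} (g : Fin m → Fin 3 ⊕ Fin 3 → k) (d : Fin n → Fin 3 ⊕ Fin 3 → k) : Prop :=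
  ∀ P ∈ biForms k 1 3, ∑ j, eval (g j) P = ∑ i, eval (d i) P

/-- The forms of bidegree `(a, b)` separate the points: there is a dual basis. -/
def SeparatedBy (a b : ℕ) {n : ℕ} (d : Fin n → Fin 3 ⊕ Fin 3 → k) : Prop :=
  ∃ q : Fin n → MvPolynomial (Fin 3 ⊕ Fin 3) k, (∀ i, q i ∈ biForms k a b) ∧
    ∀ i j, eval (d j) (q i) = if i = j then 1 else 0

/-- A linear form vanishing at the second vector but not at the first one. -/
theorem exists_linear_separator {v w : Fin 3 → k} (hw : w ≠ 0) (h : ∀ c : k, v ≠ fun i => c * w i) :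
    ∃ a : Fin 3 → k, ∑ i, a i * w i = 0 ∧ ∑ i, a i * v i ≠ 0 := by
  by_contra! H
  obtain ⟨r, hr⟩ := Function.ne_iff.1 hw
  simp only [Pi.zero_apply] at hr
  refine h (v r / w r) (funext fun i => ?_)
  by_cases hi : i = r
  · subst hi; field_simp
  have := H (Pi.single i (w r) - Pi.single r (w i)) (by
    simp only [Pi.sub_apply, sub_mul, Finset.sum_sub_distrib, Pi.single_apply, ite_mul, zero_mul,
      Finset.sum_ite_eq', Finset.mem_univ, if_true]
    ring)
  simp [sub_mul, Finset.sum_sub_distrib, Pi.single_apply] at this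
  field_simp
  linear_combination this

/-- A form of bidegree `(1, 1)` vanishing at `z'` but not at a non-proportional point `z`. -/
theorem exists_bilinear_separator {z z' : Fin 3 ⊕ Fin 3 → k}
    (hl : z ∘ Sum.inl ≠ 0) (hr : z ∘ Sum.inr ≠ 0) (hl' : z' ∘ Sum.inl ≠ 0)
    (hr' : z' ∘ Sum.inr ≠ 0) (h : ¬ BiProportional z z') :
    ∃ P ∈ biForms k 1 1, eval z' P = 0 ∧ eval z P ≠ 0 := by
  have lin : ∀ a : Fin 3 → k, (∑ i, C (a i) * X (Sum.inl i)) ∈ biForms k 1 0 := fun a =>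
    Submodule.sum_mem _ fun i _ => by
      rw [← smul_eq_C_mul]; exact Submodule.smul_mem _ _ (X_inl_mem i)
  have lin' : ∀ a : Fin 3 → k, (∑ i, C (a i) * X (Sum.inr i)) ∈ biForms k 0 1 := fun a =>
    Submodule.sum_mem _ fun i _ => by
      rw [← smul_eq_C_mul]; exact Submodule.smul_mem _ _ (X_inr_mem i)
  by_cases h1 : ∃ c : k, z ∘ Sum.inl = fun i => c * (z' ∘ Sum.inl) i
  · by_cases h2 : ∃ c : k, z ∘ Sum.inr = fun i => c * (z' ∘ Sum.inr) i
    · obtain ⟨c, hc⟩ := h1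
      obtain ⟨c', hc'⟩ := h2
      refine absurd ⟨c, c', ?_, ?_, ?_⟩ h
      · rintro rfl; exact hl (by rw [hc]; ext; simp)
      · rintro rfl; exact hr (by rw [hc']; ext; simp)
      · ext i
        rcases i with i | i
        · exact congrFun hc i
        · exact congrFun hc' i
    · push Not at h2
      obtain ⟨a, ha, ha'⟩ := exists_linear_separator hr' h2
      obtain ⟨r, hr⟩ := Function.ne_iff.1 hl
      refine ⟨X (Sum.inl r) * ∑ i, C (a i) * X (Sum.inr i), biForms_mul_mem (X_inl_mem r) (lin' a),
        ?_, ?_⟩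
      · simp only [map_mul, map_sum, eval_C, eval_X]
        rw [show ∑ i, a i * z' (Sum.inr i) = 0 from ha, mul_zero]
      · simp only [map_mul, map_sum, eval_C, eval_X]
        exact mul_ne_zero hr ha'
  · push Not at h1
    obtain ⟨a, ha, ha'⟩ := exists_linear_separator hl' h1
    obtain ⟨r, hr⟩ := Function.ne_iff.1 hr
    refine ⟨(∑ i, C (a i) * X (Sum.inl i)) * X (Sum.inr r), biForms_mul_mem (lin a) (X_inr_mem r),
      ?_, ?_⟩
    · simp only [map_mul, map_sum, eval_C, eval_X]
      rw [show ∑ i, a i * z' (Sum.inl i) = 0 from ha, zero_mul]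
    · simp only [map_mul, map_sum, eval_C, eval_X]
      exact mul_ne_zero ha' hr

/-- One bilinear separator per point, multiplied together; this is why the degree equals the number
of points. -/
theorem exists_product_separator {n : ℕ} {z : Fin 3 ⊕ Fin 3 → k} {d : Fin n → Fin 3 ⊕ Fin 3 → k}
    (hl : z ∘ Sum.inl ≠ 0) (hr : z ∘ Sum.inr ≠ 0) (hl' : ∀ i, d i ∘ Sum.inl ≠ 0)
    (hr' : ∀ i, d i ∘ Sum.inr ≠ 0) (h : ∀ i, ¬ BiProportional z (d i)) :
    ∃ P ∈ biForms k n n, (∀ i, eval (d i) P = 0) ∧ eval z P ≠ 0 := by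
  choose P hP h0 h1 using fun i => exists_bilinear_separator hl hr (hl' i) (hr' i) (h i)
  refine ⟨∏ i, P i, ?_, fun i => ?_, ?_⟩
  · have : ∀ s : Finset (Fin n), ∏ i ∈ s, P i ∈ biForms k s.card s.card := by
      intro s
      induction s using Finset.induction_on with
      | empty => simpa using one_mem_biForms
      | insert i s hi ih =>
        rw [Finset.prod_insert hi, Finset.card_insert_of_notMem hi, add_comm]
        exact biForms_mul_mem (hP i) ih
    simpa using this Finset.univ
  · rw [map_prod]
    exact Finset.prod_eq_zero (Finset.mem_univ i) (h0 i)
  · rw [map_prod]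
    exact Finset.prod_ne_zero_iff.2 fun i _ => h1 i

/-- Lower bound on the number of points, and independence of conics at the points. -/
theorem eval_conics_injective {m n : ℕ} {g : Fin m → Fin 3 ⊕ Fin 3 → k}
    {d : Fin n → Fin 3 ⊕ Fin 3 → k} (h : SameMoments g d) (h11 : SeparatedBy 1 1 d)
    {q : MvPolynomial (Fin 3 ⊕ Fin 3) k} (hq : q ∈ biForms k 0 2) (i : Fin n)
    (hg : ∀ j, eval (g j) q = 0) : eval (d i) q = 0 := by
  obtain ⟨p, hp, hpd⟩ := h11
  have := h (p i * q) (biForms_mul_mem (hp i) hq)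
  simpa [hg, hpd] using this.symm

/-- A flattening bound. A combination of the conics dual to `d` that vanishes on `g` vanishes on
`d`, hence is zero, so evaluation at `g` embeds an `n`-dimensional space into `k ^ m`. -/
theorem card_le_of_sameMoments {m n : ℕ} {g : Fin m → Fin 3 ⊕ Fin 3 → k}
    {d : Fin n → Fin 3 ⊕ Fin 3 → k} (h : SameMoments g d) (h11 : SeparatedBy 1 1 d)
    (h02 : SeparatedBy 0 2 d) : n ≤ m := by
  obtain ⟨q, hq, hqd⟩ := h02
  let Φ : (Fin n → k) →ₗ[k] (Fin m → k) :=
    LinearMap.pi fun j => ∑ i, (eval (g j) (q i)) • LinearMap.proj i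
  have hΦ : ∀ x j, Φ x j = eval (g j) (∑ i, C (x i) * q i) := fun x j => by
    simp [Φ, LinearMap.sum_apply, mul_comm]
  have hinj : Function.Injective Φ := by
    refine (injective_iff_map_eq_zero Φ).2 fun x hx => funext fun i => ?_
    have := eval_conics_injective h h11 (q := ∑ i, C (x i) * q i)
      (Submodule.sum_mem _ fun i _ => by
        rw [← smul_eq_C_mul]; exact Submodule.smul_mem _ _ (hq i)) i
      (fun j => by rw [← hΦ, hx]; rfl)
    simpa [hqd] using this
  simpa using LinearMap.finrank_le_finrank_of_injective hinj

/-- With equally many points the injection behind `card_le_of_sameMoments` is bijective, and the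
preimages of the unit vectors are conics dual to `g`. -/
theorem separatedBy_conics_of_sameMoments {n : ℕ} {g d : Fin n → Fin 3 ⊕ Fin 3 → k}
    (h : SameMoments g d) (h11 : SeparatedBy 1 1 d) (h02 : SeparatedBy 0 2 d) :
    SeparatedBy 0 2 g := by
  obtain ⟨q, hq, hqd⟩ := h02
  let Φ : (Fin n → k) →ₗ[k] (Fin n → k) :=
    LinearMap.pi fun j => ∑ i, (eval (g j) (q i)) • LinearMap.proj i
  have hΦ : ∀ x j, Φ x j = eval (g j) (∑ i, C (x i) * q i) := fun x j => by
    simp [Φ, LinearMap.sum_apply, mul_comm]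
  have hmem : ∀ x : Fin n → k, ∑ i, C (x i) * q i ∈ biForms k 0 2 := fun x =>
    Submodule.sum_mem _ fun i _ => by
      rw [← smul_eq_C_mul]; exact Submodule.smul_mem _ _ (hq i)
  have hinj : Function.Injective Φ := by
    refine (injective_iff_map_eq_zero Φ).2 fun x hx => funext fun i => ?_
    have := eval_conics_injective h h11 (hmem x) i (fun j => by rw [← hΦ, hx]; rfl)
    simpa [hqd] using this
  have hsurj := LinearMap.surjective_of_injective hinj
  choose x hx using fun i : Fin n => hsurj (Pi.single i 1)
  refine ⟨fun i => ∑ r, C (x i r) * q r, fun i => hmem _, fun i j => ?_⟩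
  rw [← hΦ, hx, Pi.single_apply]
  simp [eq_comm]

/-- Forms of bidegree `(1, 1)` vanishing on `d` vanish on every family with the same moments. -/
theorem eval_eq_zero_of_sameMoments {n : ℕ} {g d : Fin n → Fin 3 ⊕ Fin 3 → k}
    (h : SameMoments g d) (h02 : SeparatedBy 0 2 g)
    {K : MvPolynomial (Fin 3 ⊕ Fin 3) k} (hK : K ∈ biForms k 1 1) (hd : ∀ i, eval (d i) K = 0)
    (j : Fin n) : eval (g j) K = 0 := by
  obtain ⟨q, hq, hqg⟩ := h02
  simpa [hd, hqg] using h (K * q j) (biForms_mul_mem hK (hq j))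

theorem inr_ne_zero_of_separatedBy {n : ℕ} {g : Fin n → Fin 3 ⊕ Fin 3 → k}
    (h02 : SeparatedBy 0 2 g) (j : Fin n) : g j ∘ Sum.inr ≠ 0 := by
  intro h0
  obtain ⟨q, hq, hqg⟩ := h02
  have h1 : g j = biScale 1 0 (g j) := by
    ext i; rcases i with i | i
    · simp [biScale]
    · simpa [biScale] using congrFun h0 i
  have h2 := hqg j j
  rw [h1, eval_biScale (hq j)] at h2
  simp at h2

/-- A point with zero first component contributes nothing to the (1,3)-moments. Deleting it would
leave a family with the same moments and too few points. -/
theorem inl_ne_zero_of_sameMoments {n : ℕ} {g d : Fin n → Fin 3 ⊕ Fin 3 → k}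
    (h : SameMoments g d) (h11 : SeparatedBy 1 1 d) (h02 : SeparatedBy 0 2 d) (j : Fin n) :
    g j ∘ Sum.inl ≠ 0 := by
  intro h0
  obtain _ | n := n
  · exact j.elim0
  have h1 : g j = biScale 0 1 (g j) := by
    ext i; rcases i with i | i
    · simpa [biScale] using congrFun h0 i
    · simp [biScale]
  have h2 : SameMoments (fun i => g (j.succAbove i)) d := fun P hP => by
    rw [← h P hP, Fin.sum_univ_succAbove _ j, h1, eval_biScale hP]
    simp
  have := card_le_of_sameMoments h2 h11 h02
  omega

end Uniqueness

/-! ### Residual pairs and the uniqueness argument on the curve -/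

section Uniqueness

open MvPolynomial

variable {k : Type*} [Field k]

/-- Membership in the ideal generated by `s` and the `K c`, with a quotient in a prescribed set. -/
def InIdeal (s : MvPolynomial (Fin 3 ⊕ Fin 3) k) (K : Fin 3 → MvPolynomial (Fin 3 ⊕ Fin 3) k)
    (W : Submodule k (MvPolynomial (Fin 3 ⊕ Fin 3) k)) (P : MvPolynomial (Fin 3 ⊕ Fin 3) k) :
    Prop :=
  ∃ h ∈ W, ∃ κ : Fin 3 → MvPolynomial (Fin 3 ⊕ Fin 3) k, P = s * h + ∑ c, K c * κ c

/-- Two families of six points on the curve `K = 0` in the product of two planes, forming together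
the transversal zero locus on the curve of a form `s` of bidegree `(1, 3)`, with the interpolation
properties of a general such pair. -/
structure ResidualPair (d d' : Fin 6 → Fin 3 ⊕ Fin 3 → k) where
  same : SameMoments d' d
  bilinear : SeparatedBy 1 1 d
  conics : SeparatedBy 0 2 d
  K : Fin 3 → MvPolynomial (Fin 3 ⊕ Fin 3) k
  K_mem : ∀ c, K c ∈ biForms k 1 1
  K_left : ∀ c i, eval (d i) (K c) = 0
  s : MvPolynomial (Fin 3 ⊕ Fin 3) k
  s_mem : s ∈ biForms k 1 3
  s_left : ∀ i, eval (d i) s = 0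
  s_right : ∀ i, eval (d' i) s = 0
  τ : Fin 6 → Fin 3 ⊕ Fin 3 → k
  τ' : Fin 6 → Fin 3 ⊕ Fin 3 → k
  K_tangent : ∀ c i, dirDeriv (d i) (τ i) (K c) = 0
  K_tangent' : ∀ c i, dirDeriv (d' i) (τ' i) (K c) = 0
  s_transversal : ∀ i, dirDeriv (d i) (τ i) s ≠ 0
  s_transversal' : ∀ i, dirDeriv (d' i) (τ' i) s ≠ 0
  -- Bidegree (2,6) is that of a product of two forms of bidegree (1,3).
  generation : ∀ P ∈ biForms k 2 6, (∀ i, eval (d i) P = 0) → (∀ i, eval (d' i) P = 0) →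
    InIdeal s K (biForms k 1 3) P
  -- Bidegree (12,12) is that of a product of twelve bilinear separators, one for each of the
  -- points.
  cut_out : ∀ P ∈ biForms k 12 12, (∀ i, eval (d i) P = 0) → (∀ i, eval (d' i) P = 0) →
    InIdeal s K ⊤ P
  -- A form of bidegree (1,3) vanishing on `d` with prescribed tangential derivatives there.
  jet : (Fin 6 → k) →ₗ[k] MvPolynomial (Fin 3 ⊕ Fin 3) k
  jet_mem : ∀ y, jet y ∈ biForms k 1 3
  eval_jet : ∀ y i, eval (d i) (jet y) = 0
  dirDeriv_jet : ∀ y i, dirDeriv (d i) (τ i) (jet y) = y i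
  -- The genericity condition: twice the divisor `d`, of degree 12, is not cut out on the curve by a
  -- form of bidegree (1,3).
  double : ∀ t ∈ biForms k 1 3, (∀ i, eval (d i) t = 0) → (∀ i, dirDeriv (d i) (τ i) t = 0) →
    ∃ κ : Fin 3 → MvPolynomial (Fin 3 ⊕ Fin 3) k, t = ∑ c, K c * κ c
  -- The zero sum is forced by `same`; it is the only relation among the twelve evaluations.
  interpolation : ∀ x : Fin 6 → k, ∑ i, x i = 0 →
    ∃ h ∈ biForms k 1 3, (∀ i, eval (d' i) h = 0) ∧ ∀ i, eval (d i) h = x i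

theorem BiProportional.eval_eq_zero_iff {z z' : Fin 3 ⊕ Fin 3 → k} (h : BiProportional z z')
    {a b : ℕ} {P : MvPolynomial (Fin 3 ⊕ Fin 3) k} (hP : P ∈ biForms k a b) :
    eval z P = 0 ↔ eval z' P = 0 := by
  obtain ⟨c, c', hc, hc', rfl⟩ := h
  rw [eval_biScale hP]
  simp [hc, hc']

theorem ResidualPair.conics' {d d' : Fin 6 → Fin 3 ⊕ Fin 3 → k} (R : ResidualPair d d') :
    SeparatedBy 0 2 d' :=
  separatedBy_conics_of_sameMoments R.same R.bilinear R.conics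

theorem ResidualPair.K_right {d d' : Fin 6 → Fin 3 ⊕ Fin 3 → k} (R : ResidualPair d d')
    (c : Fin 3) (i : Fin 6) : eval (d' i) (R.K c) = 0 :=
  eval_eq_zero_of_sameMoments R.same R.conics' (R.K_mem c) (R.K_left c) i

/-- The only zeros of `s` on the curve are the points of the two families. -/
theorem ResidualPair.mem_of_eval_eq_zero {d d' : Fin 6 → Fin 3 ⊕ Fin 3 → k}
    (R : ResidualPair d d') {z : Fin 3 ⊕ Fin 3 → k} (hl : z ∘ Sum.inl ≠ 0)
    (hr : z ∘ Sum.inr ≠ 0) (hK : ∀ c, eval z (R.K c) = 0) (hs : eval z R.s = 0) :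
    (∃ i, BiProportional z (d i)) ∨ ∃ i, BiProportional z (d' i) := by
  by_contra! H
  obtain ⟨H1, H2⟩ := H
  have hself : SameMoments d d := fun _ _ => rfl
  obtain ⟨P, hP, h0, h1⟩ := exists_product_separator hl hr
    (fun i => inl_ne_zero_of_sameMoments hself R.bilinear R.conics i)
    (fun i => inr_ne_zero_of_separatedBy R.conics i) H1
  obtain ⟨Q, hQ, h0', h1'⟩ := exists_product_separator hl hr
    (fun i => inl_ne_zero_of_sameMoments R.same R.bilinear R.conics i)
    (fun i => inr_ne_zero_of_separatedBy R.conics' i) H2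
  obtain ⟨h, -, κ, e⟩ := R.cut_out (P * Q) (biForms_mul_mem hP hQ)
    (fun i => by simp [h0]) (fun i => by simp [h0'])
  have := congrArg (eval z) e
  simp [hs, hK, h1, h1'] at this

theorem exists_constant_of_orthogonal {n : ℕ} (y : Fin n → k)
    (h : ∀ x : Fin n → k, ∑ i, x i = 0 → ∑ i, x i * y i = 0) : ∃ c, ∀ i, y i = c := by
  obtain _ | n := n
  · exact ⟨0, fun i => i.elim0⟩
  refine ⟨y 0, fun i => ?_⟩
  have := h (Pi.single i 1 - Pi.single 0 1) (by simp [Finset.sum_sub_distrib])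
  simp only [Pi.sub_apply, sub_mul, Finset.sum_sub_distrib, Pi.single_apply, ite_mul, zero_mul,
    one_mul, Finset.sum_ite_eq', Finset.mem_univ, if_true] at this
  exact sub_eq_zero.1 this

/-- A family of six points with the same moments as a residual pair agrees with one of its two
members. -/
theorem ResidualPair.unique {d d' : Fin 6 → Fin 3 ⊕ Fin 3 → k} (R : ResidualPair d d')
    {g : Fin 6 → Fin 3 ⊕ Fin 3 → k} (hg : SameMoments g d) :
    (∀ j, ∃ i, BiProportional (g j) (d i)) ∨ ∀ j, ∃ i, BiProportional (g j) (d' i) := by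
  classical
  by_cases hall : ∀ j, ∃ i, BiProportional (g j) (d i)
  · exact Or.inl hall
  right
  push Not at hall
  obtain ⟨j₀, hj₀⟩ := hall
  have hconics := separatedBy_conics_of_sameMoments hg R.bilinear R.conics
  have hK : ∀ c j, eval (g j) (R.K c) = 0 := fun c j =>
    eval_eq_zero_of_sameMoments hg hconics (R.K_mem c) (R.K_left c) j
  have hl := inl_ne_zero_of_sameMoments hg R.bilinear R.conics
  have hr := inr_ne_zero_of_separatedBy hconics
  -- A form vanishing on both families, doubly at the common points.
  let δ : (Fin 6 → k) →ₗ[k] (Fin 6 → k) := LinearMap.pi fun j =>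
    if h : ∃ i, BiProportional (g j) (d i) then LinearMap.proj h.choose
    else (aeval (g j)).toLinearMap ∘ₗ R.jet
  have δ_common : ∀ y j (h : ∃ i, BiProportional (g j) (d i)), δ y j = y h.choose :=
    fun y j h => by simp only [δ, LinearMap.pi_apply, dif_pos h, LinearMap.proj_apply]
  have δ_other : ∀ y j, (¬ ∃ i, BiProportional (g j) (d i)) → δ y j = eval (g j) (R.jet y) :=
    fun y j h => by
      simp only [δ, LinearMap.pi_apply, dif_neg h, LinearMap.comp_apply, AlgHom.toLinearMap_apply,
        aeval_eq_eval]
  have jet_common : ∀ y j, (∃ i, BiProportional (g j) (d i)) → eval (g j) (R.jet y) = 0 := by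
    rintro y j ⟨i, hi⟩
    exact (hi.eval_eq_zero_iff (R.jet_mem y)).2 (R.eval_jet y i)
  -- If `δ` were injective, it would be surjective, and some jet would vanish on `d` and at every `g
  -- j` except `g j₀`, where its value is 1. This contradicts equality of moments.
  obtain ⟨y, hy, hy0⟩ : ∃ y, δ y = 0 ∧ y ≠ 0 := by
    by_contra! H
    have hsurj := LinearMap.surjective_of_injective ((injective_iff_map_eq_zero δ).2 H)
    obtain ⟨y, hy⟩ := hsurj (Pi.single j₀ 1)
    have hsum := hg (R.jet y) (R.jet_mem y)
    rw [Finset.sum_eq_zero (fun i _ => R.eval_jet y i), Finset.sum_eq_single j₀] at hsum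
    · rw [← δ_other y j₀ (by push Not; exact hj₀), hy] at hsum
      simp at hsum
    · intro j _ hj
      by_cases h : ∃ i, BiProportional (g j) (d i)
      · exact jet_common y j h
      · rw [← δ_other y j h, hy]; simp [hj]
    · simp
  have ht : ∀ j, eval (g j) (R.jet y) = 0 := fun j => by
    by_cases h : ∃ i, BiProportional (g j) (d i)
    · exact jet_common y j h
    · rw [← δ_other y j h, hy]; rfl
  have hy_common : ∀ j, (∃ i, BiProportional (g j) (d i)) →
      ∃ i, BiProportional (g j) (d i) ∧ y i = 0 := fun j h =>
    ⟨h.choose, h.choose_spec, by rw [← δ_common y j h, hy]; rfl⟩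
  -- The derivatives of this form are proportional to those of `s`.
  obtain ⟨c, hc⟩ := exists_constant_of_orthogonal
      (fun i => y i / dirDeriv (d i) (R.τ i) R.s) fun x hx => by
    obtain ⟨h', hh', h'0, h'x⟩ := R.interpolation x hx
    -- The form `h' * R.jet y` vanishes at all twelve points, so on the curve it is divisible by
    -- `s`. The quotient `h` plays the part of a residue numerator.
    obtain ⟨h, hh, κ, e⟩ := R.generation (h' * R.jet y) (biForms_mul_mem hh' (R.jet_mem y))
      (fun i => by simp [R.eval_jet]) (fun i => by simp [h'0])
    -- Differentiate along the curve at `d i`: the `K` terms drop out, and `s` and the jet vanish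
    -- there.
    have key : ∀ i, x i * y i = dirDeriv (d i) (R.τ i) R.s * eval (d i) h := fun i => by
      have := congrArg (dirDeriv (d i) (R.τ i)) e
      simpa [dirDeriv_mul, R.eval_jet, R.dirDeriv_jet, h'x, R.s_left, R.K_left, R.K_tangent]
        using this
    -- Three cases: at a point shared with `d` the relation `key` applies with `y i = 0`; at a point
    -- shared with `d'` both factors on the left vanish, so the derivative of the product does too;
    -- elsewhere `s` is non-zero and can be cancelled.
    have hgj : ∀ j, eval (g j) h = 0 := fun j => by
      by_cases h1 : ∃ i, BiProportional (g j) (d i)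
      · obtain ⟨i, hi, hyi⟩ := hy_common j h1
        rw [hi.eval_eq_zero_iff hh]
        have := key i
        rw [hyi, mul_zero, eq_comm] at this
        exact (mul_eq_zero.1 this).resolve_left (R.s_transversal i)
      by_cases h2 : ∃ i, BiProportional (g j) (d' i)
      · obtain ⟨i, hi⟩ := h2
        rw [hi.eval_eq_zero_iff hh]
        have hti := (hi.eval_eq_zero_iff (R.jet_mem y)).1 (ht j)
        have := congrArg (dirDeriv (d' i) (R.τ' i)) e
        simp only [dirDeriv_mul, h'0, hti, map_add, map_sum, R.s_right, R.K_right, R.K_tangent',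
          mul_zero, zero_mul, add_zero, Finset.sum_const_zero] at this
        exact (mul_eq_zero.1 this.symm).resolve_left (R.s_transversal' i)
      · have hs : eval (g j) R.s ≠ 0 := fun hs =>
          (R.mem_of_eval_eq_zero (hl j) (hr j) (fun c => hK c j) hs).elim h1 h2
        have := congrArg (eval (g j)) e
        simp only [map_mul, map_add, map_sum, ht, hK, mul_zero, zero_mul, add_zero,
          Finset.sum_const_zero] at this
        exact (mul_eq_zero.1 this.symm).resolve_left hs
    -- Equality of moments for `h` turns its vanishing on `g` into orthogonality of `x` to the
    -- ratios of derivatives.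
    have hsum := hg h hh
    rw [Finset.sum_eq_zero fun j _ => hgj j] at hsum
    rw [hsum]
    refine Finset.sum_congr rfl fun i _ => ?_
    rw [← mul_div_assoc, key i, mul_div_cancel_left₀ _ (R.s_transversal i)]
  have hyc : ∀ i, y i = c * dirDeriv (d i) (R.τ i) R.s := fun i => by
    rw [← hc i, div_mul_cancel₀ _ (R.s_transversal i)]
  have hc0 : c ≠ 0 := by
    rintro rfl
    exact hy0 (funext fun i => by simp [hyc])
  -- The jet minus `c • s` vanishes doubly on `d`, so it vanishes on the curve. Hence `s` vanishes
  -- on `g`, and a point shared with `d` is excluded because the derivative of the jet there would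
  -- be both zero and non-zero.
  obtain ⟨κ, e⟩ := R.double (R.jet y - c • R.s)
    (Submodule.sub_mem _ (R.jet_mem y) (Submodule.smul_mem _ _ R.s_mem))
    (fun i => by simp [R.eval_jet, R.s_left])
    (fun i => by simp [R.dirDeriv_jet, hyc])
  intro j
  have hs : eval (g j) R.s = 0 := by
    have := congrArg (eval (g j)) e
    simpa [ht, hK, hc0] using this
  refine (R.mem_of_eval_eq_zero (hl j) (hr j) (fun c => hK c j) hs).resolve_left fun h1 => ?_
  obtain ⟨i, -, hyi⟩ := hy_common j h1
  rw [hyc] at hyi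
  exact (mul_ne_zero hc0 (R.s_transversal i)) hyi

end Uniqueness

/-! ### Persistence of linear-algebra conditions along a filter -/

section Perturbation

open Filter

variable {X M : Type*} [AddCommGroup M] [Module ℂ M] {l : Filter X}

/-- Pointwise convergence of linear functionals. -/
def WTendsto (l : Filter X) (φ : X → M →ₗ[ℂ] ℂ) (φ₀ : M →ₗ[ℂ] ℂ) : Prop :=
  ∀ P, Tendsto (fun p => φ p P) l (𝓝 (φ₀ P))

/-- Convergence of vectors inside a finite-dimensional affine subspace. -/
def STendsto (l : Filter X) (S : X → M) (S₀ : M) : Prop :=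
  ∃ (n : ℕ) (z : X → Fin n → ℂ) (B : Fin n → M), Tendsto z l (𝓝 0) ∧
    ∀ p, S p = S₀ + ∑ j, z p j • B j

theorem WTendsto.apply {φ : X → M →ₗ[ℂ] ℂ} {φ₀ : M →ₗ[ℂ] ℂ} (hφ : WTendsto l φ φ₀)
    {S : X → M} {S₀ : M} (hS : STendsto l S S₀) :
    Tendsto (fun p => φ p (S p)) l (𝓝 (φ₀ S₀)) := by
  obtain ⟨n, z, B, hz, hS⟩ := hS
  simp only [hS, map_add, map_sum, map_smul, smul_eq_mul]
  have hz' : ∀ j, Tendsto (fun p => z p j) l (𝓝 0) := fun j => (tendsto_pi_nhds.1 hz) j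
  have h : Tendsto (fun p => φ p S₀ + ∑ j, z p j * φ p (B j)) l
      (𝓝 (φ₀ S₀ + ∑ j, 0 * φ₀ (B j))) :=
    (hφ S₀).add (tendsto_finsetSum _ fun j _ => (hz' j).mul (hφ (B j)))
  simpa using h

theorem STendsto.apply {S : X → M} {S₀ : M} (hS : STendsto l S S₀) (φ : M →ₗ[ℂ] ℂ) :
    Tendsto (fun p => φ (S p)) l (𝓝 (φ S₀)) :=
  WTendsto.apply (φ := fun _ => φ) (fun _ => tendsto_const_nhds) hS

/-- Linearly independent functionals are jointly surjective. -/
theorem exists_forall_eq_of_independent {ι : Type*} [Fintype ι] {W : Submodule ℂ M}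
    (φ : ι → M →ₗ[ℂ] ℂ)
    (h : ∀ c : ι → ℂ, (∀ P ∈ W, ∑ i, c i * φ i P = 0) → c = 0) (y : ι → ℂ) :
    ∃ P ∈ W, ∀ i, φ i P = y i := by
  classical
  let Φ : W →ₗ[ℂ] (ι → ℂ) := LinearMap.pi fun i => φ i ∘ₗ W.subtype
  suffices hΦ : Function.Surjective Φ by
    obtain ⟨P, hP⟩ := hΦ y
    exact ⟨P, P.2, fun i => congrFun hP i⟩
  rw [← LinearMap.range_eq_top]
  by_contra hne
  obtain ⟨f, hf, hf'⟩ := Submodule.exists_dual_map_eq_bot_of_lt_top (lt_top_iff_ne_top.2 hne)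
    inferInstance
  have hfr : ∀ w, f w = ∑ i, f (Pi.single i 1) * w i := fun w => by
    conv_lhs => rw [pi_eq_sum_univ' w]
    simp [mul_comm, Pi.single]
  refine hf ?_
  have := h (fun i => f (Pi.single i 1)) fun P hP => by
    have h1 : f (Φ ⟨P, hP⟩) = 0 := by
      have : f (Φ ⟨P, hP⟩) ∈ (LinearMap.range Φ).map f := ⟨_, ⟨_, rfl⟩, rfl⟩
      rwa [hf', Submodule.mem_bot] at this
    rw [← h1, hfr]
    rfl
  ext i
  simpa using congrFun this i

theorem tendsto_matrix_det {ι : Type*} [Fintype ι] [DecidableEq ι] {N : X → Matrix ι ι ℂ}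
    {N₀ : Matrix ι ι ℂ} (hN : Tendsto N l (𝓝 N₀)) :
    Tendsto (fun p => (N p).det) l (𝓝 N₀.det) :=
  ((Continuous.matrix_det (continuous_id (X := Matrix ι ι ℂ))).tendsto N₀).comp hN

/-- Solutions of a surjective linear system persist under perturbation of the system. -/
theorem exists_perturbed_solution {ι : Type*} [Fintype ι] {W : Submodule ℂ M}
    {φ : ι → X → M →ₗ[ℂ] ℂ} {φ₀ : ι → M →ₗ[ℂ] ℂ} (hφ : ∀ i, WTendsto l (φ i) (φ₀ i))
    (hsurj : ∀ y : ι → ℂ, ∃ P ∈ W, ∀ i, φ₀ i P = y i) {S₀ : M} (hS₀ : S₀ ∈ W) :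
    ∃ S : X → M, STendsto l S S₀ ∧ (∀ p, S p ∈ W) ∧ ∀ᶠ p in l, ∀ i, φ i p (S p) = φ₀ i S₀ := by
  classical
  choose B hB hBφ using fun i : ι => hsurj (Pi.single i 1)
  -- The perturbed functionals on a basis dual to the limits; this tends to the identity, so the
  -- defect `r` can be corrected by `N⁻¹ r`, which tends to zero.
  let N : X → Matrix ι ι ℂ := fun p => Matrix.of fun i j => φ i p (B j)
  have hN : Tendsto N l (𝓝 1) := by
    refine tendsto_pi_nhds.2 fun i => tendsto_pi_nhds.2 fun j => ?_
    have := hφ i (B j)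
    rwa [hBφ j, Pi.single_apply] at this
  have hdet : Tendsto (fun p => (N p).det) l (𝓝 1) := by
    simpa using tendsto_matrix_det hN
  have hinv : Tendsto (fun p => (N p)⁻¹) l (𝓝 1) := by
    have h1 := (Continuous.matrix_adjugate (continuous_id (X := Matrix ι ι ℂ))).tendsto 1
    simp only [id, Matrix.adjugate_one] at h1
    have h2 := (hdet.inv₀ one_ne_zero).smul (h1.comp hN)
    simpa [Matrix.inv_def, Ring.inverse_eq_inv', Function.comp_def] using h2
  let r : X → ι → ℂ := fun p i => φ₀ i S₀ - φ i p S₀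
  have hr : Tendsto r l (𝓝 0) := tendsto_pi_nhds.2 fun i => by
    simpa using (tendsto_const_nhds (x := φ₀ i S₀)).sub (hφ i S₀)
  let z : X → ι → ℂ := fun p => (N p)⁻¹.mulVec (r p)
  have hz : Tendsto z l (𝓝 0) := by
    have := (Continuous.matrix_mulVec (continuous_fst (X := Matrix ι ι ℂ) (Y := ι → ℂ))
      continuous_snd).tendsto (1, 0)
    have h2 := this.comp (hinv.prodMk_nhds hr)
    simpa [Function.comp_def] using h2
  let e := Fintype.equivFin ι
  refine ⟨fun p => S₀ + ∑ j, z p j • B j, ⟨Fintype.card ι, fun p j => z p (e.symm j),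
    fun j => B (e.symm j), ?_, fun p => ?_⟩, fun p => ?_, ?_⟩
  · exact tendsto_pi_nhds.2 fun j => (tendsto_pi_nhds.1 hz) (e.symm j)
  · exact congrArg (S₀ + ·) (e.symm.sum_comp fun j => z p j • B j).symm
  · exact Submodule.add_mem _ hS₀
      (Submodule.sum_mem _ fun j _ => Submodule.smul_mem _ _ (hB j))
  · filter_upwards [hdet.eventually_ne one_ne_zero] with p hp i
    have h1 : (N p).mulVec (z p) = r p := by
      simp only [z, Matrix.mulVec_mulVec, Matrix.mul_nonsing_inv _ (isUnit_iff_ne_zero.2 hp),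
        Matrix.one_mulVec]
    have h2 := congrFun h1 i
    simp only [Matrix.mulVec, dotProduct, N, Matrix.of_apply, r] at h2
    simp only [map_add, map_sum, map_smul, smul_eq_mul]
    rw [show ∑ j, z p j * φ i p (B j) = ∑ j, φ i p (B j) * z p j from
      Finset.sum_congr rfl fun j _ => mul_comm _ _, h2]
    ring

/-- Surjectivity onto a finite-dimensional space persists under perturbation. -/
theorem eventually_le_range {E : Type*} [AddCommGroup E] [Module ℂ E] {W : Submodule ℂ M}
    [FiniteDimensional ℂ W] {A : X → E →ₗ[ℂ] M} {A₀ : E →ₗ[ℂ] M}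
    (hA : ∀ e (φ : M →ₗ[ℂ] ℂ), Tendsto (fun p => φ (A p e)) l (𝓝 (φ (A₀ e))))
    (hW : ∀ p e, A p e ∈ W) (h₀ : W ≤ LinearMap.range A₀) :
    ∀ᶠ p in l, W ≤ LinearMap.range (A p) := by
  classical
  let b := Module.finBasis ℂ W
  choose e he using fun i => h₀ (b i).2
  -- A linear retraction onto `W` turns coordinates on `W` into functionals on `M`, to which `hA`
  -- applies.
  obtain ⟨π, hπ⟩ := W.subtype.exists_leftInverse_of_injective (Submodule.ker_subtype W)
  have hπ' : ∀ w : W, π w = w := fun w => LinearMap.congr_fun hπ w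
  let N : X → Matrix _ _ ℂ := fun p => Matrix.of fun i j => b.coord j (π (A p (e i)))
  have hN : Tendsto N l (𝓝 1) := by
    refine tendsto_pi_nhds.2 fun i => tendsto_pi_nhds.2 fun j => ?_
    have := hA (e i) (b.coord j ∘ₗ π)
    rw [he i, LinearMap.comp_apply, hπ', b.coord_apply, b.repr_self, Finsupp.single_apply] at this
    exact this
  have hdet : Tendsto (fun p => (N p).det) l (𝓝 1) := by
    simpa using tendsto_matrix_det hN
  filter_upwards [hdet.eventually_ne one_ne_zero] with p hp
  have hexp : ∀ i, A p (e i) = ∑ j, N p i j • (b j : M) := fun i => by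
    have h1 := b.sum_repr (π (A p (e i)))
    rw [show π (A p (e i)) = ⟨A p (e i), hW p (e i)⟩ from hπ' ⟨_, hW p (e i)⟩] at h1
    have h2 := congrArg W.subtype h1
    simp only [map_sum, map_smul, Submodule.subtype_apply] at h2
    rw [← h2]
    refine Finset.sum_congr rfl fun j _ => ?_
    simp only [N, Matrix.of_apply, b.coord_apply]
    rw [show π (A p (e i)) = ⟨A p (e i), hW p (e i)⟩ from hπ' ⟨_, hW p (e i)⟩]
  have hb : ∀ j, (b j : M) = A p (∑ i, (N p)⁻¹ j i • e i) := fun j => by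
    simp only [map_sum, map_smul, hexp, Finset.smul_sum, smul_smul]
    rw [Finset.sum_comm]
    simp only [← Finset.sum_smul, ← Matrix.mul_apply,
      Matrix.nonsing_inv_mul _ (isUnit_iff_ne_zero.2 hp), Matrix.one_apply, ite_smul, one_smul,
      zero_smul, Finset.sum_ite_eq, Finset.mem_univ, if_true]
  intro w hw
  have h1 := congrArg W.subtype (b.sum_repr ⟨w, hw⟩)
  simp only [map_sum, map_smul, Submodule.subtype_apply] at h1
  rw [← h1]
  exact Submodule.sum_mem _ fun j _ => Submodule.smul_mem _ _ ⟨_, (hb j).symm⟩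

/-- Injectivity of a square system of functionals on given vectors persists. -/
theorem eventually_injective {ι : Type*} [Fintype ι] {φ : ι → X → M →ₗ[ℂ] ℂ}
    {φ₀ : ι → M →ₗ[ℂ] ℂ} (hφ : ∀ i, WTendsto l (φ i) (φ₀ i)) (e : ι → M)
    (h₀ : ∀ x : ι → ℂ, (∀ i, φ₀ i (∑ j, x j • e j) = 0) → x = 0) :
    ∀ᶠ p in l, ∀ x : ι → ℂ, (∀ i, φ i p (∑ j, x j • e j) = 0) → x = 0 := by
  classical
  let N : X → Matrix ι ι ℂ := fun p => Matrix.of fun i j => φ i p (e j)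
  let N₀ : Matrix ι ι ℂ := Matrix.of fun i j => φ₀ i (e j)
  have hN : Tendsto N l (𝓝 N₀) :=
    tendsto_pi_nhds.2 fun i => tendsto_pi_nhds.2 fun j => hφ i (e j)
  have hdet : Tendsto (fun p => (N p).det) l (𝓝 N₀.det) :=
    tendsto_matrix_det hN
  have hN₀ : N₀.det ≠ 0 := fun h => by
    obtain ⟨x, hx, hx0⟩ := Matrix.exists_mulVec_eq_zero_iff.2 h
    refine hx (h₀ x fun i => ?_)
    have := congrFun hx0 i
    simpa [Matrix.mulVec, dotProduct, N₀, mul_comm] using this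
  filter_upwards [hdet.eventually_ne hN₀] with p hp x hx
  by_contra hne
  refine hp (Matrix.exists_mulVec_eq_zero_iff.1 ⟨x, hne, funext fun i => ?_⟩)
  simpa [Matrix.mulVec, dotProduct, N, mul_comm] using hx i

theorem exists_forall_eq_of_injective {ι : Type*} [Fintype ι] {W : Submodule ℂ M}
    {φ : ι → M →ₗ[ℂ] ℂ} {e : ι → M} (he : ∀ i, e i ∈ W)
    (h : ∀ x : ι → ℂ, (∀ i, φ i (∑ j, x j • e j) = 0) → x = 0) (y : ι → ℂ) :
    ∃ P ∈ W, ∀ i, φ i P = y i := by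
  let Φ : (ι → ℂ) →ₗ[ℂ] (ι → ℂ) :=
    LinearMap.pi fun i => φ i ∘ₗ ∑ j, (LinearMap.proj j : (ι → ℂ) →ₗ[ℂ] ℂ).smulRight (e j)
  have hΦ : ∀ x i, Φ x i = φ i (∑ j, x j • e j) := fun x i => by
    simp [Φ]
  have hinj : Function.Injective Φ := (injective_iff_map_eq_zero Φ).2 fun x hx =>
    h x fun i => by rw [← hΦ, hx]; rfl
  obtain ⟨x, hx⟩ := LinearMap.surjective_of_injective hinj y
  exact ⟨_, Submodule.sum_mem _ fun j _ => Submodule.smul_mem _ (x j) (he j),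
    fun i => by rw [← hΦ, hx]⟩

end Perturbation

/-! ### Persistence of ideal membership -/

section PerturbedIdeals

open Filter MvPolynomial

variable {X : Type*} {l : Filter X}

theorem wTendsto_eval {z : X → Fin 3 ⊕ Fin 3 → ℂ} {z₀ : Fin 3 ⊕ Fin 3 → ℂ}
    (hz : Tendsto z l (𝓝 z₀)) :
    WTendsto l (fun p => (aeval (z p)).toLinearMap) (aeval z₀).toLinearMap := fun P => by
  simp only [AlgHom.toLinearMap_apply, aeval_eq_eval]
  exact ((MvPolynomial.continuous_eval P).tendsto z₀).comp hz

theorem wTendsto_dirDeriv {z τ : X → Fin 3 ⊕ Fin 3 → ℂ} {z₀ τ₀ : Fin 3 ⊕ Fin 3 → ℂ}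
    (hz : Tendsto z l (𝓝 z₀)) (hτ : Tendsto τ l (𝓝 τ₀)) :
    WTendsto l (fun p => dirDeriv (z p) (τ p)) (dirDeriv z₀ τ₀) := fun P => by
  simp only [dirDeriv_apply]
  exact tendsto_finsetSum _ fun i _ => ((tendsto_pi_nhds.1 hτ) i).mul
    (((MvPolynomial.continuous_eval _).tendsto z₀).comp hz)

/-- A form vanishing under the given functionals lies in the ideal generated by `s` and `K`, as
soon as this can be checked for the limit by a complement spanned by `e`. -/
theorem eventually_inIdeal {ι : Type*} [Fintype ι]
    {V₁ V₂ W : Submodule ℂ (MvPolynomial (Fin 3 ⊕ Fin 3) ℂ)} [FiniteDimensional ℂ W]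
    {s : X → MvPolynomial (Fin 3 ⊕ Fin 3) ℂ} {s₀ : MvPolynomial (Fin 3 ⊕ Fin 3) ℂ}
    {K : Fin 3 → X → MvPolynomial (Fin 3 ⊕ Fin 3) ℂ}
    {K₀ : Fin 3 → MvPolynomial (Fin 3 ⊕ Fin 3) ℂ}
    (hs : STendsto l s s₀) (hK : ∀ c, STendsto l (K c) (K₀ c))
    (hsW : ∀ p, ∀ h ∈ V₁, s p * h ∈ W) (hKW : ∀ c p, ∀ h ∈ V₂, K c p * h ∈ W)
    {e : ι → MvPolynomial (Fin 3 ⊕ Fin 3) ℂ} (he : ∀ i, e i ∈ W)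
    {φ : ι → X → MvPolynomial (Fin 3 ⊕ Fin 3) ℂ →ₗ[ℂ] ℂ}
    {φ₀ : ι → MvPolynomial (Fin 3 ⊕ Fin 3) ℂ →ₗ[ℂ] ℂ} (hφ : ∀ i, WTendsto l (φ i) (φ₀ i))
    (hφs : ∀ᶠ p in l, ∀ i, ∀ h ∈ V₁, φ i p (s p * h) = 0)
    (hφK : ∀ᶠ p in l, ∀ i c, ∀ h ∈ V₂, φ i p (K c p * h) = 0)
    (hinj : ∀ x : ι → ℂ, (∀ i, φ₀ i (∑ j, x j • e j) = 0) → x = 0)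
    (hgen : ∀ R : Submodule ℂ (MvPolynomial (Fin 3 ⊕ Fin 3) ℂ), (∀ h ∈ V₁, s₀ * h ∈ R) →
      (∀ c, ∀ h ∈ V₂, K₀ c * h ∈ R) → (∀ i, e i ∈ R) → W ≤ R) :
    ∀ᶠ p in l, ∀ P ∈ W, (∀ i, φ i p P = 0) → InIdeal (s p) (fun c => K c p) V₁ P := by
  classical
  -- The map sending quotients and coefficients to the ideal element plus a combination of the `e
  -- j`. At the limit it covers `W`, hence it does so nearby.
  let A : MvPolynomial (Fin 3 ⊕ Fin 3) ℂ → (Fin 3 → MvPolynomial (Fin 3 ⊕ Fin 3) ℂ) →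
      (V₁ × (Fin 3 → V₂) × (ι → ℂ)) →ₗ[ℂ] MvPolynomial (Fin 3 ⊕ Fin 3) ℂ := fun S L =>
    LinearMap.coprod (LinearMap.mulLeft ℂ S ∘ₗ V₁.subtype)
      (LinearMap.coprod (∑ c, LinearMap.mulLeft ℂ (L c) ∘ₗ V₂.subtype ∘ₗ LinearMap.proj c)
        (∑ j, (LinearMap.proj j : (ι → ℂ) →ₗ[ℂ] ℂ).smulRight (e j)))
  have hA : ∀ S L x, A S L x = S * x.1 + (∑ c, L c * x.2.1 c + ∑ j, x.2.2 j • e j) :=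
    fun S L x => by simp [A, LinearMap.sum_apply]
  have hmul : ∀ {S : X → MvPolynomial (Fin 3 ⊕ Fin 3) ℂ} {S₀ : MvPolynomial (Fin 3 ⊕ Fin 3) ℂ},
      STendsto l S S₀ → ∀ (φ : MvPolynomial (Fin 3 ⊕ Fin 3) ℂ →ₗ[ℂ] ℂ)
        (h : MvPolynomial (Fin 3 ⊕ Fin 3) ℂ),
        Tendsto (fun p => φ (S p * h)) l (𝓝 (φ (S₀ * h))) := fun hS φ h => by
    simpa only [LinearMap.comp_apply, LinearMap.mulRight_apply] using
      hS.apply (φ ∘ₗ LinearMap.mulRight ℂ h)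
  have hrange := eventually_le_range (l := l) (W := W) (A := fun p => A (s p) fun c => K c p)
    (A₀ := A s₀ K₀) (fun x φ => by
      simp only [hA, map_add, map_sum]
      exact (hmul hs φ _).add
        ((tendsto_finsetSum _ fun c _ => hmul (hK c) φ _).add tendsto_const_nhds))
    (fun p x => by
      rw [hA]
      exact Submodule.add_mem _ (hsW p _ x.1.2) (Submodule.add_mem _
        (Submodule.sum_mem _ fun c _ => hKW c p _ (x.2.1 c).2)
        (Submodule.sum_mem _ fun j _ => Submodule.smul_mem _ _ (he j))))
    (hgen _ (fun h hh => ⟨(⟨h, hh⟩, 0, 0), by simp [hA]⟩)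
      (fun c h hh => ⟨(0, Pi.single c ⟨h, hh⟩, 0), by
        rw [hA]
        simp only [Pi.zero_apply, zero_smul, Finset.sum_const_zero, add_zero,
          ZeroMemClass.coe_zero, mul_zero, zero_add]
        rw [Finset.sum_eq_single c]
        · simp
        · intro b _ hb; simp [hb]
        · simp⟩)
      (fun i => ⟨(0, 0, Pi.single i 1), by simp [hA, Pi.single_apply]⟩))
  filter_upwards [hrange, hφs, hφK, eventually_injective hφ e hinj] with p h1 h2 h3 h4 P hP hP0
  obtain ⟨x, rfl⟩ := h1 hP
  -- The functionals annihilate the ideal part, so they see only the combination of the `e j`, which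
  -- must be zero by persistent injectivity.
  have hx : x.2.2 = 0 := h4 _ fun i => by
    have := hP0 i
    rw [hA] at this
    simpa only [map_add, map_sum, h2 i _ x.1.2, h3 i _ _ (x.2.1 _).2, Finset.sum_const_zero,
      zero_add] using this
  exact ⟨x.1, x.1.2, fun c => x.2.1 c, by rw [hA, hx]; simp⟩

end PerturbedIdeals

/-! ### The hexagon x_c y_c = 0 and the ideal of twelve points on it -/

section HexagonGeneration

open MvPolynomial

/-- The coordinates on the first plane. -/
noncomputable abbrev xVar (i : Fin 3) : MvPolynomial (Fin 3 ⊕ Fin 3) ℂ := X (Sum.inl i)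

/-- The coordinates on the second plane. -/
noncomputable abbrev yVar (i : Fin 3) : MvPolynomial (Fin 3 ⊕ Fin 3) ℂ := X (Sum.inr i)

theorem xVar_pow_mem (i : Fin 3) (n : ℕ) : xVar i ^ n ∈ biForms ℂ n 0 := by
  simpa using biForms_pow_mem (X_inl_mem (k := ℂ) i) n

theorem yVar_pow_mem (i : Fin 3) (n : ℕ) : yVar i ^ n ∈ biForms ℂ 0 n := by
  simpa using biForms_pow_mem (X_inr_mem (k := ℂ) i) n

theorem y_monomial_mem (i j : Fin 3) {m n e : ℕ} (h : m + n = e) :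
    yVar i ^ m * yVar j ^ n ∈ biForms ℂ 0 e :=
  biForms_mul_mem (yVar_pow_mem i m) (yVar_pow_mem j n) rfl h

theorem x_monomial_mem (i j : Fin 3) {m n e : ℕ} (h : m + n = e) :
    xVar i ^ m * xVar j ^ n ∈ biForms ℂ e 0 :=
  biForms_mul_mem (xVar_pow_mem i m) (xVar_pow_mem j n) h rfl

theorem xy_mem {a b : ℕ} {P Q : MvPolynomial (Fin 3 ⊕ Fin 3) ℂ} (hP : P ∈ biForms ℂ a 0)
    (hQ : Q ∈ biForms ℂ 0 b) : P * Q ∈ biForms ℂ a b :=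
  biForms_mul_mem hP hQ (by simp) (by simp)

/-- The cubic `(2 y ^ 2 - 2 y z + z ^ 2) (y - z)`. -/
noncomputable def edgeCubic (i j : Fin 3) : MvPolynomial (Fin 3 ⊕ Fin 3) ℂ :=
  (2 : ℂ) • (yVar i ^ 3 * yVar j ^ 0) - (4 : ℂ) • (yVar i ^ 2 * yVar j ^ 1)
    + (3 : ℂ) • (yVar i ^ 1 * yVar j ^ 2) - yVar i ^ 0 * yVar j ^ 3

theorem edgeCubic_mem (i j : Fin 3) : edgeCubic i j ∈ biForms ℂ 0 3 :=
  Submodule.sub_mem _ (Submodule.add_mem _ (Submodule.sub_mem _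
    (Submodule.smul_mem _ _ (y_monomial_mem i j rfl))
    (Submodule.smul_mem _ _ (y_monomial_mem i j rfl)))
    (Submodule.smul_mem _ _ (y_monomial_mem i j rfl))) (y_monomial_mem i j rfl)

theorem exists_edgeCubic_eq_left (i j : Fin 3) :
    ∃ q ∈ biForms ℂ 0 2, edgeCubic i j = (2 : ℂ) • yVar i ^ 3 + yVar j * q :=
  ⟨-((4 : ℂ) • (yVar i ^ 2 * yVar j ^ 0)) + (3 : ℂ) • (yVar i ^ 1 * yVar j ^ 1)
      - yVar i ^ 0 * yVar j ^ 2,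
    Submodule.sub_mem _ (Submodule.add_mem _
      (Submodule.neg_mem _ (Submodule.smul_mem _ _ (y_monomial_mem i j rfl)))
      (Submodule.smul_mem _ _ (y_monomial_mem i j rfl))) (y_monomial_mem i j rfl), by
    simp only [edgeCubic, smul_eq_C_mul]; ring⟩

theorem exists_edgeCubic_eq_right (i j : Fin 3) :
    ∃ q ∈ biForms ℂ 0 2, edgeCubic i j = - yVar j ^ 3 + yVar i * q :=
  ⟨(2 : ℂ) • (yVar i ^ 2 * yVar j ^ 0) - (4 : ℂ) • (yVar i ^ 1 * yVar j ^ 1)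
      + (3 : ℂ) • (yVar i ^ 0 * yVar j ^ 2),
    Submodule.add_mem _ (Submodule.sub_mem _
      (Submodule.smul_mem _ _ (y_monomial_mem i j rfl))
      (Submodule.smul_mem _ _ (y_monomial_mem i j rfl)))
      (Submodule.smul_mem _ _ (y_monomial_mem i j rfl)), by
    simp only [edgeCubic, smul_eq_C_mul]; ring⟩

/-- The form cutting out the twelve base points on the hexagon. -/
noncomputable def baseForm : MvPolynomial (Fin 3 ⊕ Fin 3) ℂ :=
  xVar 0 * edgeCubic 1 2 + xVar 1 * edgeCubic 2 0 + xVar 2 * edgeCubic 0 1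

theorem baseForm_mem : baseForm ∈ biForms ℂ 1 3 :=
  Submodule.add_mem _ (Submodule.add_mem _
    (biForms_mul_mem (X_inl_mem _) (edgeCubic_mem _ _))
    (biForms_mul_mem (X_inl_mem _) (edgeCubic_mem _ _)))
    (biForms_mul_mem (X_inl_mem _) (edgeCubic_mem _ _))

section Membership

variable {a b : ℕ} {R : Submodule ℂ (MvPolynomial (Fin 3 ⊕ Fin 3) ℂ)} {i j k : Fin 3}

/-- On the hexagon edge y = e_i, where x_i = 0, `baseForm` is (2 x_k - x_j) y_i³. Its multiples
trade one x_j for 2 x_k modulo `R`, so one interior monomial on the edge yields all of them. -/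
theorem vertex_interior_mem
    (hs : baseForm = xVar i * edgeCubic j k + xVar j * edgeCubic k i + xVar k * edgeCubic i j)
    (hsR : ∀ h ∈ biForms ℂ (a + 1) (b + 1), baseForm * h ∈ R)
    (hKR : ∀ c, ∀ h ∈ biForms ℂ (a + 1) (b + 3), xVar c * yVar c * h ∈ R)
    (he : xVar j ^ (a + 1) * xVar k ^ 1 * yVar i ^ (b + 4) ∈ R) (p q : ℕ) (hpq : p + q = a) :
    xVar j ^ (p + 1) * xVar k ^ (q + 1) * yVar i ^ (b + 4) ∈ R := by
  induction q generalizing p with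
  | zero => obtain rfl : p = a := hpq; exact he
  | succ q ih =>
    have h1 := ih (p + 1) (by omega)
    obtain ⟨r, hr, er⟩ := exists_edgeCubic_eq_right k i
    obtain ⟨t, ht, et⟩ := exists_edgeCubic_eq_left i j
    have h2 := hsR (xVar j ^ (p + 1) * xVar k ^ (q + 1) * yVar i ^ (b + 1))
      (xy_mem (x_monomial_mem _ _ (by omega)) (yVar_pow_mem _ _))
    have h3 := hKR i (xVar j ^ (p + 1) * xVar k ^ (q + 1) * (edgeCubic j k * yVar i ^ b))
      (xy_mem (x_monomial_mem _ _ (by omega))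
        (biForms_mul_mem (edgeCubic_mem _ _) (yVar_pow_mem _ _) rfl (by omega)))
    have h4 := hKR k (xVar j ^ (p + 2) * xVar k ^ q * (r * yVar i ^ (b + 1)))
      (xy_mem (x_monomial_mem _ _ (by omega))
        (biForms_mul_mem hr (yVar_pow_mem _ _) rfl (by omega)))
    have h5 := hKR j (xVar j ^ p * xVar k ^ (q + 2) * (t * yVar i ^ (b + 1)))
      (xy_mem (x_monomial_mem _ _ (by omega))
        (biForms_mul_mem ht (yVar_pow_mem _ _) rfl (by omega)))
    have h6 := Submodule.smul_mem R (2⁻¹ : ℂ) (Submodule.add_mem R (Submodule.sub_mem R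
      (Submodule.sub_mem R (Submodule.sub_mem R h2 h3) h4) h5) h1)
    convert h6 using 1
    rw [hs, er, et, eq_inv_smul_iff₀ (by norm_num)]
    simp only [smul_eq_C_mul]
    ring

/-- On the hexagon edge x = e_i, where y_i = 0, `baseForm` is x_i times a cubic containing -y_k³.
This lowers the exponent of y_k until one of three monomials is reached; the other terms of
`baseForm` are multiples of x_j y_j or x_k y_k. -/
theorem edge_interior_mem
    (hs : baseForm = xVar i * edgeCubic j k + xVar j * edgeCubic k i + xVar k * edgeCubic i j)
    (hsR : ∀ h ∈ biForms ℂ (a + 1) (b + 1), baseForm * h ∈ R)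
    (hKR : ∀ c, ∀ h ∈ biForms ℂ (a + 1) (b + 3), xVar c * yVar c * h ∈ R)
    (he : ∀ m n, n < 3 → m + n = b + 2 →
      xVar i ^ (a + 2) * (yVar j ^ (m + 1) * yVar k ^ (n + 1)) ∈ R) (p q : ℕ)
    (hpq : p + q = b + 2) :
    xVar i ^ (a + 2) * (yVar j ^ (p + 1) * yVar k ^ (q + 1)) ∈ R := by
  induction q using Nat.strong_induction_on generalizing p with
  | _ q ih =>
    by_cases hq : q < 3
    · exact he p q hq hpq
    obtain ⟨q, rfl⟩ := Nat.exists_eq_add_of_le' (not_lt.1 hq)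
    have h1 := ih q (by omega) (p + 3) (by omega)
    have h2 := ih (q + 1) (by omega) (p + 2) (by omega)
    have h3 := ih (q + 2) (by omega) (p + 1) (by omega)
    have h4 := hsR (xVar i ^ (a + 1) * (yVar j ^ (p + 1) * yVar k ^ (q + 1)))
      (xy_mem (xVar_pow_mem _ _) (y_monomial_mem _ _ (by omega)))
    have h5 := hKR j (xVar i ^ (a + 1) * (edgeCubic k i * (yVar j ^ p * yVar k ^ (q + 1))))
      (xy_mem (xVar_pow_mem _ _)
        (biForms_mul_mem (edgeCubic_mem _ _) (y_monomial_mem _ _ rfl) rfl (by omega)))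
    have h6 := hKR k (xVar i ^ (a + 1) * (edgeCubic i j * (yVar j ^ (p + 1) * yVar k ^ q)))
      (xy_mem (xVar_pow_mem _ _)
        (biForms_mul_mem (edgeCubic_mem _ _) (y_monomial_mem _ _ rfl) rfl (by omega)))
    have h7 := Submodule.add_mem R (Submodule.sub_mem R (Submodule.add_mem R
      (Submodule.add_mem R (Submodule.sub_mem R h5 h4) h6) (Submodule.smul_mem R (2 : ℂ) h1))
      (Submodule.smul_mem R (4 : ℂ) h2)) (Submodule.smul_mem R (3 : ℂ) h3)
    convert h7 using 1
    rw [hs, edgeCubic.eq_def j k]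
    simp only [smul_eq_C_mul]
    ring

/-- The pure powers of y_j and y_k belong to the nodes where two edges meet. There `baseForm` also
leaves a term on the adjacent edge, supplied by `hj` and `hk`. -/
theorem edge_mem
    (hs : baseForm = xVar i * edgeCubic j k + xVar j * edgeCubic k i + xVar k * edgeCubic i j)
    (hsR : ∀ h ∈ biForms ℂ (a + 1) (b + 1), baseForm * h ∈ R)
    (hKR : ∀ c, ∀ h ∈ biForms ℂ (a + 1) (b + 3), xVar c * yVar c * h ∈ R)
    (he : ∀ m n, n < 3 → m + n = b + 2 →
      xVar i ^ (a + 2) * (yVar j ^ (m + 1) * yVar k ^ (n + 1)) ∈ R)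
    (hj : xVar k ^ 1 * xVar i ^ (a + 1) * yVar j ^ (b + 4) ∈ R)
    (hk : xVar i ^ (a + 1) * xVar j ^ 1 * yVar k ^ (b + 4) ∈ R) (p q : ℕ) (hpq : p + q = b + 4) :
    xVar i ^ (a + 2) * (yVar j ^ p * yVar k ^ q) ∈ R := by
  have hrel := edge_interior_mem hs hsR hKR he
  rcases q with _ | q
  · obtain rfl : p = b + 4 := hpq
    obtain ⟨r, hr, er⟩ := exists_edgeCubic_eq_right i j
    have h1 := hrel (b + 2) 0 rfl
    have h2 := hrel (b + 1) 1 rfl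
    have h3 := hrel b 2 rfl
    have h4 := hsR (xVar i ^ (a + 1) * (yVar j ^ (b + 1) * yVar k ^ 0))
      (xy_mem (xVar_pow_mem _ _) (y_monomial_mem _ _ (by omega)))
    have h5 := hKR j (xVar i ^ (a + 1) * (edgeCubic k i * yVar j ^ b))
      (xy_mem (xVar_pow_mem _ _)
        (biForms_mul_mem (edgeCubic_mem _ _) (yVar_pow_mem _ _) rfl (by omega)))
    have h6 := hKR i (xVar k ^ 1 * xVar i ^ a * (r * yVar j ^ (b + 1)))
      (xy_mem (x_monomial_mem _ _ (by omega))
        (biForms_mul_mem hr (yVar_pow_mem _ _) rfl (by omega)))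
    have h7 := Submodule.smul_mem R (2⁻¹ : ℂ) (Submodule.add_mem R (Submodule.sub_mem R
      (Submodule.add_mem R (Submodule.add_mem R (Submodule.sub_mem R (Submodule.sub_mem R h4 h5) h6)
      hj) (Submodule.smul_mem R (4 : ℂ) h1)) (Submodule.smul_mem R (3 : ℂ) h2)) h3)
    convert h7 using 1
    rw [hs, edgeCubic.eq_def j k, er, eq_inv_smul_iff₀ (by norm_num)]
    simp only [smul_eq_C_mul]
    ring
  rcases p with _ | p
  · obtain rfl : q = b + 3 := by omega
    obtain ⟨r, hr, er⟩ := exists_edgeCubic_eq_left k i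
    have h1 := hrel 0 (b + 2) (by omega)
    have h2 := hrel 1 (b + 1) (by omega)
    have h3 := hrel 2 b (by omega)
    have h4 := hsR (xVar i ^ (a + 1) * (yVar j ^ 0 * yVar k ^ (b + 1)))
      (xy_mem (xVar_pow_mem _ _) (y_monomial_mem _ _ (by omega)))
    have h5 := hKR k (xVar i ^ (a + 1) * (edgeCubic i j * yVar k ^ b))
      (xy_mem (xVar_pow_mem _ _)
        (biForms_mul_mem (edgeCubic_mem _ _) (yVar_pow_mem _ _) rfl (by omega)))
    have h6 := hKR i (xVar i ^ a * xVar j ^ 1 * (r * yVar k ^ (b + 1)))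
      (xy_mem (x_monomial_mem _ _ (by omega))
        (biForms_mul_mem hr (yVar_pow_mem _ _) rfl (by omega)))
    have h7 := Submodule.add_mem R (Submodule.sub_mem R (Submodule.add_mem R
      (Submodule.add_mem R (Submodule.add_mem R (Submodule.sub_mem R h5 h4) h6)
      (Submodule.smul_mem R (2 : ℂ) hk)) (Submodule.smul_mem R (3 : ℂ) h1))
      (Submodule.smul_mem R (4 : ℂ) h2)) (Submodule.smul_mem R (2 : ℂ) h3)
    convert h7 using 1
    rw [hs, edgeCubic.eq_def j k, er]
    simp only [smul_eq_C_mul, map_ofNat]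
    ring
  · exact hrel p q (by omega)

end Membership

/-- Monomials complementary to the ideal of the twelve base points. -/
noncomputable def complementMonomials (a b : ℕ) :
    Fin 6 ⊕ Fin 6 → MvPolynomial (Fin 3 ⊕ Fin 3) ℂ :=
  Sum.elim
    ![xVar 0 ^ (a + 2) * (yVar 1 ^ (b + 3) * yVar 2 ^ 1),
      xVar 1 ^ (a + 2) * (yVar 2 ^ (b + 3) * yVar 0 ^ 1),
      xVar 2 ^ (a + 2) * (yVar 0 ^ (b + 3) * yVar 1 ^ 1),
      xVar 0 ^ (a + 2) * (yVar 1 ^ (b + 2) * yVar 2 ^ 2),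
      xVar 1 ^ (a + 2) * (yVar 2 ^ (b + 2) * yVar 0 ^ 2),
      xVar 2 ^ (a + 2) * (yVar 0 ^ (b + 2) * yVar 1 ^ 2)]
    ![xVar 0 ^ (a + 2) * (yVar 1 ^ (b + 1) * yVar 2 ^ 3),
      xVar 1 ^ (a + 2) * (yVar 2 ^ (b + 1) * yVar 0 ^ 3),
      xVar 2 ^ (a + 2) * (yVar 0 ^ (b + 1) * yVar 1 ^ 3),
      xVar 1 ^ (a + 1) * xVar 2 ^ 1 * yVar 0 ^ (b + 4),
      xVar 2 ^ (a + 1) * xVar 0 ^ 1 * yVar 1 ^ (b + 4),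
      xVar 0 ^ (a + 1) * xVar 1 ^ 1 * yVar 2 ^ (b + 4)]

theorem complementMonomials_mem (a b : ℕ) (i : Fin 6 ⊕ Fin 6) :
    complementMonomials a b i ∈ biForms ℂ (a + 2) (b + 4) := by
  have hA : ∀ i j k m n, m + n = b + 4 →
      xVar i ^ (a + 2) * (yVar j ^ m * yVar k ^ n) ∈ biForms ℂ (a + 2) (b + 4) :=
    fun i j k m n h => xy_mem (xVar_pow_mem _ _) (y_monomial_mem _ _ h)
  have hB : ∀ i j k, xVar j ^ (a + 1) * xVar k ^ 1 * yVar i ^ (b + 4) ∈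
      biForms ℂ (a + 2) (b + 4) :=
    fun i j k => xy_mem (x_monomial_mem _ _ (by omega)) (yVar_pow_mem _ _)
  rcases i with i | i
  · simp only [complementMonomials, Sum.elim_inl]
    fin_cases i <;> exact hA _ _ _ _ _ (by omega)
  · simp only [complementMonomials, Sum.elim_inr]
    fin_cases i
    · exact hA _ _ _ _ _ (by omega)
    · exact hA _ _ _ _ _ (by omega)
    · exact hA _ _ _ _ _ (by omega)
    · exact hB _ _ _
    · exact hB _ _ _
    · exact hB _ _ _

/-- Modulo the x_c y_c, only monomials supported on one of the six edges survive, and the preceding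
reductions treat each edge. The twelve remaining monomials match the degree 3 · 3 + 3 · 1 of
`baseForm` on the hexagon. -/
theorem biForms_le_of_base {a b : ℕ} {R : Submodule ℂ (MvPolynomial (Fin 3 ⊕ Fin 3) ℂ)}
    (hsR : ∀ h ∈ biForms ℂ (a + 1) (b + 1), baseForm * h ∈ R)
    (hKR : ∀ c, ∀ h ∈ biForms ℂ (a + 1) (b + 3), xVar c * yVar c * h ∈ R)
    (he : ∀ i, complementMonomials a b i ∈ R) : biForms ℂ (a + 2) (b + 4) ≤ R := by
  have s0 : baseForm = xVar 0 * edgeCubic 1 2 + xVar 1 * edgeCubic 2 0 + xVar 2 * edgeCubic 0 1 :=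
    rfl
  have s1 : baseForm =
      xVar 1 * edgeCubic 2 0 + xVar 2 * edgeCubic 0 1 + xVar 0 * edgeCubic 1 2 := by
    rw [s0]; ring
  have s2 : baseForm =
      xVar 2 * edgeCubic 0 1 + xVar 0 * edgeCubic 1 2 + xVar 1 * edgeCubic 2 0 := by
    rw [s0]; ring
  have v0 := vertex_interior_mem s0 hsR hKR (he (Sum.inr 3))
  have v1 := vertex_interior_mem s1 hsR hKR (he (Sum.inr 4))
  have v2 := vertex_interior_mem s2 hsR hKR (he (Sum.inr 5))
  have e0 := edge_mem s0 hsR hKR (fun m n hn hmn => by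
      interval_cases n
      · obtain rfl : m = b + 2 := by omega
        exact he (Sum.inl 0)
      · obtain rfl : m = b + 1 := by omega
        exact he (Sum.inl 3)
      · obtain rfl : m = b := by omega
        exact he (Sum.inr 0)) (v1 0 a (by omega)) (v2 a 0 rfl)
  have e1 := edge_mem s1 hsR hKR (fun m n hn hmn => by
      interval_cases n
      · obtain rfl : m = b + 2 := by omega
        exact he (Sum.inl 1)
      · obtain rfl : m = b + 1 := by omega
        exact he (Sum.inl 4)
      · obtain rfl : m = b := by omega
        exact he (Sum.inr 1)) (v2 0 a (by omega)) (v0 a 0 rfl)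
  have e2 := edge_mem s2 hsR hKR (fun m n hn hmn => by
      interval_cases n
      · obtain rfl : m = b + 2 := by omega
        exact he (Sum.inl 2)
      · obtain rfl : m = b + 1 := by omega
        exact he (Sum.inl 5)
      · obtain rfl : m = b := by omega
        exact he (Sum.inr 2)) (v0 0 a (by omega)) (v1 a 0 rfl)
  have vertex : ∀ i j k : Fin 3, (∀ p q, p + q = a →
        xVar j ^ (p + 1) * xVar k ^ (q + 1) * yVar i ^ (b + 4) ∈ R) →
      xVar j ^ (a + 2) * yVar i ^ (b + 4) ∈ R → xVar k ^ (a + 2) * yVar i ^ (b + 4) ∈ R →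
      ∀ p q, p + q = a + 2 → xVar j ^ p * xVar k ^ q * yVar i ^ (b + 4) ∈ R := by
    intro i j k h1 h2 h3 p q hpq
    rcases p with _ | p
    · obtain rfl : q = a + 2 := by omega
      simpa using h3
    rcases q with _ | q
    · obtain rfl : p = a + 1 := by omega
      simpa using h2
    · exact h1 p q (by omega)
  have w0 := vertex 0 1 2 v0 (by simpa using e1 0 (b + 4) (by omega))
    (by simpa using e2 (b + 4) 0 (by omega))
  have w1 := vertex 1 2 0 v1 (by simpa using e2 0 (b + 4) (by omega))
    (by simpa using e0 (b + 4) 0 (by omega))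
  have w2 := vertex 2 0 1 v2 (by simpa using e0 0 (b + 4) (by omega))
    (by simpa using e1 (b + 4) 0 (by omega))
  refine biForms_le fun α β hα hβ => ?_
  by_cases hc : ∃ c, α c ≠ 0 ∧ β c ≠ 0
  · obtain ⟨c, h1, h2⟩ := hc
    have hsplit : ∀ γ : Fin 3 → ℕ, γ c ≠ 0 → ∃ γ' : Fin 3 → ℕ, γ = Pi.single c 1 + γ' :=
      fun γ h => ⟨γ - Pi.single c 1, by
        ext m
        by_cases hm : m = c
        · subst hm; simp; omega
        · simp [hm]⟩
    obtain ⟨α', rfl⟩ := hsplit α h1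
    obtain ⟨β', rfl⟩ := hsplit β h2
    rw [← biMonomial_mul]
    have : biMonomial ℂ (Pi.single c 1) (Pi.single c 1) = xVar c * yVar c := by
      simp [biMonomial, Pi.single_apply, pow_ite]
    rw [this]
    refine hKR c _ (biMonomial_mem ?_ ?_)
    · simp [Finset.sum_add_distrib] at hα; omega
    · simp [Finset.sum_add_distrib] at hβ; omega
  · push Not at hc
    have hmon : biMonomial ℂ α β = xVar 0 ^ α 0 * xVar 1 ^ α 1 * xVar 2 ^ α 2 *
        (yVar 0 ^ β 0 * yVar 1 ^ β 1 * yVar 2 ^ β 2) := by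
      simp only [biMonomial, Fin.prod_univ_three]
    rw [Fin.sum_univ_three] at hα hβ
    rw [hmon]
    have hc' : ∀ c, α c = 0 ∨ β c = 0 := fun c => or_iff_not_imp_left.2 (hc c)
    rcases hc' 0 with h0 | h0 <;> rcases hc' 1 with h1 | h1 <;> rcases hc' 2 with h2 | h2 <;>
      simp only [h0, h1, h2, pow_zero, one_mul, mul_one, add_zero, zero_add] at hα hβ ⊢
    · omega
    · rw [hα]; exact e2 _ _ hβ
    · rw [hα, mul_comm (yVar 0 ^ _)]; exact e1 _ _ (by omega)
    · rw [hβ, mul_comm (xVar 1 ^ _)]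
      rw [mul_comm (xVar 2 ^ _)]; exact w0 _ _ hα
    · rw [hα]; exact e0 _ _ hβ
    · rw [hβ, mul_comm (xVar 0 ^ _)]; exact w1 _ _ (by omega)
    · rw [hβ]; exact w2 _ _ hα
    · omega

end HexagonGeneration

/-! ### The twelve base points and their independence properties -/

section BasePoints

open MvPolynomial

/-- The six base points that are defined over every field: one on each edge of the coordinate
triangle, and its vertices. -/
def realBase (k : Type*) [Field k] : Fin 6 → Fin 3 ⊕ Fin 3 → k :=
  ![Sum.elim ![2, 0, 0] ![0, 1, 1], Sum.elim ![0, 2, 0] ![1, 0, 1],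
    Sum.elim ![0, 0, 2] ![1, 1, 0], Sum.elim ![0, -2, -1] ![1, 0, 0],
    Sum.elim ![-1, 0, -2] ![0, 1, 0], Sum.elim ![-2, -1, 0] ![0, 0, 1]]

/-- The six base points with non-real coordinates: a conjugate pair on each edge of the
coordinate triangle. -/
noncomputable def complexBase : Fin 6 → Fin 3 ⊕ Fin 3 → ℂ :=
  ![Sum.elim ![(1 - Complex.I) / 2, 0, 0] ![0, 1, 1 + Complex.I],
    Sum.elim ![0, (1 - Complex.I) / 2, 0] ![1 + Complex.I, 0, 1],
    Sum.elim ![0, 0, (1 - Complex.I) / 2] ![1, 1 + Complex.I, 0],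
    Sum.elim ![(1 + Complex.I) / 2, 0, 0] ![0, 1, 1 - Complex.I],
    Sum.elim ![0, (1 + Complex.I) / 2, 0] ![1 - Complex.I, 0, 1],
    Sum.elim ![0, 0, (1 + Complex.I) / 2] ![1, 1 - Complex.I, 0]]

theorem one_sub_I_ne_zero : (1 : ℂ) - Complex.I ≠ 0 := fun h => by
  have := congrArg Complex.re h
  simp at this

theorem one_add_I_ne_zero : (1 : ℂ) + Complex.I ≠ 0 := fun h => by
  have := congrArg Complex.re h
  simp at this

theorem eq_zero_of_add_sub_mul_I {p q : ℂ} (h1 : p + q * Complex.I = 0)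
    (h2 : p - q * Complex.I = 0) : p = 0 ∧ q = 0 := by
  have hp : p = 0 := by linear_combination (h1 + h2) / 2
  have hq : q * Complex.I = 0 := by linear_combination (h1 - h2) / 2
  exact ⟨hp, (mul_eq_zero.1 hq).resolve_right Complex.I_ne_zero⟩

/-- After division by w in the first two equations, a polynomial of degree at most two has the three
roots 1, 1 + i and 1 - i. -/
theorem eq_zero_of_three_roots {p q r : ℂ}
    (h1 : p * (1 + Complex.I) + q * (1 + Complex.I) ^ 2 + r * (1 + Complex.I) ^ 3 = 0)
    (h2 : p * (1 - Complex.I) + q * (1 - Complex.I) ^ 2 + r * (1 - Complex.I) ^ 3 = 0)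
    (h3 : p + q + r = 0) : p = 0 ∧ q = 0 ∧ r = 0 := by
  have hI := Complex.I_sq
  have hp : p = 0 := by
    linear_combination Complex.I / 2 * (h1 - h2) + 2 * h3 -
      (p + 2 * q + r * (Complex.I ^ 2 + 2)) * hI
  have hr : r = 0 := by
    linear_combination (1 / 2) * hp - (1 / 4) * (h1 + h2) + (2 * q + 6 * r) / 4 * hI
  exact ⟨hp, by linear_combination h3 - hp - hr, hr⟩

/-- The system splits along the edges. On x = e_i three monomials face the three points with ratio
1, 1 + i, 1 - i, a Vandermonde system; on y = e_i one monomial faces one point. -/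
theorem complementMonomials_injective (a b : ℕ) (x : Fin 6 ⊕ Fin 6 → ℂ)
    (h : ∀ i, eval (complexBase i) (∑ j, x j • complementMonomials a b j) = 0)
    (h' : ∀ i, eval (realBase ℂ i) (∑ j, x j • complementMonomials a b j) = 0) : x = 0 := by
  have c1 : ((1 - Complex.I) / 2) ^ (a + 2) ≠ 0 :=
    pow_ne_zero _ (div_ne_zero one_sub_I_ne_zero two_ne_zero)
  have c2 : ((1 + Complex.I) / 2) ^ (a + 2) ≠ 0 :=
    pow_ne_zero _ (div_ne_zero one_add_I_ne_zero two_ne_zero)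
  have c3 : (2 : ℂ) ^ (a + 2) ≠ 0 := pow_ne_zero _ two_ne_zero
  have key : ∀ {p q r : ℂ},
      p * (((1 - Complex.I) / 2) ^ (a + 2) * (1 + Complex.I)) +
        q * (((1 - Complex.I) / 2) ^ (a + 2) * (1 + Complex.I) ^ 2) +
        r * (((1 - Complex.I) / 2) ^ (a + 2) * (1 + Complex.I) ^ 3) = 0 →
      p * (((1 + Complex.I) / 2) ^ (a + 2) * (1 - Complex.I)) +
        q * (((1 + Complex.I) / 2) ^ (a + 2) * (1 - Complex.I) ^ 2) +
        r * (((1 + Complex.I) / 2) ^ (a + 2) * (1 - Complex.I) ^ 3) = 0 →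
      p * 2 ^ (a + 2) + q * 2 ^ (a + 2) + r * 2 ^ (a + 2) = 0 → p = 0 ∧ q = 0 ∧ r = 0 := by
    intro p q r h1 h2 h3
    refine eq_zero_of_three_roots (mul_left_cancel₀ c1 ?_) (mul_left_cancel₀ c2 ?_)
      (mul_left_cancel₀ c3 ?_)
    · linear_combination h1
    · linear_combination h2
    · linear_combination h3
  simp only [Fin.forall_fin_succ, Fin.sum_univ_succ, complementMonomials, complexBase, realBase,
    Fintype.sum_sum_type] at h h'
  simp [smul_eval] at h h'
  obtain ⟨h0, h1, h2, h3, h4, h5⟩ := h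
  obtain ⟨g0, g1, g2, g3, g4, g5⟩ := h'
  obtain ⟨e0, e3, f0⟩ := key h0 h3 g0
  obtain ⟨e1, e4, f1⟩ := key h1 h4 g1
  obtain ⟨e2, e5, f2⟩ := key h2 h5 g2
  ext i
  rcases i with i | i <;> fin_cases i <;> assumption

/-- Tangent directions of the hexagon at the base points with non-real coordinates. -/
def complexTangent : Fin 6 → Fin 3 ⊕ Fin 3 → ℂ :=
  ![Sum.elim 0 ![0, 0, 1], Sum.elim 0 ![1, 0, 0], Sum.elim 0 ![0, 1, 0],
    Sum.elim 0 ![0, 0, 1], Sum.elim 0 ![1, 0, 0], Sum.elim 0 ![0, 1, 0]]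

/-- Tangent directions of the hexagon at the real base points. -/
def realTangent : Fin 6 → Fin 3 ⊕ Fin 3 → ℂ :=
  ![Sum.elim 0 ![0, 0, 1], Sum.elim 0 ![1, 0, 0], Sum.elim 0 ![0, 1, 0],
    Sum.elim ![0, 0, 1] 0, Sum.elim ![1, 0, 0] 0, Sum.elim ![0, 1, 0] 0]

/-- The forms of bidegree `(1, 3)` that are not identically zero on the hexagon. -/
noncomputable def edgeMonomials : Fin 6 ⊕ Fin 6 → MvPolynomial (Fin 3 ⊕ Fin 3) ℂ :=
  Sum.elim
    ![xVar 0 * (yVar 1 ^ 3 * yVar 2 ^ 0), xVar 1 * (yVar 2 ^ 3 * yVar 0 ^ 0),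
      xVar 2 * (yVar 0 ^ 3 * yVar 1 ^ 0), xVar 0 * (yVar 1 ^ 2 * yVar 2 ^ 1),
      xVar 1 * (yVar 2 ^ 2 * yVar 0 ^ 1), xVar 2 * (yVar 0 ^ 2 * yVar 1 ^ 1)]
    ![xVar 0 * (yVar 1 ^ 1 * yVar 2 ^ 2), xVar 1 * (yVar 2 ^ 1 * yVar 0 ^ 2),
      xVar 2 * (yVar 0 ^ 1 * yVar 1 ^ 2), xVar 0 * (yVar 1 ^ 0 * yVar 2 ^ 3),
      xVar 1 * (yVar 2 ^ 0 * yVar 0 ^ 3), xVar 2 * (yVar 0 ^ 0 * yVar 1 ^ 3)]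

theorem edgeMonomials_mem (i : Fin 6 ⊕ Fin 6) : edgeMonomials i ∈ biForms ℂ 1 3 := by
  have hA : ∀ i j k m n, m + n = 3 → xVar i * (yVar j ^ m * yVar k ^ n) ∈ biForms ℂ 1 3 :=
    fun i j k m n h => xy_mem (X_inl_mem _) (y_monomial_mem _ _ h)
  rcases i with i | i
  · simp only [edgeMonomials, Sum.elim_inl]
    fin_cases i <;> exact hA _ _ _ _ _ (by omega)
  · simp only [edgeMonomials, Sum.elim_inr]
    fin_cases i <;> exact hA _ _ _ _ _ (by omega)

theorem biForms_le_of_edgeMonomials {R : Submodule ℂ (MvPolynomial (Fin 3 ⊕ Fin 3) ℂ)}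
    (hKR : ∀ c, ∀ h ∈ biForms ℂ 0 2, xVar c * yVar c * h ∈ R)
    (he : ∀ i, edgeMonomials i ∈ R) : biForms ℂ 1 3 ≤ R := by
  have edge : ∀ i j k : Fin 3, (∀ m n, m + n = 3 → xVar i * (yVar j ^ m * yVar k ^ n) ∈ R) →
      ∀ p q r, p + q + r = 3 → xVar i * (yVar i ^ p * yVar j ^ q * yVar k ^ r) ∈ R := by
    intro i j k h p q r hpqr
    rcases p with _ | p
    · simpa using h q r (by omega)
    · convert hKR i (yVar i ^ p * yVar j ^ q * yVar k ^ r) (biForms_mul_mem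
        (y_monomial_mem _ _ rfl) (yVar_pow_mem _ _) rfl (by omega)) using 1
      ring
  have small : ∀ {p : ℕ → ℕ → Prop}, p 3 0 → p 2 1 → p 1 2 → p 0 3 → ∀ m n, m + n = 3 → p m n := by
    intro p h0 h1 h2 h3 m n hmn
    obtain rfl : n = 3 - m := by omega
    have : m ≤ 3 := by omega
    interval_cases m <;> assumption
  have e0 := edge 0 1 2 (small (he (Sum.inl 0)) (he (Sum.inl 3)) (he (Sum.inr 0)) (he (Sum.inr 3)))
  have e1 := edge 1 2 0 (small (he (Sum.inl 1)) (he (Sum.inl 4)) (he (Sum.inr 1)) (he (Sum.inr 4)))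
  have e2 := edge 2 0 1 (small (he (Sum.inl 2)) (he (Sum.inl 5)) (he (Sum.inr 2)) (he (Sum.inr 5)))
  refine biForms_le fun α β hα hβ => ?_
  have hmon : biMonomial ℂ α β = xVar 0 ^ α 0 * xVar 1 ^ α 1 * xVar 2 ^ α 2 *
      (yVar 0 ^ β 0 * yVar 1 ^ β 1 * yVar 2 ^ β 2) := by
    simp only [biMonomial, Fin.prod_univ_three]
  rw [Fin.sum_univ_three] at hα hβ
  rw [hmon]
  obtain ⟨h0, h1, h2⟩ | ⟨h0, h1, h2⟩ | ⟨h0, h1, h2⟩ : (α 0 = 1 ∧ α 1 = 0 ∧ α 2 = 0) ∨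
    (α 0 = 0 ∧ α 1 = 1 ∧ α 2 = 0) ∨ (α 0 = 0 ∧ α 1 = 0 ∧ α 2 = 1) := by omega
  · rw [h0, h1, h2]
    convert e0 _ _ _ hβ using 1; ring
  · rw [h0, h1, h2]
    convert e1 (β 1) (β 2) (β 0) (by omega) using 1; ring
  · rw [h0, h1, h2]
    convert e2 (β 2) (β 0) (β 1) (by omega) using 1; ring

theorem dirDeriv_pow (z τ : Fin 3 ⊕ Fin 3 → ℂ) (P : MvPolynomial (Fin 3 ⊕ Fin 3) ℂ) (n : ℕ) :
    dirDeriv z τ (P ^ n) = n * eval z P ^ (n - 1) * dirDeriv z τ P := by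
  induction n with
  | zero => simp [dirDeriv_apply]
  | succ n ih =>
    rw [pow_succ, dirDeriv_mul, ih]
    rcases n with _ | n
    · simp
    · simp only [Nat.add_sub_cancel, map_pow]
      push_cast
      ring

/-- A polynomial of degree at most three has no room for double roots at both 1 + i and 1 - i. -/
theorem eq_zero_of_two_double_roots {p q r s : ℂ}
    (h1 : p + q * (1 + Complex.I) + r * (1 + Complex.I) ^ 2 + s * (1 + Complex.I) ^ 3 = 0)
    (h2 : p + q * (1 - Complex.I) + r * (1 - Complex.I) ^ 2 + s * (1 - Complex.I) ^ 3 = 0)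
    (h3 : q + r * (2 * (1 + Complex.I)) + s * (3 * (1 + Complex.I) ^ 2) = 0)
    (h4 : q + r * (2 * (1 - Complex.I)) + s * (3 * (1 - Complex.I) ^ 2) = 0) :
    p = 0 ∧ q = 0 ∧ r = 0 ∧ s = 0 := by
  have hI := Complex.I_sq
  obtain ⟨e1, e2⟩ := eq_zero_of_add_sub_mul_I (p := p + q - 2 * s) (q := q + 2 * r + 2 * s)
    (by linear_combination h1 - (r + 3 * s + s * Complex.I) * hI)
    (by linear_combination h2 - (r + 3 * s - s * Complex.I) * hI)
  obtain ⟨e3, e4⟩ := eq_zero_of_add_sub_mul_I (p := q + 2 * r) (q := 2 * r + 6 * s)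
    (by linear_combination h3 - 3 * s * hI)
    (by linear_combination h4 - 3 * s * hI)
  have hs : s = 0 := by linear_combination (e2 - e3) / 2
  have hr : r = 0 := by linear_combination e4 / 2 - 3 * hs
  have hq : q = 0 := by linear_combination e3 - 2 * hr
  exact ⟨by linear_combination e1 - hq + 2 * hs, hq, hr, hs⟩

/-- On each edge x = e_i a form of bidegree (1,3) restricts to a binary cubic, here with double
roots at a conjugate pair. This is the base case of the field `double`. -/
theorem edgeMonomials_injective (x : Fin 6 ⊕ Fin 6 → ℂ)
    (h : ∀ i, eval (complexBase i) (∑ j, x j • edgeMonomials j) = 0)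
    (h' : ∀ i, dirDeriv (complexBase i) (complexTangent i) (∑ j, x j • edgeMonomials j) = 0) :
    x = 0 := by
  simp only [Fin.forall_fin_succ, Fin.sum_univ_succ, edgeMonomials, complexBase, complexTangent,
    Fintype.sum_sum_type] at h h'
  simp [smul_eval] at h
  simp [dirDeriv_mul, dirDeriv_pow, dirDeriv_X] at h'
  obtain ⟨h0, h1, h2, h3, h4, h5⟩ := h
  obtain ⟨g0, g1, g2, g3, g4, g5⟩ := h'
  have c1 : (1 - Complex.I) / 2 ≠ 0 := div_ne_zero one_sub_I_ne_zero two_ne_zero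
  have c2 : (1 + Complex.I) / 2 ≠ 0 := div_ne_zero one_add_I_ne_zero two_ne_zero
  have key : ∀ {p q r s : ℂ},
      p * ((1 - Complex.I) / 2) + q * ((1 - Complex.I) / 2 * (1 + Complex.I)) +
        (r * ((1 - Complex.I) / 2 * (1 + Complex.I) ^ 2) +
          s * ((1 - Complex.I) / 2 * (1 + Complex.I) ^ 3)) = 0 →
      p * ((1 + Complex.I) / 2) + q * ((1 + Complex.I) / 2 * (1 - Complex.I)) +
        (r * ((1 + Complex.I) / 2 * (1 - Complex.I) ^ 2) +
          s * ((1 + Complex.I) / 2 * (1 - Complex.I) ^ 3)) = 0 →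
      q * ((1 - Complex.I) / 2) + (r * ((1 - Complex.I) / 2 * (2 * (1 + Complex.I))) +
        s * ((1 - Complex.I) / 2 * (3 * (1 + Complex.I) ^ 2))) = 0 →
      q * ((1 + Complex.I) / 2) + (r * ((1 + Complex.I) / 2 * (2 * (1 - Complex.I))) +
        s * ((1 + Complex.I) / 2 * (3 * (1 - Complex.I) ^ 2))) = 0 →
      p = 0 ∧ q = 0 ∧ r = 0 ∧ s = 0 := by
    intro p q r s h1 h2 h3 h4
    refine eq_zero_of_two_double_roots (mul_left_cancel₀ c1 ?_) (mul_left_cancel₀ c2 ?_)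
      (mul_left_cancel₀ c1 ?_) (mul_left_cancel₀ c2 ?_)
    · linear_combination h1
    · linear_combination h2
    · linear_combination h3
    · linear_combination h4
  obtain ⟨e0, e3, f0, f3⟩ := key h0 h3 g0 g3
  obtain ⟨e1, e4, f1, f4⟩ := key h1 h4 g1 g4
  obtain ⟨e2, e5, f2, f5⟩ := key h2 h5 g2 g5
  ext i
  rcases i with i | i <;> fin_cases i <;> assumption

/-- The monomials x_i y_j and x_i y_k see only the conjugate pair on the edge x = e_i, and they
distinguish its two points. -/
theorem bilinear_independent (c : Fin 6 → ℂ)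
    (h : ∀ P ∈ biForms ℂ 1 1, ∑ i, c i * eval (complexBase i) P = 0) : c = 0 := by
  have key : ∀ i j, ∑ m, c m * eval (complexBase m) (xVar i * yVar j) = 0 := fun i j =>
    h _ (xy_mem (X_inl_mem i) (X_inr_mem j))
  have h01 := key 0 1
  have h02 := key 0 2
  have h12 := key 1 2
  have h10 := key 1 0
  have h20 := key 2 0
  have h21 := key 2 1
  simp [Fin.sum_univ_succ, complexBase] at h01 h02 h12 h10 h20 h21
  have hI := Complex.I_sq
  have pair : ∀ {p q : ℂ}, p * ((1 - Complex.I) / 2) + q * ((1 + Complex.I) / 2) = 0 →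
      p * ((1 - Complex.I) / 2 * (1 + Complex.I)) +
        q * ((1 + Complex.I) / 2 * (1 - Complex.I)) = 0 →
      p = 0 ∧ q = 0 := by
    intro p q h1 h2
    have e1 : p + q = 0 := by linear_combination h2 + (p + q) / 2 * hI
    have e2 : (p - q) * Complex.I = 0 := by linear_combination e1 - 2 * h1
    have e3 := (mul_eq_zero.1 e2).resolve_right Complex.I_ne_zero
    exact ⟨by linear_combination (e1 + e3) / 2, by linear_combination (e1 - e3) / 2⟩
  obtain ⟨e0, e3⟩ := pair h01 h02
  obtain ⟨e1, e4⟩ := pair h12 h10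
  obtain ⟨e2, e5⟩ := pair h20 h21
  ext i
  fin_cases i <;> assumption

/-- A mixed monomial y_j y_k sees a single pair. As both ratios satisfy w² = 2w - 2, the squares
then say that the pair sums double from each edge to the next. Going round gives S = 8 S, whence the
factor 7. -/
theorem conics_independent (c : Fin 6 → ℂ)
    (h : ∀ P ∈ biForms ℂ 0 2, ∑ i, c i * eval (complexBase i) P = 0) : c = 0 := by
  have key : ∀ i j, ∑ m, c m * eval (complexBase m) (yVar i * yVar j) = 0 := fun i j =>
    h _ (biForms_mul_mem (X_inr_mem i) (X_inr_mem j))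
  have h00 := key 0 0
  have h11 := key 1 1
  have h22 := key 2 2
  have h12 := key 1 2
  have h20 := key 2 0
  have h01 := key 0 1
  simp [Fin.sum_univ_succ, complexBase] at h00 h11 h22 h01 h12 h20
  have hI := Complex.I_sq
  have a0 : c 0 + c 3 = 0 := by
    linear_combination (4 * h22 + 2 * h00 + h11 - 8 * h12 - 4 * h20 - 2 * h01
      - (4 * (c 0 + c 3) + 2 * (c 1 + c 4) + (c 2 + c 5)) * hI) * (-1 / 7)
  have a1 : c 1 + c 4 = 0 := by
    linear_combination h22 - 2 * h12 + 2 * a0 - (c 0 + c 3) * hI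
  have a2 : c 2 + c 5 = 0 := by
    linear_combination h00 - 2 * h20 + 2 * a1 - (c 1 + c 4) * hI
  have pair : ∀ {p q : ℂ}, p + q = 0 → p * (1 + Complex.I) + q * (1 - Complex.I) = 0 →
      p = 0 ∧ q = 0 := by
    intro p q h1 h2
    have e2 : (p - q) * Complex.I = 0 := by linear_combination h2 - h1
    have e3 := (mul_eq_zero.1 e2).resolve_right Complex.I_ne_zero
    exact ⟨by linear_combination (h1 + e3) / 2, by linear_combination (h1 - e3) / 2⟩
  obtain ⟨e0, e3⟩ := pair a0 h12
  obtain ⟨e1, e4⟩ := pair a1 h20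
  obtain ⟨e2, e5⟩ := pair a2 h01
  ext i
  fin_cases i <;> assumption

/-- The twelve evaluations satisfy one relation up to scale: each edge fixes the coefficients of its
points up to a factor, and the points on the edges y = e_i link these factors. Setting one
coefficient to zero kills all. -/
theorem eleven_points_independent (c : Fin 5 ⊕ Fin 6 → ℂ)
    (h : ∀ P ∈ biForms ℂ 1 3, ∑ i, c (Sum.inl i) * eval (complexBase i.castSucc) P +
      ∑ i, c (Sum.inr i) * eval (realBase ℂ i) P = 0) : c = 0 := by
  have key := fun j => h _ (edgeMonomials_mem j)
  simp only [Sum.forall, Fin.forall_fin_succ] at key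
  simp [Fin.sum_univ_succ, complexBase, realBase, edgeMonomials] at key
  obtain ⟨⟨h0, h1, h2, h3, h4, h5⟩, g0, g1, g2, g3, g4, g5⟩ := key
  have edge : ∀ {p q r s t : ℂ},
      p * ((1 - Complex.I) / 2) + q * ((1 + Complex.I) / 2) + (r * 2 + -s) = 0 →
      p * ((1 - Complex.I) / 2 * (1 + Complex.I)) + q * ((1 + Complex.I) / 2 * (1 - Complex.I)) +
        r * 2 = 0 →
      p * ((1 - Complex.I) / 2 * (1 + Complex.I) ^ 2) +
        q * ((1 + Complex.I) / 2 * (1 - Complex.I) ^ 2) + r * 2 = 0 →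
      p * ((1 - Complex.I) / 2 * (1 + Complex.I) ^ 3) +
        q * ((1 + Complex.I) / 2 * (1 - Complex.I) ^ 3) + (r * 2 + -(t * 2)) = 0 →
      q = p ∧ r = -p ∧ s = -p ∧ t = -p := by
    intro p q r s t h1 h2 h3 h4
    have hI := Complex.I_sq
    have e1 : p + q + 2 * r = 0 := by linear_combination h2 + (p + q) / 2 * hI
    have e2 : (p - q) * Complex.I = 0 := by
      linear_combination h3 - e1 + ((p + q) / 2 + (p - q) / 2 * Complex.I) * hI
    have e3 := (mul_eq_zero.1 e2).resolve_right Complex.I_ne_zero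
    have e4 : r = -p := by linear_combination (e1 + e3) / 2
    refine ⟨by linear_combination -e3, e4, ?_, ?_⟩
    · linear_combination -h1 - (1 + Complex.I) / 2 * e3 + 2 * e4
    · have h5 : q = p := by linear_combination -e3
      subst h5
      linear_combination (-h4 + 2 * e4 - q * (1 + Complex.I ^ 2) * hI) / 2 + q * hI
  obtain ⟨a1, a2, a3, a4⟩ := edge h0 h3 g0 g3
  obtain ⟨b1, b2, b3, b4⟩ := edge h1 h4 g1 g4
  -- The omitted point is the second of the pair on the edge x = e_2, so its coefficient is zero.
  obtain ⟨d1, d2, d3, d4⟩ := edge (p := c (Sum.inl 2)) (q := 0) (r := c (Sum.inr 2))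
    (s := c (Sum.inr 3)) (t := c (Sum.inr 4)) (by linear_combination h2)
    (by linear_combination h5) (by linear_combination g2) (by linear_combination g5)
  have e2 : c (Sum.inl 2) = 0 := d1.symm
  have f4 : c (Sum.inr 4) = 0 := by rw [d4, e2, neg_zero]
  have f3 : c (Sum.inr 3) = 0 := by rw [d3, e2, neg_zero]
  have e0 : c (Sum.inl 0) = 0 := by linear_combination a3 - f4
  have e1 : c (Sum.inl 1) = 0 := by linear_combination b4 - f3
  have e3 : c (Sum.inl 3) = 0 := a1.trans e0
  have e4 : c (Sum.inl 4) = 0 := b1.trans e1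
  have f0 : c (Sum.inr 0) = 0 := by rw [a2, e0, neg_zero]
  have f1 : c (Sum.inr 1) = 0 := by rw [b2, e1, neg_zero]
  have f2 : c (Sum.inr 2) = 0 := by rw [d2, e2, neg_zero]
  have f5 : c (Sum.inr 5) = 0 := by rw [a4, e0, neg_zero]
  ext i
  rcases i with i | i <;> fin_cases i <;> assumption

theorem complex_tangent_baseK (c : Fin 3) (i : Fin 6) :
    dirDeriv (complexBase i) (complexTangent i) (xVar c * yVar c) = 0 := by
  fin_cases c <;> fin_cases i <;> simp [dirDeriv_mul, dirDeriv_X, complexBase, complexTangent]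

theorem real_tangent_baseK (c : Fin 3) (i : Fin 6) :
    dirDeriv (realBase ℂ i) (realTangent i) (xVar c * yVar c) = 0 := by
  fin_cases c <;> fin_cases i <;> simp [dirDeriv_mul, dirDeriv_X, realBase, realTangent]

theorem eval_complexBase_baseForm (i : Fin 6) : eval (complexBase i) baseForm = 0 := by
  have hI := Complex.I_sq
  have h1 : (2 : ℂ) - 4 * (1 + Complex.I) + 3 * (1 + Complex.I) ^ 2 - (1 + Complex.I) ^ 3 = 0 := by
    linear_combination -Complex.I * hI
  have h2 : (2 : ℂ) - 4 * (1 - Complex.I) + 3 * (1 - Complex.I) ^ 2 - (1 - Complex.I) ^ 3 = 0 := by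
    linear_combination Complex.I * hI
  fin_cases i <;> simp [complexBase, baseForm, edgeCubic, smul_eval, h1, h2]

theorem eval_realBase_baseForm (i : Fin 6) : eval (realBase ℂ i) baseForm = 0 := by
  fin_cases i <;> simp [realBase, baseForm, edgeCubic, smul_eval] <;> norm_num

theorem complex_transversal (i : Fin 6) :
    dirDeriv (complexBase i) (complexTangent i) baseForm ≠ 0 := by
  have hI := Complex.I_sq
  have h1 : -4 + 3 * (2 * (1 + Complex.I)) - 3 * (1 + Complex.I) ^ 2 = 2 := by
    linear_combination -3 * hI
  have h2 : -4 + 3 * (2 * (1 - Complex.I)) - 3 * (1 - Complex.I) ^ 2 = 2 := by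
    linear_combination -3 * hI
  fin_cases i <;> simp [dirDeriv_mul, dirDeriv_X, dirDeriv_pow, complexBase, complexTangent,
    baseForm, edgeCubic, h1, h2, one_sub_I_ne_zero, one_add_I_ne_zero]

theorem real_transversal (i : Fin 6) :
    dirDeriv (realBase ℂ i) (realTangent i) baseForm ≠ 0 := by
  fin_cases i <;> simp [dirDeriv_mul, dirDeriv_X, dirDeriv_pow, realBase, realTangent,
    baseForm, edgeCubic] <;> norm_num

end BasePoints

/-! ### Residual pairs near the base points -/

section ResidualPairs

open MvPolynomial Filter

/-- The directional derivative as a linear function of the direction. -/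
noncomputable def dirDerivLin (z : Fin 3 ⊕ Fin 3 → ℂ) (P : MvPolynomial (Fin 3 ⊕ Fin 3) ℂ) :
    (Fin 3 ⊕ Fin 3 → ℂ) →ₗ[ℂ] ℂ :=
  ∑ i, eval z (pderiv i P) • LinearMap.proj i

theorem dirDerivLin_apply (z τ : Fin 3 ⊕ Fin 3 → ℂ) (P : MvPolynomial (Fin 3 ⊕ Fin 3) ℂ) :
    dirDerivLin z P τ = dirDeriv z τ P := by
  simp [dirDerivLin, dirDeriv_apply, LinearMap.sum_apply, mul_comm]

variable {X : Type*} {l : Filter X}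

theorem STendsto.pi {S : X → Fin 3 ⊕ Fin 3 → ℂ} {S₀ : Fin 3 ⊕ Fin 3 → ℂ}
    (h : STendsto l S S₀) : Tendsto S l (𝓝 S₀) :=
  tendsto_pi_nhds.2 fun i => h.apply (LinearMap.proj i)

/-- Tangent vectors of the hexagon at smooth points extend to nearby curves. -/
theorem exists_tangent {z : X → Fin 3 ⊕ Fin 3 → ℂ} {z₀ τ₀ : Fin 3 ⊕ Fin 3 → ℂ}
    (hz : Tendsto z l (𝓝 z₀)) {K : Fin 3 → X → MvPolynomial (Fin 3 ⊕ Fin 3) ℂ}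
    (hK : ∀ c, STendsto l (K c) (xVar c * yVar c))
    (hz₀ : ∀ c : Fin 3, z₀ (Sum.inl c) ≠ 0 ∨ z₀ (Sum.inr c) ≠ 0)
    (hτ₀ : ∀ c : Fin 3, dirDeriv z₀ τ₀ (xVar c * yVar c) = 0) :
    ∃ τ : X → Fin 3 ⊕ Fin 3 → ℂ, Tendsto τ l (𝓝 τ₀) ∧
      ∀ᶠ p in l, ∀ c, dirDeriv (z p) (τ p) (K c p) = 0 := by
  classical
  obtain ⟨τ, h1, -, h2⟩ := exists_perturbed_solution (l := l) (W := ⊤)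
    (φ := fun c p => dirDerivLin (z p) (K c p)) (φ₀ := fun c => dirDerivLin z₀ (xVar c * yVar c))
    (fun c τ => by
      simp only [dirDerivLin_apply]
      exact (wTendsto_dirDeriv hz tendsto_const_nhds).apply (hK c))
    -- The differential of x_c y_c involves only the directions x_c and y_c, so the three are
    -- independent wherever no x_c and y_c vanish together, that is, away from the nodes.
    (exists_forall_eq_of_independent _ fun γ hγ => funext fun c => by
      have h1 := hγ (Pi.single (Sum.inl c) 1) trivial
      have h2 := hγ (Pi.single (Sum.inr c) 1) trivial
      simp [dirDerivLin_apply, dirDeriv_mul, dirDeriv_X, Pi.single_apply] at h1 h2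
      rcases hz₀ c with h | h
      · exact h2.resolve_right h
      · exact h1.resolve_right h)
    (S₀ := τ₀) trivial
  refine ⟨τ, h1.pi, ?_⟩
  filter_upwards [h2] with p hp c
  rw [← dirDerivLin_apply, hp c, dirDerivLin_apply, hτ₀ c]

theorem eventually_separatedBy {n a b : ℕ} {d : X → Fin n → Fin 3 ⊕ Fin 3 → ℂ}
    {d₀ : Fin n → Fin 3 ⊕ Fin 3 → ℂ} (hd : Tendsto d l (𝓝 d₀))
    (h : ∀ c : Fin n → ℂ, (∀ P ∈ biForms ℂ a b, ∑ i, c i * eval (d₀ i) P = 0) → c = 0) :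
    ∀ᶠ p in l, SeparatedBy a b (d p) := by
  have hφ : ∀ i, WTendsto l (fun p => (aeval (d p i)).toLinearMap) (aeval (d₀ i)).toLinearMap :=
    fun i => wTendsto_eval ((tendsto_pi_nhds.1 hd) i)
  have hsurj := exists_forall_eq_of_independent (W := biForms ℂ a b)
    (fun i => (aeval (d₀ i)).toLinearMap) h
  choose q₀ hq₀ hq using fun i : Fin n => hsurj (Pi.single i 1)
  choose q hq1 hq2 hq3 using fun i : Fin n => exists_perturbed_solution hφ hsurj (hq₀ i)
  filter_upwards [eventually_all.2 hq3] with p hp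
  refine ⟨fun i => q i p, fun i => hq2 i p, fun i j => ?_⟩
  have := hp i j
  rw [hq, Pi.single_apply] at this
  simpa [aeval_eq_eval, eq_comm] using this

theorem baseK_mem (c : Fin 3) : xVar c * yVar c ∈ biForms ℂ 1 1 :=
  xy_mem (X_inl_mem c) (X_inr_mem c)

/-- Pairs of families of points close to the base points and with equal moments are residual. -/
theorem eventually_residualPair {d d' : X → Fin 6 → Fin 3 ⊕ Fin 3 → ℂ}
    (hd : Tendsto d l (𝓝 complexBase)) (hd' : Tendsto d' l (𝓝 (realBase ℂ)))
    (hsame : ∀ᶠ p in l, SameMoments (d' p) (d p)) :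
    ∀ᶠ p in l, Nonempty (ResidualPair (d p) (d' p)) := by
  classical
  have hdi : ∀ i, Tendsto (fun p => d p i) l (𝓝 (complexBase i)) := tendsto_pi_nhds.1 hd
  have hdi' : ∀ i, Tendsto (fun p => d' p i) l (𝓝 (realBase ℂ i)) := tendsto_pi_nhds.1 hd'
  have hev := fun i => wTendsto_eval (hdi i)
  have hev' := fun i => wTendsto_eval (hdi' i)
  have hbil := eventually_separatedBy hd bilinear_independent
  have hcon := eventually_separatedBy hd conics_independent
  -- The curve.
  choose K hKt hKm hK0 using fun c => exists_perturbed_solution hev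
    (exists_forall_eq_of_independent (W := biForms ℂ 1 1) _ bilinear_independent) (baseK_mem c)
  have hbK : ∀ c i, aeval (complexBase i) (xVar c * yVar c) = (0 : ℂ) := fun c i => by
    fin_cases c <;> fin_cases i <;> simp [complexBase]
  have hKl : ∀ᶠ p in l, ∀ c i, eval (d p i) (K c p) = 0 := by
    filter_upwards [eventually_all.2 hK0] with p hp c i
    simpa [aeval_eq_eval] using (hp c i).trans (hbK c i)
  -- The bilinear forms were built to vanish on `d`; equality of moments extends this to `d'`.
  have hKr : ∀ᶠ p in l, ∀ c i, eval (d' p i) (K c p) = 0 := by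
    filter_upwards [hKl, hsame, hbil, hcon] with p h1 h2 h3 h4 c i
    exact eval_eq_zero_of_sameMoments h2 (separatedBy_conics_of_sameMoments h2 h3 h4) (hKm c p)
      (h1 c) i
  -- Interpolation at eleven of the twelve points.
  let ψ : Fin 5 ⊕ Fin 6 → X → MvPolynomial (Fin 3 ⊕ Fin 3) ℂ →ₗ[ℂ] ℂ :=
    Sum.elim (fun i p => (aeval (d p i.castSucc)).toLinearMap)
      (fun i p => (aeval (d' p i)).toLinearMap)
  let ψ₀ : Fin 5 ⊕ Fin 6 → MvPolynomial (Fin 3 ⊕ Fin 3) ℂ →ₗ[ℂ] ℂ :=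
    Sum.elim (fun i => (aeval (complexBase i.castSucc)).toLinearMap)
      (fun i => (aeval (realBase ℂ i)).toLinearMap)
  have hψ : ∀ i, WTendsto l (ψ i) (ψ₀ i) := by
    rintro (i | i)
    · exact hev _
    · exact hev' _
  have hψs := exists_forall_eq_of_independent (W := biForms ℂ 1 3) ψ₀ fun c hc =>
    eleven_points_independent c fun P hP => by
      simpa [Fintype.sum_sum_type, ψ₀, aeval_eq_eval] using hc P hP
  -- Equality of moments determines the value at the twelfth point from the other eleven.
  have last : ∀ p, SameMoments (d' p) (d p) → ∀ P ∈ biForms ℂ 1 3, ∀ x : Fin 6 → ℂ, ∑ i, x i = 0 →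
      (∀ i, eval (d' p i) P = 0) → (∀ i : Fin 5, eval (d p i.castSucc) P = x i.castSucc) →
      ∀ i, eval (d p i) P = x i := by
    intro p hp P hP x hx h1 h2
    have h3 := hp P hP
    rw [Finset.sum_eq_zero fun i _ => h1 i, Fin.sum_univ_castSucc] at h3
    rw [Fin.sum_univ_castSucc] at hx
    refine Fin.lastCases ?_ h2
    rw [Finset.sum_congr rfl fun i _ => h2 i] at h3
    linear_combination -h3 - hx
  obtain ⟨s, hst, hsm, hs0⟩ := exists_perturbed_solution hψ hψs baseForm_mem
  have hsr : ∀ᶠ p in l, ∀ i, eval (d' p i) (s p) = 0 := by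
    filter_upwards [hs0] with p hp i
    simpa [ψ, ψ₀, aeval_eq_eval, eval_realBase_baseForm] using hp (Sum.inr i)
  have hsl : ∀ᶠ p in l, ∀ i, eval (d p i) (s p) = 0 := by
    filter_upwards [hs0, hsr, hsame] with p hp h1 h2
    exact last p h2 _ (hsm p) 0 (by simp) h1 fun i => by
      simpa [ψ, ψ₀, aeval_eq_eval, eval_complexBase_baseForm] using hp (Sum.inl i)
  choose B₀ hB₀m hB₀ using fun i => hψs (Pi.single i 1)
  choose B hBt hBm hB using fun i => exists_perturbed_solution hψ hψs (hB₀m i)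
  have hrel : ∀ᶠ p in l, ∀ x : Fin 6 → ℂ, ∑ i, x i = 0 → ∃ h ∈ biForms ℂ 1 3,
      (∀ i, eval (d' p i) h = 0) ∧ ∀ i, eval (d p i) h = x i := by
    filter_upwards [eventually_all.2 hB, hsame] with p hp h2 x hx
    have hmem : ∑ i : Fin 5, x i.castSucc • B (Sum.inl i) p ∈ biForms ℂ 1 3 :=
      Submodule.sum_mem _ fun i _ => Submodule.smul_mem _ _ (hBm _ p)
    have hp' : ∀ (i : Fin 5) j, ψ j p (B (Sum.inl i) p) = if j = Sum.inl i then 1 else 0 :=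
      fun i j => by rw [hp, hB₀, Pi.single_apply]
    have h1 : ∀ i, eval (d' p i) (∑ i : Fin 5, x i.castSucc • B (Sum.inl i) p) = 0 := fun i => by
      have := fun j => hp' j (Sum.inr i)
      simp only [ψ, Sum.elim_inr, AlgHom.toLinearMap_apply, aeval_eq_eval, reduceCtorEq,
        if_false] at this
      rw [map_sum]
      exact Finset.sum_eq_zero fun j _ => by rw [smul_eval, this, mul_zero]
    refine ⟨_, hmem, h1, last p h2 _ hmem x hx h1 fun i => ?_⟩
    have := fun j => hp' j (Sum.inl i)
    simp only [ψ, Sum.elim_inl, AlgHom.toLinearMap_apply, aeval_eq_eval, Sum.inl.injEq] at this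
    simp only [map_sum, smul_eval, this, mul_ite, mul_one, mul_zero, Finset.sum_ite_eq,
      Finset.mem_univ, if_true]
  -- Tangent vectors.
  choose τ hτt hτK using fun i => exists_tangent (hdi i) hKt
    (fun c => by fin_cases c <;> fin_cases i <;>
      simp [complexBase, one_sub_I_ne_zero, one_add_I_ne_zero]) (fun c => complex_tangent_baseK c i)
  choose τ' hτt' hτK' using fun i => exists_tangent (hdi' i) hKt
    (fun c => by fin_cases c <;> fin_cases i <;> simp [realBase])
    (fun c => real_tangent_baseK c i)
  have htr : ∀ᶠ p in l, ∀ i, dirDeriv (d p i) (τ i p) (s p) ≠ 0 := eventually_all.2 fun i =>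
    ((wTendsto_dirDeriv (hdi i) (hτt i)).apply hst).eventually_ne (complex_transversal i)
  have htr' : ∀ᶠ p in l, ∀ i, dirDeriv (d' p i) (τ' i p) (s p) ≠ 0 := eventually_all.2 fun i =>
    ((wTendsto_dirDeriv (hdi' i) (hτt' i)).apply hst).eventually_ne (real_transversal i)
  -- Forms vanishing at the twelve points.
  have hgen : ∀ a b : ℕ, ∀ᶠ p in l, ∀ P ∈ biForms ℂ (a + 2) (b + 4),
      (∀ i, eval (d p i) P = 0) → (∀ i, eval (d' p i) P = 0) →
      InIdeal (s p) (fun c => K c p) (biForms ℂ (a + 1) (b + 1)) P := by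
    intro a b
    have := eventually_inIdeal (ι := Fin 6 ⊕ Fin 6) (V₁ := biForms ℂ (a + 1) (b + 1))
      (V₂ := biForms ℂ (a + 1) (b + 3)) (W := biForms ℂ (a + 2) (b + 4)) hst hKt
      (fun p h hh => biForms_mul_mem (hsm p) hh (by omega) (by omega))
      (fun c p h hh => biForms_mul_mem (hKm c p) hh (by omega) (by omega))
      (complementMonomials_mem a b)
      (φ := Sum.elim (fun i p => (aeval (d p i)).toLinearMap)
        (fun i p => (aeval (d' p i)).toLinearMap))
      (φ₀ := Sum.elim (fun i => (aeval (complexBase i)).toLinearMap)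
        (fun i => (aeval (realBase ℂ i)).toLinearMap))
      (by
        rintro (i | i)
        · exact hev i
        · exact hev' i)
      (by
        filter_upwards [hsl, hsr] with p h1 h2
        rintro (i | i) h -
        · simp [aeval_eq_eval, h1]
        · simp [aeval_eq_eval, h2])
      (by
        filter_upwards [hKl, hKr] with p h1 h2
        rintro (i | i) c h -
        · simp [aeval_eq_eval, h1]
        · simp [aeval_eq_eval, h2])
      (fun x hx => complementMonomials_injective a b x
        (fun i => by simpa [aeval_eq_eval] using hx (Sum.inl i))
        (fun i => by simpa [aeval_eq_eval] using hx (Sum.inr i)))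
      (fun R h1 h2 h3 => biForms_le_of_base h1 h2 h3)
    filter_upwards [this] with p hp P hP h1 h2
    refine hp P hP ?_
    rintro (i | i)
    · simpa [aeval_eq_eval] using h1 i
    · simpa [aeval_eq_eval] using h2 i
  -- Forms vanishing doubly at the first six points.
  let χ : Fin 6 ⊕ Fin 6 → X → MvPolynomial (Fin 3 ⊕ Fin 3) ℂ →ₗ[ℂ] ℂ :=
    Sum.elim (fun i p => (aeval (d p i)).toLinearMap) (fun i p => dirDeriv (d p i) (τ i p))
  let χ₀ : Fin 6 ⊕ Fin 6 → MvPolynomial (Fin 3 ⊕ Fin 3) ℂ →ₗ[ℂ] ℂ :=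
    Sum.elim (fun i => (aeval (complexBase i)).toLinearMap)
      (fun i => dirDeriv (complexBase i) (complexTangent i))
  have hχ : ∀ i, WTendsto l (χ i) (χ₀ i) := by
    rintro (i | i)
    · exact hev i
    · exact wTendsto_dirDeriv (hdi i) (hτt i)
  have hχinj : ∀ x : Fin 6 ⊕ Fin 6 → ℂ, (∀ i, χ₀ i (∑ j, x j • edgeMonomials j) = 0) → x = 0 :=
    fun x hx => edgeMonomials_injective x
      (fun i => by simpa [χ₀, aeval_eq_eval] using hx (Sum.inl i))
      (fun i => hx (Sum.inr i))
  have hdouble : ∀ᶠ p in l, ∀ t ∈ biForms ℂ 1 3, (∀ i, χ i p t = 0) →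
      InIdeal (s p) (fun c => K c p) ⊥ t := by
    -- Taking `⊥` for the multipliers of `s` leaves the ideal of the curve alone.
    refine eventually_inIdeal (V₁ := ⊥) (V₂ := biForms ℂ 0 2) hst hKt
      (fun p h hh => by rw [(Submodule.mem_bot ℂ).1 hh, mul_zero]; exact Submodule.zero_mem _)
      (fun c p h hh => biForms_mul_mem (hKm c p) hh) edgeMonomials_mem hχ ?_ ?_ hχinj
      (fun R _ h2 h3 => biForms_le_of_edgeMonomials h2 h3)
    · refine Eventually.of_forall fun p i h hh => ?_
      rw [(Submodule.mem_bot ℂ).1 hh, mul_zero, map_zero]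
    · filter_upwards [hKl, eventually_all.2 hτK] with p h1 h2
      rintro (i | i) c h -
      · simp [χ, aeval_eq_eval, h1]
      · simp [χ, dirDeriv_mul, h1, h2]
  have hχs := exists_forall_eq_of_injective edgeMonomials_mem hχinj
  choose J₀ hJ₀m hJ₀ using fun i : Fin 6 => hχs (Pi.single (Sum.inr i) 1)
  choose J hJt hJm hJ using fun i => exists_perturbed_solution hχ hχs (hJ₀m i)
  -- `hgen 0 2` and `hgen 10 8` are the bidegrees (2,6) and (12,12) of `generation` and `cut_out`.
  filter_upwards [hsame, hbil, hcon, hKl, hsl, hsr, eventually_all.2 hτK, eventually_all.2 hτK',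
    htr, htr', hgen 0 2, hgen 10 8, hdouble, hrel, eventually_all.2 hJ]
    with p q1 q2 q3 q4 q5 q6 q7 q8 q9 q10 q11 q12 q13 q14 q15
  have hJ' : ∀ i j, χ j p (J i p) = if j = Sum.inr i then 1 else 0 := fun i j => by
    rw [q15, hJ₀, Pi.single_apply]
  have hJl : ∀ i j, eval (d p j) (J i p) = 0 := fun i j => by
    simpa [χ, aeval_eq_eval] using hJ' i (Sum.inl j)
  have hJr : ∀ i j, dirDeriv (d p j) (τ j p) (J i p) = if j = i then 1 else 0 := fun i j => by
    simpa [χ] using hJ' i (Sum.inr j)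
  exact ⟨{
    same := q1
    bilinear := q2
    conics := q3
    K := fun c => K c p
    K_mem := fun c => hKm c p
    K_left := q4
    s := s p
    s_mem := hsm p
    s_left := q5
    s_right := q6
    τ := fun i => τ i p
    τ' := fun i => τ' i p
    K_tangent := fun c i => q7 i c
    K_tangent' := fun c i => q8 i c
    s_transversal := q9
    s_transversal' := q10
    generation := fun P hP h1 h2 => by
      obtain ⟨h, hh, κ, e⟩ := q11 P hP h1 h2
      exact ⟨h, hh, κ, e⟩
    cut_out := fun P hP h1 h2 => by
      obtain ⟨h, -, κ, e⟩ := q12 P hP h1 h2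
      exact ⟨h, trivial, κ, e⟩
    jet := ∑ i, (LinearMap.proj i : (Fin 6 → ℂ) →ₗ[ℂ] ℂ).smulRight (J i p)
    jet_mem := fun y => by
      simp only [LinearMap.sum_apply, LinearMap.smulRight_apply]
      exact Submodule.sum_mem _ fun i _ => Submodule.smul_mem _ _ (hJm i p)
    eval_jet := fun y i => by
      simp [LinearMap.sum_apply, smul_eval, hJl]
    dirDeriv_jet := fun y i => by
      simp [LinearMap.sum_apply, hJr]
    double := fun t ht h1 h2 => by
      obtain ⟨h, hh, κ, e⟩ := q13 t ht (by
        rintro (i | i)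
        · simpa [χ, aeval_eq_eval] using h1 i
        · exact h2 i)
      exact ⟨κ, by rw [e, (Submodule.mem_bot ℂ).1 hh]; simp⟩
    interpolation := q14 }⟩

end ResidualPairs

/-! ### The moment map and its openness -/

section Moments

open MvPolynomial Filter

theorem hasStrictFDerivAt_mvPolynomial_eval {σ 𝕜 : Type*} [Fintype σ] [NontriviallyNormedField 𝕜]
    (P : MvPolynomial σ 𝕜) (z : σ → 𝕜) :
    HasStrictFDerivAt (fun z : σ → 𝕜 => eval z P)
      (∑ i, eval z (pderiv i P) • (ContinuousLinearMap.proj i : (σ → 𝕜) →L[𝕜] 𝕜)) z := by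
  classical
  induction P using MvPolynomial.induction_on with
  | C a =>
    simp only [eval_C]
    exact (hasStrictFDerivAt_const a z).congr_fderiv (by ext; simp)
  | add P Q hP hQ =>
    simp only [map_add]
    exact (hP.fun_add hQ).congr_fderiv (ContinuousLinearMap.ext fun v => by
      simp [sum_apply, add_mul, Finset.sum_add_distrib])
  | mul_X P i hP =>
    have hX : HasStrictFDerivAt (fun z : σ → 𝕜 => z i)
        (ContinuousLinearMap.proj i : (σ → 𝕜) →L[𝕜] 𝕜) z :=
      (ContinuousLinearMap.proj i : (σ → 𝕜) →L[𝕜] 𝕜).hasStrictFDerivAt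
    simp only [map_mul, eval_X]
    refine (hP.fun_mul hX).congr_fderiv ?_
    have e : ∀ j, eval z (pderiv j (P * X i)) = (if i = j then eval z P else 0) +
        z i * eval z (pderiv j P) := fun j => by
      by_cases h : i = j
      · subst h; simp
      · simp [h, pderiv_X_of_ne h]
    exact ContinuousLinearMap.ext fun v => by
      simp only [sum_apply, smul_apply, add_apply, e, smul_eq_mul, add_mul, ite_mul, zero_mul,
        ContinuousLinearMap.proj_apply, Finset.sum_add_distrib, Finset.sum_ite_eq, Finset.mem_univ,
        if_true, Finset.mul_sum, mul_assoc]

/-- Exponents of the ternary cubic monomials. -/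
def cubicExp : Fin 10 → Fin 3 → ℕ :=
  ![![3, 0, 0], ![0, 3, 0], ![0, 0, 3], ![2, 1, 0], ![2, 0, 1], ![1, 2, 0], ![0, 2, 1], ![1, 0, 2],
    ![0, 1, 2], ![1, 1, 1]]

theorem exists_cubicExp {β : Fin 3 → ℕ} (h : ∑ i, β i = 3) : ∃ n, cubicExp n = β := by
  rw [Fin.sum_univ_three] at h
  have e : β = ![β 0, β 1, β 2] := by ext i; fin_cases i <;> rfl
  generalize β 0 = p at *
  generalize β 1 = q at *
  generalize β 2 = r at *
  subst e
  have hp : p ≤ 3 := by omega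
  have hq : q ≤ 3 := by omega
  obtain rfl : r = 3 - p - q := by omega
  interval_cases p <;> interval_cases q <;> first | (exfalso; omega) | decide

/-- The monomial of bidegree `(1, 3)` dual to a coefficient of a triple of cubics. -/
noncomputable def momentPoly (k : Type*) [Field k] (a : Fin 3) (n : Fin 10) :
    MvPolynomial (Fin 3 ⊕ Fin 3) k :=
  biMonomial k (Pi.single a 1) (cubicExp n)

/-- The cubic moments of a family of points. -/
noncomputable def moments {k : Type*} [Field k] {m : ℕ} (g : Fin m → Fin 3 ⊕ Fin 3 → k) :
    Fin 3 → Fin 10 → k :=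
  fun a n => ∑ j, eval (g j) (momentPoly k a n)

theorem sameMoments_of_moments_eq {k : Type*} [Field k] {m n : ℕ} {g : Fin m → Fin 3 ⊕ Fin 3 → k}
    {d : Fin n → Fin 3 ⊕ Fin 3 → k} (h : moments g = moments d) : SameMoments g d := by
  let R : Submodule k (MvPolynomial (Fin 3 ⊕ Fin 3) k) :=
    LinearMap.eqLocus (∑ j, (aeval (g j)).toLinearMap) (∑ i, (aeval (d i)).toLinearMap)
  have hR : biForms k 1 3 ≤ R := by
    refine biForms_le fun α β hα hβ => ?_
    obtain ⟨n, rfl⟩ := exists_cubicExp hβ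
    obtain ⟨a, rfl⟩ : ∃ a, α = Pi.single a 1 := by
      rw [Fin.sum_univ_three] at hα
      obtain h | h | h : α 0 = 1 ∨ α 1 = 1 ∨ α 2 = 1 := by omega
      · exact ⟨0, by ext i; fin_cases i <;> simp <;> omega⟩
      · exact ⟨1, by ext i; fin_cases i <;> simp <;> omega⟩
      · exact ⟨2, by ext i; fin_cases i <;> simp <;> omega⟩
    have := congrFun (congrFun h a) n
    simpa [R, LinearMap.mem_eqLocus, aeval_eq_eval, moments, momentPoly] using this
  intro P hP
  have := hR hP
  simpa [R, LinearMap.mem_eqLocus, aeval_eq_eval] using this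

/-- The moment map is open at a family of points at which no form of bidegree `(1, 3)` is
singular. -/
theorem map_moments_nhds {𝕜 : Type*} [NontriviallyNormedField 𝕜] [CompleteSpace 𝕜] {m : ℕ}
    (g : Fin m → Fin 3 ⊕ Fin 3 → 𝕜)
    (h : ∀ c : Fin 3 → Fin 10 → 𝕜, (∀ j i,
      eval (g j) (pderiv i (∑ a, ∑ n, c a n • momentPoly 𝕜 a n)) = 0) → c = 0) :
    map moments (𝓝 g) = 𝓝 (moments g) := by
  classical
  let f' : (Fin m → Fin 3 ⊕ Fin 3 → 𝕜) →L[𝕜] (Fin 3 → Fin 10 → 𝕜) :=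
    ContinuousLinearMap.pi fun a => ContinuousLinearMap.pi fun n => ∑ j,
      (∑ i, eval (g j) (pderiv i (momentPoly 𝕜 a n)) •
        (ContinuousLinearMap.proj i : (Fin 3 ⊕ Fin 3 → 𝕜) →L[𝕜] 𝕜)) ∘L
        (ContinuousLinearMap.proj j : (Fin m → Fin 3 ⊕ Fin 3 → 𝕜) →L[𝕜] (Fin 3 ⊕ Fin 3 → 𝕜))
  have hf : HasStrictFDerivAt moments f' g := by
    refine hasStrictFDerivAt_pi'' fun a => hasStrictFDerivAt_pi'' fun n => ?_
    have : HasStrictFDerivAt (fun g : Fin m → Fin 3 ⊕ Fin 3 → 𝕜 =>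
        ∑ j, eval (g j) (momentPoly 𝕜 a n)) (∑ j,
      (∑ i, eval (g j) (pderiv i (momentPoly 𝕜 a n)) •
        (ContinuousLinearMap.proj i : (Fin 3 ⊕ Fin 3 → 𝕜) →L[𝕜] 𝕜)) ∘L
        (ContinuousLinearMap.proj j : (Fin m → Fin 3 ⊕ Fin 3 → 𝕜) →L[𝕜] (Fin 3 ⊕ Fin 3 → 𝕜))) g :=
      HasStrictFDerivAt.fun_sum fun j _ =>
        (hasStrictFDerivAt_mvPolynomial_eval (momentPoly 𝕜 a n) (g j)).comp g
          (ContinuousLinearMap.proj (R := 𝕜) (φ := fun _ : Fin m => Fin 3 ⊕ Fin 3 → 𝕜)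
            j).hasStrictFDerivAt
    exact this
  refine hf.map_nhds_eq_of_surj ?_
  by_contra hne
  obtain ⟨φ, hφ, hφ'⟩ := Submodule.exists_dual_map_eq_bot_of_lt_top (lt_top_iff_ne_top.2 hne)
    inferInstance
  -- A functional annihilating the image of the derivative is the coefficient vector of a form of
  -- bidegree (1,3) whose gradient vanishes at every point (Terracini).
  let c : Fin 3 → Fin 10 → 𝕜 := fun a n => φ (Pi.single a (Pi.single n 1))
  have hφc : ∀ w, φ w = ∑ a, ∑ n, c a n * w a n := fun w => by
    have hw : w = ∑ a, ∑ n, w a n • Pi.single a (Pi.single n (1 : 𝕜)) := by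
      ext a n
      simp [Finset.sum_apply, Pi.single_apply, ite_apply]
    conv_lhs => rw [hw]
    simp [c, mul_comm]
  have hc : c = 0 := h c fun j i => by
    have h1 : φ (f' (Pi.single j (Pi.single i 1))) = 0 := by
      have : φ (f' (Pi.single j (Pi.single i 1))) ∈ (f'.range).map φ := ⟨_, ⟨_, rfl⟩, rfl⟩
      rwa [hφ', Submodule.mem_bot] at this
    rw [hφc] at h1
    rw [← h1]
    simp only [map_sum]
    refine Finset.sum_congr rfl fun a _ => Finset.sum_congr rfl fun n _ => ?_
    simp only [f', ContinuousLinearMap.pi_apply, sum_apply,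
      ContinuousLinearMap.comp_apply, ContinuousLinearMap.proj_apply,
      smul_apply, smul_eq_mul]
    rw [Finset.sum_eq_single j, Finset.sum_eq_single i]
    · simp
    · intro b _ hb; simp [hb]
    · simp
    · intro b _ hb; simp [hb]
    · simp
  exact hφ (LinearMap.ext fun w => by rw [hφc, hc]; simp)

end Moments

/-! ### Submersivity and equality of moments at the base points -/

section BaseMoments

open MvPolynomial Filter

variable {k : Type*} [Field k]

theorem momentPoly_eq (a : Fin 3) (n : Fin 10) : momentPoly k a n = X (Sum.inl a) *
    (X (Sum.inr 0) ^ cubicExp n 0 * X (Sum.inr 1) ^ cubicExp n 1 *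
      X (Sum.inr 2) ^ cubicExp n 2) := by
  simp only [momentPoly, biMonomial, Fin.prod_univ_three]
  fin_cases a <;> simp

theorem eval_momentPoly (z : Fin 3 ⊕ Fin 3 → k) (a : Fin 3) (n : Fin 10) :
    eval z (momentPoly k a n) = z (Sum.inl a) * (z (Sum.inr 0) ^ cubicExp n 0 *
      z (Sum.inr 1) ^ cubicExp n 1 * z (Sum.inr 2) ^ cubicExp n 2) := by
  simp [momentPoly_eq]

/-- The value at `l` of the cubic form with coefficients `c`. -/
def cubicValue (c : Fin 10 → k) (l : Fin 3 → k) : k :=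
  c 0 * l 0 ^ 3 + c 1 * l 1 ^ 3 + c 2 * l 2 ^ 3 + c 3 * (l 0 ^ 2 * l 1) + c 4 * (l 0 ^ 2 * l 2) +
    c 5 * (l 0 * l 1 ^ 2) + c 6 * (l 1 ^ 2 * l 2) + c 7 * (l 0 * l 2 ^ 2) + c 8 * (l 1 * l 2 ^ 2) +
    c 9 * (l 0 * l 1 * l 2)

/-- The gradient at `l` of the cubic form with coefficients `c`. -/
def cubicGrad (c : Fin 10 → k) (l : Fin 3 → k) : Fin 3 → k :=
  ![3 * c 0 * l 0 ^ 2 + 2 * c 3 * (l 0 * l 1) + 2 * c 4 * (l 0 * l 2) + c 5 * l 1 ^ 2 +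
      c 7 * l 2 ^ 2 + c 9 * (l 1 * l 2),
    3 * c 1 * l 1 ^ 2 + c 3 * l 0 ^ 2 + 2 * c 5 * (l 0 * l 1) + 2 * c 6 * (l 1 * l 2) +
      c 8 * l 2 ^ 2 + c 9 * (l 0 * l 2),
    3 * c 2 * l 2 ^ 2 + c 4 * l 0 ^ 2 + c 6 * l 1 ^ 2 + 2 * c 7 * (l 0 * l 2) +
      2 * c 8 * (l 1 * l 2) + c 9 * (l 0 * l 1)]

theorem eval_pderiv_inl_sum_momentPoly (c : Fin 3 → Fin 10 → k) (z : Fin 3 ⊕ Fin 3 → k)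
    (b : Fin 3) : eval z (pderiv (Sum.inl b) (∑ a, ∑ n, c a n • momentPoly k a n)) =
      cubicValue (c b) fun i => z (Sum.inr i) := by
  have key : ∀ a n, eval z (pderiv (Sum.inl b) (momentPoly k a n)) = if a = b then
      z (Sum.inr 0) ^ cubicExp n 0 * z (Sum.inr 1) ^ cubicExp n 1 * z (Sum.inr 2) ^ cubicExp n 2
      else 0 := fun a n => by
    classical
    have hy : ∀ i, pderiv (Sum.inl b) (X (Sum.inr i) : MvPolynomial (Fin 3 ⊕ Fin 3) k) = 0 :=
      fun i => pderiv_X_of_ne (by simp)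
    by_cases h : a = b
    · subst h; simp [momentPoly_eq, hy]
    · have : pderiv (Sum.inl b) (X (Sum.inl a) : MvPolynomial (Fin 3 ⊕ Fin 3) k) = 0 :=
        pderiv_X_of_ne (by simpa using h)
      simp [momentPoly_eq, hy, h, this]
  rw [map_sum, map_sum, Finset.sum_eq_single b (by intro a _ h; simp [key, h]) (by simp)]
  simp [key, Fin.sum_univ_succ, cubicExp, cubicValue]
  ring

theorem eval_pderiv_inr_sum_momentPoly (c : Fin 3 → Fin 10 → k) (z : Fin 3 ⊕ Fin 3 → k)
    (b : Fin 3) : eval z (pderiv (Sum.inr b) (∑ a, ∑ n, c a n • momentPoly k a n)) =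
      ∑ a, z (Sum.inl a) * cubicGrad (c a) (fun i => z (Sum.inr i)) b := by
  rw [map_sum, map_sum]
  refine Finset.sum_congr rfl fun a _ => ?_
  fin_cases b <;>
    simp [momentPoly_eq, Derivation.leibniz_pow, Fin.sum_univ_succ, cubicExp,
      cubicGrad] <;> ring

/-- The 36 partial derivatives satisfy one Euler relation per point, which leaves 30 conditions on
30 coefficients; the system is solved directly. -/
theorem cubic_eq_zero_of_realBase (c : Fin 3 → Fin 10 → ℝ) (h : ∀ j i,
    eval (realBase ℝ j) (pderiv i (∑ a, ∑ n, c a n • momentPoly ℝ a n)) = 0) : c = 0 := by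
  have hv := fun j b => h j (Sum.inl b)
  have hg := fun j b => h j (Sum.inr b)
  simp only [eval_pderiv_inl_sum_momentPoly, eval_pderiv_inr_sum_momentPoly] at hv hg
  simp [Fin.forall_fin_succ, Fin.sum_univ_three, realBase, cubicValue, cubicGrad] at hv hg
  ext a n
  fin_cases a <;> fin_cases n <;> simp <;> linarith

theorem eq_of_conjugate_roots {p q r : ℂ}
    (h1 : p + q * (1 + Complex.I) + r * (1 + Complex.I) ^ 2 = 0)
    (h2 : p + q * (1 - Complex.I) + r * (1 - Complex.I) ^ 2 = 0) : p + q = 0 ∧ q + 2 * r = 0 :=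
  eq_zero_of_add_sub_mul_I (by linear_combination h1 - r * Complex.I_sq)
    (by linear_combination h2 - r * Complex.I_sq)

/-- A cubic form vanishing at three conjugate pairs of points, and singular at the first pair. -/
theorem coeffs_eq_zero_of_conjugate_pairs {jjj jjk jkk kkk ijj ijk ikk iii iik iij : ℂ}
    (h : ∀ w, w = 1 + Complex.I ∨ w = 1 - Complex.I →
      jjj + jjk * w + jkk * w ^ 2 + kkk * w ^ 3 = 0 ∧
      jjk + jkk * (2 * w) + kkk * (3 * w ^ 2) = 0 ∧
      ijj + ijk * w + ikk * w ^ 2 = 0 ∧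
      kkk + ikk * w + iik * w ^ 2 + iii * w ^ 3 = 0 ∧
      iii + iij * w + ijj * w ^ 2 + jjj * w ^ 3 = 0) :
    (jjj = 0 ∧ jjk = 0 ∧ jkk = 0 ∧ kkk = 0) ∧ (ijj = 0 ∧ ijk = 0 ∧ ikk = 0) ∧
      iii = 0 ∧ iik = 0 ∧ iij = 0 := by
  obtain ⟨a1, a2, a3, a4, a5⟩ := h _ (Or.inl rfl)
  obtain ⟨b1, b2, b3, b4, b5⟩ := h _ (Or.inr rfl)
  -- The restriction to the line of the first pair is a binary cubic with two double roots, so it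
  -- vanishes.
  obtain ⟨rfl, rfl, rfl, rfl⟩ := eq_zero_of_two_double_roots a1 b1 a2 b2
  obtain ⟨c1, c2⟩ := eq_of_conjugate_roots a3 b3
  obtain ⟨c3, c4⟩ := eq_of_conjugate_roots (p := ikk) (q := iik) (r := iii)
    (mul_left_cancel₀ one_add_I_ne_zero (by linear_combination a4))
    (mul_left_cancel₀ one_sub_I_ne_zero (by linear_combination b4))
  obtain ⟨c5, c6⟩ := eq_of_conjugate_roots (p := iii) (q := iij) (r := ijj)
    (by linear_combination a5) (by linear_combination b5)
  -- Each remaining quadratic is a multiple of w² - 2w + 2, so `ijj`, `ikk`, `iii` satisfy cyclic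
  -- doubling relations and `iii = 8 iii`.
  have hi : iii = 0 := by
    linear_combination -(c5 - c6 + 2 * (c1 - c2) + 4 * (c3 - c4)) / 7
  have hA : ijj = 0 := by linear_combination (c6 - c5 + hi) / 2
  have hB : ijk = 0 := by linear_combination c1 - hA
  exact ⟨⟨rfl, rfl, rfl, rfl⟩, ⟨hA, hB, by linear_combination (c2 - hB) / 2⟩, hi,
    by linear_combination c4 - 2 * hi, by linear_combination c5 - hi⟩

/-- Each point of `complexBase` has only one non-zero first coordinate, so the gradient condition
there concerns a single cubic. Each cubic vanishes at all six points and is singular at the pair on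
its own edge. -/
theorem cubic_eq_zero_of_complexBase (c : Fin 3 → Fin 10 → ℂ) (h : ∀ j i,
    eval (complexBase j) (pderiv i (∑ a, ∑ n, c a n • momentPoly ℂ a n)) = 0) : c = 0 := by
  have hv := fun j b => h j (Sum.inl b)
  have hg : ∀ j b, cubicGrad (c ((![0, 1, 2, 0, 1, 2] : Fin 6 → Fin 3) j))
      (fun i => complexBase j (Sum.inr i)) b = 0 := fun j b => by
    have h1 := h j (Sum.inr b)
    rw [eval_pderiv_inr_sum_momentPoly, Finset.sum_eq_single
      ((![0, 1, 2, 0, 1, 2] : Fin 6 → Fin 3) j)] at h1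
    · refine (mul_eq_zero.1 h1).resolve_left ?_
      have e1 := div_ne_zero one_sub_I_ne_zero (two_ne_zero (α := ℂ))
      have e2 := div_ne_zero one_add_I_ne_zero (two_ne_zero (α := ℂ))
      fin_cases j <;> first | exact e1 | exact e2
    · intro a _ ha
      fin_cases j <;> fin_cases a <;> simp [complexBase] at ha ⊢
    · simp
  simp only [eval_pderiv_inl_sum_momentPoly] at hv
  have hv' : ∀ w, w = 1 + Complex.I ∨ w = 1 - Complex.I → ∀ b, cubicValue (c b) ![0, 1, w] = 0 ∧
      cubicValue (c b) ![w, 0, 1] = 0 ∧ cubicValue (c b) ![1, w, 0] = 0 := by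
    rintro w (rfl | rfl) b
    · exact ⟨hv 0 b, hv 1 b, hv 2 b⟩
    · exact ⟨hv 3 b, hv 4 b, hv 5 b⟩
  have hg' : ∀ w, w = 1 + Complex.I ∨ w = 1 - Complex.I → ∀ b, cubicGrad (c 0) ![0, 1, w] b = 0 ∧
      cubicGrad (c 1) ![w, 0, 1] b = 0 ∧ cubicGrad (c 2) ![1, w, 0] b = 0 := by
    rintro w (rfl | rfl) b
    · exact ⟨hg 0 b, hg 1 b, hg 2 b⟩
    · exact ⟨hg 3 b, hg 4 b, hg 5 b⟩
  have h0 := coeffs_eq_zero_of_conjugate_pairs (jjj := c 0 1) (jjk := c 0 6) (jkk := c 0 8)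
    (kkk := c 0 2) (ijj := c 0 5) (ijk := c 0 9) (ikk := c 0 7) (iii := c 0 0) (iik := c 0 4)
    (iij := c 0 3) fun w hw => by
      obtain ⟨e1, e4, e5⟩ : _ ∧ _ ∧ _ := ⟨(hv' w hw 0).1, (hv' w hw 0).2.1, (hv' w hw 0).2.2⟩
      obtain ⟨e2, e3⟩ : _ ∧ _ := ⟨(hg' w hw 2).1, (hg' w hw 0).1⟩
      simp only [cubicValue, cubicGrad, Matrix.cons_val] at e1 e2 e3 e4 e5
      exact ⟨by linear_combination e1, by linear_combination e2, by linear_combination e3,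
        by linear_combination e4, by linear_combination e5⟩
  have h1 := coeffs_eq_zero_of_conjugate_pairs (jjj := c 1 2) (jjk := c 1 7) (jkk := c 1 4)
    (kkk := c 1 0) (ijj := c 1 8) (ijk := c 1 9) (ikk := c 1 3) (iii := c 1 1) (iik := c 1 5)
    (iij := c 1 6) fun w hw => by
      obtain ⟨e1, e4, e5⟩ : _ ∧ _ ∧ _ := ⟨(hv' w hw 1).2.1, (hv' w hw 1).2.2, (hv' w hw 1).1⟩
      obtain ⟨e2, e3⟩ : _ ∧ _ := ⟨(hg' w hw 0).2.1, (hg' w hw 1).2.1⟩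
      simp only [cubicValue, cubicGrad, Matrix.cons_val] at e1 e2 e3 e4 e5
      exact ⟨by linear_combination e1, by linear_combination e2, by linear_combination e3,
        by linear_combination e4, by linear_combination e5⟩
  have h2 := coeffs_eq_zero_of_conjugate_pairs (jjj := c 2 0) (jjk := c 2 3) (jkk := c 2 5)
    (kkk := c 2 1) (ijj := c 2 4) (ijk := c 2 9) (ikk := c 2 6) (iii := c 2 2) (iik := c 2 8)
    (iij := c 2 7) fun w hw => by
      obtain ⟨e1, e4, e5⟩ : _ ∧ _ ∧ _ := ⟨(hv' w hw 2).2.2, (hv' w hw 2).1, (hv' w hw 2).2.1⟩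
      obtain ⟨e2, e3⟩ : _ ∧ _ := ⟨(hg' w hw 1).2.2, (hg' w hw 2).2.2⟩
      simp only [cubicValue, cubicGrad, Matrix.cons_val] at e1 e2 e3 e4 e5
      exact ⟨by linear_combination e1, by linear_combination e2, by linear_combination e3,
        by linear_combination e4, by linear_combination e5⟩
  ext a n
  fin_cases a <;> fin_cases n <;> simp [h0, h1, h2]

/-- The scalings of the first coordinates of the base points are the weights in the linear relation
among evaluations at the twelve zeros of `baseForm` on the hexagon, with opposite signs for the two
families. -/
theorem moments_complexBase : moments complexBase = moments (realBase ℂ) := by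
  ext a n
  simp only [moments, eval_momentPoly]
  fin_cases a <;> fin_cases n <;>
    simp [Fin.sum_univ_succ, cubicExp, complexBase, realBase] <;> ring_nf <;>
    simp [Complex.I_sq] <;> ring_nf

theorem map_eval_momentPoly {F K : Type*} [Field F] [Field K] (φ : F →+* K)
    (z : Fin 3 ⊕ Fin 3 → F) (a : Fin 3) (n : Fin 10) :
    eval (fun i => φ (z i)) (momentPoly K a n) = φ (eval z (momentPoly F a n)) := by
  simp [eval_momentPoly]

theorem realBase_map (i : Fin 6) (j : Fin 3 ⊕ Fin 3) :
    realBase ℂ i j = Complex.ofRealHom (realBase ℝ i j) := by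
  rcases j with j | j <;> fin_cases i <;> fin_cases j <;> simp [realBase]

end BaseMoments

/-! ### Power sums of linear forms as moments -/

section PowerSums

open MvPolynomial

variable {F : Type} [Field F]

/-- The linear form with coefficients `l`. -/
noncomputable def linForm (l : Fin 3 → F) : homogeneousSubmodule (Fin 3) F 1 :=
  ⟨∑ i, C (l i) * X i, Submodule.sum_mem _ fun i _ => by
    rw [← smul_eq_C_mul]; exact Submodule.smul_mem _ _ (isHomogeneous_X F i)⟩

/-- The coefficients of a linear form. -/
noncomputable def linCoeff (p : MvPolynomial (Fin 3) F) : Fin 3 → F :=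
  fun i => coeff (Finsupp.single i 1) p

theorem linCoeff_linForm (l : Fin 3 → F) : linCoeff (linForm l : MvPolynomial (Fin 3) F) = l := by
  ext i
  simp [linCoeff, linForm, coeff_sum, coeff_C_mul, coeff_X,
    Finsupp.single_left_inj (one_ne_zero (α := ℕ))]

theorem linForm_linCoeff (p : homogeneousSubmodule (Fin 3) F 1) :
    linForm (linCoeff (p : MvPolynomial (Fin 3) F)) = p := by
  refine Subtype.ext (MvPolynomial.ext _ _ fun m => ?_)
  by_cases hm : m.degree = 1
  · obtain ⟨i, rfl⟩ := (Finsupp.range_single_one (σ := Fin 3)).ge hm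
    exact congrFun (linCoeff_linForm _) i
  · rw [((mem_homogeneousSubmodule _ _).1 p.2).coeff_eq_zero hm,
      ((mem_homogeneousSubmodule _ _).1 (linForm _).2).coeff_eq_zero hm]

theorem coeff_linForm_pow (l : Fin 3 → F) (β : Fin 3 → ℕ) :
    coeff (Finsupp.equivFunOnFinite.symm β) ((linForm l : MvPolynomial (Fin 3) F) ^ ∑ i, β i) =
      Nat.multinomial Finset.univ β * ∏ i, l i ^ β i := by
  classical
  have key : ∀ γ : Fin 3 → ℕ, ∏ i, (C (l i) * X i : MvPolynomial (Fin 3) F) ^ γ i =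
      monomial (Finsupp.equivFunOnFinite.symm γ) (∏ i, l i ^ γ i) := fun γ => by
    rw [monomial_eq, Finsupp.prod_fintype _ _ (by simp)]
    simp [mul_pow, Finset.prod_mul_distrib]
  simp only [linForm]
  rw [Finset.sum_pow_eq_sum_piAntidiag, coeff_sum, Finset.sum_eq_single β]
  · rw [key, ← map_natCast (C : F →+* MvPolynomial (Fin 3) F), coeff_C_mul, coeff_monomial,
      if_pos rfl]
  · intro γ _ hγ
    rw [key, ← map_natCast (C : F →+* MvPolynomial (Fin 3) F), coeff_C_mul, coeff_monomial,
      if_neg (by simpa using hγ), mul_zero]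
  · intro h
    simp at h

/-- The coefficients of a ternary form, divided by multinomial coefficients. -/
noncomputable def polarCoeff (p : MvPolynomial (Fin 3) F) (β : Fin 3 → ℕ) : F :=
  coeff (Finsupp.equivFunOnFinite.symm β) p / Nat.multinomial Finset.univ β

/-- In characteristic zero the multinomial coefficients can be divided out, which leaves the power
moments of the coefficient vectors. -/
theorem eq_sum_pow_iff [CharZero F] {m e : ℕ} {p : MvPolynomial (Fin 3) F}
    (hp : p.IsHomogeneous e) (μ : Fin m → F) (ℓ : Fin m → homogeneousSubmodule (Fin 3) F 1) :
    p = ∑ i, μ i • (ℓ i : MvPolynomial (Fin 3) F) ^ e ↔ ∀ β : Fin 3 → ℕ, ∑ i, β i = e →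
      ∑ i, μ i * ∏ b, linCoeff (ℓ i : MvPolynomial (Fin 3) F) b ^ β b = polarCoeff p β := by
  have hm : ∀ β : Fin 3 → ℕ, (Nat.multinomial Finset.univ β : F) ≠ 0 := fun β => by
    exact_mod_cast (Nat.multinomial_pos _ _).ne'
  have key : ∀ β : Fin 3 → ℕ, ∑ i, β i = e →
      coeff (Finsupp.equivFunOnFinite.symm β) (∑ i, μ i • (ℓ i : MvPolynomial (Fin 3) F) ^ e) =
      Nat.multinomial Finset.univ β *
        ∑ i, μ i * ∏ b, linCoeff (ℓ i : MvPolynomial (Fin 3) F) b ^ β b := by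
    rintro β rfl
    rw [coeff_sum, Finset.mul_sum]
    refine Finset.sum_congr rfl fun i _ => ?_
    conv_lhs => rw [← linForm_linCoeff (ℓ i)]
    rw [coeff_smul, coeff_linForm_pow, smul_eq_mul]
    ring
  constructor
  · intro h β hβ
    rw [polarCoeff, h, key β hβ, mul_div_cancel_left₀ _ (hm β)]
  · intro h
    ext n
    by_cases hn : n.degree = e
    · obtain ⟨β, rfl⟩ := Finsupp.equivFunOnFinite.symm.surjective n
      have hβ : ∑ i, β i = e := by
        rw [← hn, Finsupp.degree_eq_sum]; rfl
      rw [key β hβ, h β hβ, polarCoeff, mul_div_cancel₀ _ (hm β)]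
    · rw [hp.coeff_eq_zero hn, IsHomogeneous.coeff_eq_zero _ hn]
      refine IsHomogeneous.sum _ _ _ fun i _ => ?_
      rw [smul_eq_C_mul]
      simpa using (isHomogeneous_C _ _).mul
        (((mem_homogeneousSubmodule _ _).1 (ℓ i).2).pow e)

/-- The conic dual to point `j`, times the power `e - 2` of a coordinate non-zero there, is a form
of degree `e` seeing only that point. -/
theorem eq_zero_of_power_moments {n e : ℕ} {z : Fin n → Fin 3 ⊕ Fin 3 → F} (h02 : SeparatedBy 0 2 z)
    (he : 2 ≤ e) {μ : Fin n → F} (h : ∀ β : Fin 3 → ℕ, ∑ i, β i = e →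
      ∑ i, μ i * ∏ b, z i (Sum.inr b) ^ β b = 0) : μ = 0 := by
  ext j
  obtain ⟨r, hr⟩ := Function.ne_iff.1 (inr_ne_zero_of_separatedBy h02 j)
  obtain ⟨q, hq, hqz⟩ := h02
  let R : Submodule F (MvPolynomial (Fin 3 ⊕ Fin 3) F) :=
    LinearMap.ker (∑ i, μ i • (aeval (z i)).toLinearMap)
  have hR : biForms F 0 e ≤ R := biForms_le fun α β hα hβ => by
    have hα' : ∀ i, α i = 0 := by simpa using hα
    simpa [R, LinearMap.sum_apply, aeval_eq_eval, biMonomial, hα'] using h β hβ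
  have hX := biForms_pow_mem (X_inr_mem (k := F) r) (e - 2)
  have := hR (biForms_mul_mem (hq j) hX (by simp) (by simp; omega))
  simp only [R, LinearMap.mem_ker, LinearMap.sum_apply, LinearMap.smul_apply,
    AlgHom.toLinearMap_apply, aeval_eq_eval, map_mul, hqz, map_pow, eval_X] at this
  rw [Finset.sum_eq_single j (fun i _ hi => by simp [hi.symm]) (by simp)] at this
  simpa [show z j (Sum.inr r) ≠ 0 from hr] using this

/-- Exponents of the ternary quadratic monomials. -/
def quadExp : Fin 6 → Fin 3 → ℕ :=
  ![![2, 0, 0], ![0, 2, 0], ![0, 0, 2], ![1, 1, 0], ![1, 0, 1], ![0, 1, 1]]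

theorem exists_quadExp {β : Fin 3 → ℕ} (h : ∑ i, β i = 2) : ∃ n, quadExp n = β := by
  rw [Fin.sum_univ_three] at h
  have e : β = ![β 0, β 1, β 2] := by ext i; fin_cases i <;> rfl
  generalize β 0 = p at *
  generalize β 1 = q at *
  generalize β 2 = r at *
  subst e
  have hp : p ≤ 2 := by omega
  have hq : q ≤ 2 := by omega
  obtain rfl : r = 2 - p - q := by omega
  interval_cases p <;> interval_cases q <;> first | (exfalso; omega) | decide

theorem exists_quadratic_weights {z : Fin 6 → Fin 3 ⊕ Fin 3 → F} (h02 : SeparatedBy 0 2 z)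
    (t : (Fin 3 → ℕ) → F) : ∃ μ : Fin 6 → F, ∀ β : Fin 3 → ℕ, ∑ i, β i = 2 →
      ∑ i, μ i * ∏ b, z i (Sum.inr b) ^ β b = t β := by
  let Φ : (Fin 6 → F) →ₗ[F] (Fin 6 → F) :=
    LinearMap.pi fun n => ∑ i, (∏ b, z i (Sum.inr b) ^ quadExp n b) • LinearMap.proj i
  have hΦ : ∀ μ n, Φ μ n = ∑ i, μ i * ∏ b, z i (Sum.inr b) ^ quadExp n b := fun μ n => by
    simp [Φ, LinearMap.sum_apply, mul_comm]
  have hinj : Function.Injective Φ := by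
    refine (injective_iff_map_eq_zero Φ).2 fun μ hμ =>
      eq_zero_of_power_moments h02 le_rfl fun β hβ => ?_
    obtain ⟨n, rfl⟩ := exists_quadExp hβ
    rw [← hΦ, hμ]; rfl
  obtain ⟨μ, hμ⟩ := LinearMap.surjective_of_injective hinj fun n => t (quadExp n)
  refine ⟨μ, fun β hβ => ?_⟩
  obtain ⟨n, rfl⟩ := exists_quadExp hβ
  rw [← hΦ, hμ]

end PowerSums

/-! ### Decompositions as families of points -/

section Decompositions

open MvPolynomial

variable {F : Type} [Field F]

theorem degrees2333_succ (a : Fin 3) : degrees2333 a.succ = 3 := by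
  fin_cases a <;> rfl

theorem two_le_degrees2333 (j : Fin 4) : 2 ≤ degrees2333 j := by
  fin_cases j <;> decide

/-- The points of the product of two planes given by the scalars of the three cubics and the
coefficients of the linear forms. -/
noncomputable def WaringData.points {m : ℕ} (D : WaringData F 2 4 m) :
    Fin m → Fin 3 ⊕ Fin 3 → F :=
  fun i => Sum.elim (fun a => D.lam i a.succ) (linCoeff (D.form i : MvPolynomial (Fin 3) F))

/-- The moments of a polynomial vector that are given by its three cubics. -/
noncomputable def cubicMoments (f : PolyVec F 2 degrees2333) : Fin 3 → Fin 10 → F :=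
  fun a n => polarCoeff (f a.succ : MvPolynomial (Fin 3) F) (cubicExp n)

theorem sum_cubicExp (n : Fin 10) : ∑ i, cubicExp n i = 3 := by
  fin_cases n <;> rfl

theorem WaringData.eq_sum_pow_iff [CharZero F] {m : ℕ} (D : WaringData F 2 4 m)
    (f : PolyVec F 2 degrees2333) (j : Fin 4) :
    (f j : MvPolynomial (Fin 3) F) =
      ∑ i, D.lam i j • (D.form i : MvPolynomial (Fin 3) F) ^ degrees2333 j ↔
    ∀ β : Fin 3 → ℕ, ∑ i, β i = degrees2333 j →
      ∑ i, D.lam i j * ∏ b, D.points i (Sum.inr b) ^ β b =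
        polarCoeff (f j : MvPolynomial (Fin 3) F) β :=
  _root_.eq_sum_pow_iff ((mem_homogeneousSubmodule _ _).1 (f j).2) _ _

theorem moments_apply {m : ℕ} (z : Fin m → Fin 3 ⊕ Fin 3 → F) (a : Fin 3) (n : Fin 10) :
    moments z a n = ∑ i, z i (Sum.inl a) * ∏ b, z i (Sum.inr b) ^ cubicExp n b := by
  simp only [moments, eval_momentPoly, Fin.prod_univ_three]

theorem WaringData.IsDecompositionOf.moments_points [CharZero F] {m : ℕ} {D : WaringData F 2 4 m}
    {f : PolyVec F 2 degrees2333} (h : D.IsDecompositionOf f) :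
    moments D.points = cubicMoments f := by
  ext a n
  rw [moments_apply]
  exact (D.eq_sum_pow_iff f a.succ).1 (h a.succ).2 _ (by rw [sum_cubicExp, degrees2333_succ])

theorem exists_isDecompositionOf [CharZero F] {f : PolyVec F 2 degrees2333} (hf : ∀ j, f j ≠ 0)
    {m : ℕ} {z : Fin m → Fin 3 ⊕ Fin 3 → F} (hz : moments z = cubicMoments f) {μ : Fin m → F}
    (hμ : ∀ β : Fin 3 → ℕ, ∑ i, β i = 2 → ∑ i, μ i * ∏ b, z i (Sum.inr b) ^ β b =
      polarCoeff (f 0 : MvPolynomial (Fin 3) F) β) :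
    ∃ D : WaringData F 2 4 m, D.IsDecompositionOf f ∧ D.points = z := by
  let D : WaringData F 2 4 m :=
    { form := fun i => linForm fun b => z i (Sum.inr b)
      lam := fun i => Fin.cons (μ i) fun a => z i (Sum.inl a) }
  have hD : D.points = z := by
    ext i c
    rcases c with a | b
    · simp [WaringData.points, D]
    · simp [WaringData.points, D, linCoeff_linForm]
  refine ⟨D, fun j => ?_, hD⟩
  have key : (f j : MvPolynomial (Fin 3) F) =
      ∑ i, D.lam i j • (D.form i : MvPolynomial (Fin 3) F) ^ degrees2333 j := by
    rw [D.eq_sum_pow_iff f j, hD]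
    intro β hβ
    obtain rfl | ⟨a, rfl⟩ := Fin.eq_zero_or_eq_succ j
    · exact hμ β hβ
    · rw [degrees2333_succ] at hβ
      obtain ⟨n, rfl⟩ := exists_cubicExp hβ
      have := congrFun (congrFun hz a) n
      rwa [moments_apply] at this
  refine ⟨fun h0 => hf j (Subtype.ext ?_), key⟩
  refine key.trans (Finset.sum_eq_zero fun i _ => ?_)
  rw [show D.lam i j = 0 from congrFun h0 i, zero_smul]

/-- Dual conics prevent two points from being matched to the same one, so the matching is a
permutation. Once the linear forms agree up to scale, independence of their powers determines all
scalars, including those of the quadric, which the points do not record. -/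
theorem equivalent_of_biProportional [CharZero F] {f : PolyVec F 2 degrees2333}
    {G D : WaringData F 2 4 6} (hG : G.IsDecompositionOf f) (hD : D.IsDecompositionOf f)
    (h02 : SeparatedBy 0 2 G.points) (h : ∀ j, ∃ i, BiProportional (G.points j) (D.points i)) :
    WaringData.Equivalent degrees2333 G D := by
  choose σ hσ using h
  have hinj : Function.Injective σ := by
    intro j j' hj
    by_contra hne
    obtain ⟨q, hq, hqG⟩ := h02
    have h1 := (hσ j).eval_eq_zero_iff (hq j)
    have h2 := (hσ j').eval_eq_zero_iff (hq j)
    rw [hj, ← h2, hqG, hqG, if_pos rfl, if_neg hne] at h1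
    simp at h1
  let τ : Equiv.Perm (Fin 6) := Equiv.ofBijective σ (Finite.injective_iff_bijective.1 hinj)
  choose c c' hc hc' hz using hσ
  have hform : ∀ i, D.form (τ i) = (c' i)⁻¹ • G.form i := fun i => by
    rw [eq_inv_smul_iff₀ (hc' i), ← linForm_linCoeff (G.form i), ← linForm_linCoeff (c' i • _)]
    congr 1
    ext b
    have := congrFun (hz i) (Sum.inr b)
    simpa [WaringData.points, biScale, linCoeff, τ] using this.symm
  refine ⟨τ, fun i => (c' i)⁻¹, fun i => ⟨inv_ne_zero (hc' i), hform i, fun j => ?_⟩⟩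
  have hpt : ∀ i b, D.points (τ i) (Sum.inr b) = (c' i)⁻¹ * G.points i (Sum.inr b) := fun i b => by
    rw [hz i]; simp [biScale, τ, hc' i]
  have := eq_zero_of_power_moments (μ := fun i =>
    D.lam (τ i) j * (c' i)⁻¹ ^ degrees2333 j - G.lam i j) h02 (two_le_degrees2333 j) fun β hβ => by
      have h1 := (G.eq_sum_pow_iff f j).1 (hG j).2 β hβ
      have h2 := (D.eq_sum_pow_iff f j).1 (hD j).2 β hβ
      rw [← Equiv.sum_comp τ] at h2
      simp only [hpt, mul_pow, Finset.prod_mul_distrib, Finset.prod_pow_eq_pow_sum, hβ] at h2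
      simp only [sub_mul, Finset.sum_sub_distrib]
      rw [h1, ← h2, sub_eq_zero]
      exact Finset.sum_congr rfl fun i _ => by ring
  exact sub_eq_zero.1 (congrFun this i)

end Decompositions

/-! ### Equivalence under change of field, and conjugate pairs of decompositions -/

section Descent

open MvPolynomial

namespace WaringData

variable {F K : Type} [Field F] [Field K] {n r k : ℕ} {d : Fin r → ℕ}

theorem Equivalent.symm {D E : WaringData F n r k} (h : Equivalent d D E) : Equivalent d E D := by
  obtain ⟨σ, c, h⟩ := h
  refine ⟨σ.symm, fun i => (c (σ.symm i))⁻¹, fun i => ?_⟩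
  obtain ⟨h1, h2, h3⟩ := h (σ.symm i)
  rw [Equiv.apply_symm_apply] at h2
  refine ⟨inv_ne_zero h1, ?_, fun j => ?_⟩
  · rw [eq_inv_smul_iff₀ h1, h2]
  · rw [← h3, Equiv.apply_symm_apply, inv_pow, mul_inv_cancel_right₀ (pow_ne_zero _ h1)]

theorem Equivalent.trans {D E G : WaringData F n r k} (h : Equivalent d D E)
    (h' : Equivalent d E G) : Equivalent d D G := by
  obtain ⟨σ, c, h⟩ := h
  obtain ⟨σ', c', h'⟩ := h'
  refine ⟨σ.trans σ', fun i => c' (σ i) * c i, fun i => ?_⟩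
  obtain ⟨h1, h2, h3⟩ := h i
  obtain ⟨g1, g2, g3⟩ := h' (σ i)
  refine ⟨mul_ne_zero g1 h1, ?_, fun j => ?_⟩
  · rw [Equiv.trans_apply, g2, h2, mul_smul]
  · rw [Equiv.trans_apply, ← h3, ← g3, mul_pow, mul_assoc]

theorem coe_map_form (φ : F →+* K) (D : WaringData F n r k) (i : Fin k) :
    ((D.map φ).form i : MvPolynomial (Fin (n + 1)) K) =
      MvPolynomial.map φ (D.form i : MvPolynomial (Fin (n + 1)) F) := rfl

theorem Equivalent.map {D E : WaringData F n r k} (h : Equivalent d D E) (φ : F →+* K) :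
    Equivalent d (D.map φ) (E.map φ) := by
  obtain ⟨σ, c, h⟩ := h
  refine ⟨σ, fun i => φ (c i), fun i => ⟨(map_ne_zero φ).2 (h i).1, ?_, fun j => ?_⟩⟩
  · refine Subtype.ext ?_
    change MvPolynomial.map φ (E.form (σ i) : MvPolynomial (Fin (n + 1)) F) =
      φ (c i) • MvPolynomial.map φ (D.form i : MvPolynomial (Fin (n + 1)) F)
    rw [(h i).2.1, Submodule.coe_smul, smul_eq_C_mul, smul_eq_C_mul, map_mul, map_C]
  · change φ (E.lam (σ i) j) * φ (c i) ^ d j = φ (D.lam i j)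
    rw [← (h i).2.2 j, map_mul, map_pow]

theorem IsDecompositionOf.map {D : WaringData F n r k} {f : PolyVec F n d}
    (h : D.IsDecompositionOf f) (φ : F →+* K) : (D.map φ).IsDecompositionOf (f.map φ) := by
  intro j
  refine ⟨fun h0 => (h j).1 (funext fun i => ?_), ?_⟩
  · exact (map_eq_zero φ).1 (congrFun h0 i)
  · change MvPolynomial.map φ (f j : MvPolynomial (Fin (n + 1)) F) = ∑ i, φ (D.lam i j) •
      MvPolynomial.map φ (D.form i : MvPolynomial (Fin (n + 1)) F) ^ d j
    rw [(h j).2, map_sum]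
    refine Finset.sum_congr rfl fun i _ => ?_
    rw [smul_eq_C_mul, smul_eq_C_mul, map_mul, map_C, map_pow]

theorem map_map {L : Type} [Field L] (φ : F →+* K) (ψ : K →+* L) (D : WaringData F n r k) :
    (D.map φ).map ψ = D.map (ψ.comp φ) := by
  simp only [map, MvPolynomial.map_map, RingHom.comp_apply]

theorem map_id (D : WaringData F n r k) : D.map (RingHom.id F) = D := by
  cases D
  simp only [WaringData.map, MvPolynomial.map_id, RingHom.id_apply]

/-- Each rescaling factor is a quotient of coefficients of two non-zero forms over `F`, so it lies
in `F`. -/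
theorem Equivalent.of_map {D E : WaringData F n r k} (φ : F →+* K) (hE : ∀ i, E.form i ≠ 0)
    (h : Equivalent d (D.map φ) (E.map φ)) : Equivalent d D E := by
  obtain ⟨σ, c, h⟩ := h
  have hc : ∀ i, ∃ x : F, φ x = c i := fun i => by
    obtain ⟨m, hm⟩ := MvPolynomial.ne_zero_iff.1 fun h0 => hE (σ i) (Subtype.ext h0)
    have h1 : φ (coeff m (E.form (σ i) : MvPolynomial (Fin (n + 1)) F)) =
        c i * φ (coeff m (D.form i : MvPolynomial (Fin (n + 1)) F)) := by
      have := congrArg (fun p : homogeneousSubmodule (Fin (n + 1)) K 1 =>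
        coeff m (p : MvPolynomial (Fin (n + 1)) K)) (h i).2.1
      simpa [coe_map_form, coeff_map] using this
    have h2 : φ (coeff m (D.form i : MvPolynomial (Fin (n + 1)) F)) ≠ 0 := by
      rintro h0
      rw [h0, mul_zero] at h1
      exact hm ((map_eq_zero φ).1 h1)
    exact ⟨coeff m (E.form (σ i) : MvPolynomial (Fin (n + 1)) F) /
      coeff m (D.form i : MvPolynomial (Fin (n + 1)) F),
      by rw [map_div₀, h1, mul_div_cancel_right₀ _ h2]⟩
  choose x hx using hc
  refine ⟨σ, x, fun i => ⟨fun h0 => (h i).1 (by rw [← hx, h0, map_zero]), ?_, fun j => ?_⟩⟩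
  · refine Subtype.ext (MvPolynomial.map_injective φ φ.injective ?_)
    have := congrArg Subtype.val (h i).2.1
    rw [coe_map_form, Submodule.coe_smul, coe_map_form] at this
    rw [this, Submodule.coe_smul, smul_eq_C_mul, smul_eq_C_mul, map_mul, map_C, hx]
  · refine φ.injective ?_
    rw [map_mul, map_pow, hx]
    exact (h i).2.2 j

/-- Multiplication of all scalars by a common factor. -/
def scale (c : F) (D : WaringData F n r k) : WaringData F n r k where
  form := D.form
  lam i j := c * D.lam i j

theorem IsDecompositionOf.scale {D : WaringData F n r k} {f : PolyVec F n d}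
    (h : D.IsDecompositionOf f) {c : F} (hc : c ≠ 0) : (D.scale c).IsDecompositionOf (c • f) := by
  intro j
  refine ⟨fun h0 => (h j).1 (funext fun i => ?_), ?_⟩
  · exact (mul_eq_zero.1 (congrFun h0 i)).resolve_left hc
  · change c • (f j : MvPolynomial (Fin (n + 1)) F) = ∑ i, (c * D.lam i j) •
      (D.form i : MvPolynomial (Fin (n + 1)) F) ^ d j
    rw [(h j).2, Finset.smul_sum]
    exact Finset.sum_congr rfl fun i _ => (mul_smul _ _ _).symm

theorem Equivalent.scale {D E : WaringData F n r k} (h : Equivalent d D E) (c : F) :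
    Equivalent d (D.scale c) (E.scale c) := by
  obtain ⟨σ, b, h⟩ := h
  refine ⟨σ, b, fun i => ⟨(h i).1, (h i).2.1, fun j => ?_⟩⟩
  change c * E.lam (σ i) j * b i ^ d j = c * D.lam i j
  rw [mul_assoc, (h i).2.2 j]

theorem scale_scale (c c' : F) (D : WaringData F n r k) :
    (D.scale c).scale c' = D.scale (c' * c) := by
  simp only [WaringData.scale, mul_assoc]

theorem scale_one (D : WaringData F n r k) : D.scale 1 = D := by
  cases D
  simp only [WaringData.scale, one_mul]

theorem map_scale (φ : F →+* K) (c : F) (D : WaringData F n r k) :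
    (D.scale c).map φ = (D.map φ).scale (φ c) := by
  simp only [WaringData.scale, WaringData.map, map_mul]

end WaringData

theorem PolyVec.map_smul {F K : Type} [Field F] [Field K] (φ : F →+* K) {n r : ℕ}
    {d : Fin r → ℕ} (c : F) (f : PolyVec F n d) : (c • f).map φ = φ c • f.map φ := by
  funext j
  refine Subtype.ext ?_
  change MvPolynomial.map φ (c • (f j : MvPolynomial (Fin (n + 1)) F)) =
    φ c • MvPolynomial.map φ (f j : MvPolynomial (Fin (n + 1)) F)
  rw [smul_eq_C_mul, smul_eq_C_mul, map_mul, map_C]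

theorem conj_comp_ofReal : (starRingEnd ℂ).comp Complex.ofRealHom = Complex.ofRealHom :=
  RingHom.ext fun x => Complex.conj_ofReal x

/-- `f` has, up to equivalence, exactly the real decomposition `D` and the non-real
decomposition `E` with six summands, and no shorter complex decompositions. -/
structure HasConjugatePair {n r : ℕ} {d : Fin r → ℕ} (f : PolyVec ℝ n d) (k : ℕ)
    (D : WaringData ℝ n r k) (E : WaringData ℂ n r k) : Prop where
  left : D.IsDecompositionOf f
  right : E.IsDecompositionOf (f.map Complex.ofRealHom)
  form_ne_zero : ∀ i, D.form i ≠ 0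
  not_isReal : ¬ E.IsReal d
  le_card : ∀ (m : ℕ) (G : WaringData ℂ n r m),
    G.IsDecompositionOf (f.map Complex.ofRealHom) → k ≤ m
  equivalent : ∀ G : WaringData ℂ n r k, G.IsDecompositionOf (f.map Complex.ofRealHom) →
    WaringData.Equivalent d G (D.map Complex.ofRealHom) ∨ WaringData.Equivalent d G E

namespace HasConjugatePair

variable {n r : ℕ} {d : Fin r → ℕ} {f : PolyVec ℝ n d} {k : ℕ} {D : WaringData ℝ n r k}
  {E : WaringData ℂ n r k}

theorem hasWaringRank_complex (h : HasConjugatePair f k D E) :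
    HasWaringRank (f.map Complex.ofRealHom) k :=
  ⟨⟨E, h.right⟩, fun m ⟨G, hG⟩ => h.le_card m G hG⟩

theorem hasWaringRank_real (h : HasConjugatePair f k D E) : HasWaringRank f k :=
  ⟨⟨D, h.left⟩, fun m ⟨_, hG⟩ => h.le_card m _ (hG.map Complex.ofRealHom)⟩

/-- A real decomposition cannot become equivalent to `E`, so over ℂ it is equivalent to `D`, and
this equivalence descends to ℝ. -/
theorem waringIdentifiable_real (h : HasConjugatePair f k D E) : WaringIdentifiable f := by
  have key : ∀ G : WaringData ℝ n r k, G.IsDecompositionOf f → WaringData.Equivalent d G D := by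
    intro G hG
    rcases h.equivalent _ (hG.map Complex.ofRealHom) with h1 | h1
    · exact h1.of_map Complex.ofRealHom h.form_ne_zero
    · exact absurd ⟨G, h1⟩ h.not_isReal
  exact ⟨k, h.hasWaringRank_real, fun G G' hG hG' => (key G hG).trans (key G' hG').symm⟩

theorem not_waringIdentifiable_complex (h : HasConjugatePair f k D E) :
    ¬ WaringIdentifiable (f.map Complex.ofRealHom) := by
  rintro ⟨m, hm, hu⟩
  obtain rfl := hm.unique h.hasWaringRank_complex
  exact h.not_isReal ⟨D, hu _ _ (h.left.map _) h.right⟩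

/-- The conjugate of `E` decomposes the same real vector. Were it equivalent to `D`, conjugating
back would make `E` real. -/
theorem isSelfConjugate (h : HasConjugatePair f k D E) : E.IsSelfConjugate d := by
  have hf : (f.map Complex.ofRealHom).map (starRingEnd ℂ) = f.map Complex.ofRealHom := by
    funext j
    refine Subtype.ext ?_
    change MvPolynomial.map _ (MvPolynomial.map _ _) = MvPolynomial.map _ _
    rw [MvPolynomial.map_map, conj_comp_ofReal]
  have hE := h.right.map (starRingEnd ℂ)
  rw [hf] at hE
  refine (h.equivalent _ hE).resolve_left fun h1 => h.not_isReal ⟨D, ?_⟩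
  have h2 := h1.map (starRingEnd ℂ)
  rw [WaringData.map_map, WaringData.map_map, conj_comp_ofReal,
    show (starRingEnd ℂ).comp (starRingEnd ℂ) = RingHom.id ℂ from
      RingHom.ext fun x => Complex.conj_conj x, WaringData.map_id] at h2
  exact h2.symm

theorem smul (h : HasConjugatePair f k D E) {c : ℝ} (hc : c ≠ 0) :
    HasConjugatePair (c • f) k (D.scale c) (E.scale (Complex.ofRealHom c)) := by
  have hc' : Complex.ofRealHom c ≠ 0 := (map_ne_zero _).2 hc
  have key : ∀ {m : ℕ} {G : WaringData ℂ n r m},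
      G.IsDecompositionOf ((c • f).map Complex.ofRealHom) →
      (G.scale (Complex.ofRealHom c)⁻¹).IsDecompositionOf (f.map Complex.ofRealHom) := by
    intro m G hG
    have := hG.scale (inv_ne_zero hc')
    rwa [PolyVec.map_smul, inv_smul_smul₀ hc'] at this
  have key' : ∀ {G H : WaringData ℂ n r k},
      WaringData.Equivalent d (G.scale (Complex.ofRealHom c)⁻¹) H →
      WaringData.Equivalent d G (H.scale (Complex.ofRealHom c)) := by
    intro G H hGH
    have := hGH.scale (Complex.ofRealHom c)
    rwa [WaringData.scale_scale, mul_inv_cancel₀ hc', WaringData.scale_one] at this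
  refine ⟨h.left.scale hc, ?_, h.form_ne_zero, ?_, fun m G hG => h.le_card m _ (key hG),
    fun G hG => ?_⟩
  · rw [PolyVec.map_smul]
    exact h.right.scale hc'
  · rintro ⟨G, hG⟩
    refine h.not_isReal ⟨G.scale c⁻¹, ?_⟩
    have := hG.scale (Complex.ofRealHom c)⁻¹
    rwa [WaringData.scale_scale, inv_mul_cancel₀ hc', WaringData.scale_one, ← map_inv₀,
      ← WaringData.map_scale] at this
  · rw [WaringData.map_scale]
    exact (h.equivalent _ (key hG)).imp key' key'

end HasConjugatePair

end Descent

/-! ### Open sets of moments, vectors and lines -/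

section OpenSet

open MvPolynomial Filter

theorem cubicMoments_map {F K : Type} [Field F] [Field K] (φ : F →+* K)
    (f : PolyVec F 2 degrees2333) (a : Fin 3) (n : Fin 10) :
    cubicMoments (f.map φ) a n = φ (cubicMoments f a n) := by
  change coeff _ (MvPolynomial.map φ _) / _ = φ (_ / _)
  rw [coeff_map, map_div₀, map_natCast]

theorem moments_map {F K : Type} [Field F] [Field K] (φ : F →+* K) {m : ℕ}
    (x : Fin m → Fin 3 ⊕ Fin 3 → F) (a : Fin 3) (n : Fin 10) :
    moments (fun i j => φ (x i j)) a n = φ (moments x a n) := by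
  simp only [moments, map_eval_momentPoly, map_sum]

theorem WaringData.points_map {F K : Type} [Field F] [Field K] (φ : F →+* K) {m : ℕ}
    (D : WaringData F 2 4 m) : (D.map φ).points = fun i j => φ (D.points i j) := by
  ext i j
  rcases j with a | b
  · rfl
  · change coeff _ (MvPolynomial.map φ _) = φ (coeff _ _)
    rw [coeff_map]

/-- The coefficients of the linear forms of a real decomposition are real up to a common factor. -/
theorem im_mul_conj_eq_zero_of_isReal {m : ℕ} {E : WaringData ℂ 2 4 m}
    (h : E.IsReal degrees2333) (i : Fin m) (b b' : Fin 3) :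
    (E.points i (Sum.inr b) * starRingEnd ℂ (E.points i (Sum.inr b'))).im = 0 := by
  obtain ⟨D, σ, c, h⟩ := h
  have key : ∀ b, E.points i (Sum.inr b) =
      c (σ.symm i) * (D.points (σ.symm i) (Sum.inr b) : ℝ) := fun b => by
    have h1 := (h (σ.symm i)).2.1
    rw [Equiv.apply_symm_apply] at h1
    have h2 := congrFun (congrFun (D.points_map Complex.ofRealHom) (σ.symm i)) (Sum.inr b)
    change linCoeff (E.form i : MvPolynomial (Fin 3) ℂ) b = _
    rw [h1]
    change c (σ.symm i) * (D.map Complex.ofRealHom).points (σ.symm i) (Sum.inr b) = _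
    rw [h2]
    rfl
  rw [key, key, map_mul, Complex.conj_ofReal, mul_mul_mul_comm, Complex.mul_conj,
    ← Complex.ofReal_mul, ← Complex.ofReal_mul, Complex.ofReal_im]

theorem hasConjugatePair_of_residualPair {f : PolyVec ℝ 2 degrees2333} (hf : ∀ j, f j ≠ 0)
    {x : Fin 6 → Fin 3 ⊕ Fin 3 → ℝ} {d : Fin 6 → Fin 3 ⊕ Fin 3 → ℂ}
    (R : ResidualPair d fun i j => Complex.ofRealHom (x i j)) (hx : moments x = cubicMoments f)
    (hd : moments d = cubicMoments (f.map Complex.ofRealHom)) {i : Fin 6} {b b' : Fin 3}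
    (him : (d i (Sum.inr b) * starRingEnd ℂ (d i (Sum.inr b'))).im ≠ 0) :
    ∃ D E, HasConjugatePair f 6 D E := by
  have hf' : ∀ j, f.map Complex.ofRealHom j ≠ 0 := fun j h0 => hf j <| Subtype.ext <|
    MvPolynomial.map_injective _ Complex.ofRealHom.injective
      ((congrArg Subtype.val h0).trans (map_zero _).symm)
  obtain ⟨ν, hν⟩ := exists_quadratic_weights R.conics
    (polarCoeff (f.map Complex.ofRealHom 0 : MvPolynomial (Fin 3) ℂ))
  obtain ⟨E, hE, rfl⟩ := exists_isDecompositionOf hf' hd hν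
  obtain ⟨μ, hμ⟩ := exists_quadratic_weights R.conics'
    (fun β => Complex.ofRealHom (polarCoeff (f 0 : MvPolynomial (Fin 3) ℝ) β))
  -- The weights of the quadric are found over ℂ; since the points and the quadric are real, their
  -- real parts also solve the system.
  obtain ⟨D, hD, rfl⟩ := exists_isDecompositionOf hf hx (μ := fun i => (μ i).re) fun β hβ => by
    have := congrArg Complex.re (hμ β hβ)
    rw [Complex.re_sum] at this
    refine Eq.trans (Finset.sum_congr rfl fun i _ => ?_) this
    simp only [Complex.ofRealHom_eq_coe, ← Complex.ofReal_pow, ← Complex.ofReal_prod,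
      Complex.re_mul_ofReal]
  have hsame : ∀ {m : ℕ} {G : WaringData ℂ 2 4 m},
      G.IsDecompositionOf (f.map Complex.ofRealHom) → SameMoments G.points E.points :=
    fun hG => sameMoments_of_moments_eq (hG.moments_points.trans hd.symm)
  refine ⟨D, E, hD, hE, fun i h0 => ?_, fun h => him (im_mul_conj_eq_zero_of_isReal h _ _ _),
    fun m G hG => card_le_of_sameMoments (hsame hG) R.bilinear R.conics, fun G hG => ?_⟩
  · refine inr_ne_zero_of_separatedBy R.conics' i (funext fun b => ?_)
    change Complex.ofRealHom (coeff _ (D.form i : MvPolynomial (Fin 3) ℝ)) = 0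
    rw [h0]
    simp
  · have h02 := separatedBy_conics_of_sameMoments (hsame hG) R.bilinear R.conics
    refine (R.unique (hsame hG)).symm.imp (fun h => ?_) fun h => ?_
    · refine equivalent_of_biProportional hG (hD.map _) h02 ?_
      rwa [WaringData.points_map]
    · exact equivalent_of_biProportional hG hE h02 h

theorem eventually_hasConjugatePair : ∀ᶠ μ in 𝓝 (moments (realBase ℝ)),
    ∀ f : PolyVec ℝ 2 degrees2333, cubicMoments f = μ → (∀ j, f j ≠ 0) →
      ∃ D E, HasConjugatePair f 6 D E := by
  -- The filter of pairs near the base pair, restricted to those with equal moments.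
  have hR := eventually_residualPair
    (l := 𝓝 (complexBase, realBase ℂ) ⊓ 𝓟 {p | moments p.1 = moments p.2})
    (d := Prod.fst) (d' := Prod.snd) (continuous_fst.continuousAt.mono_left inf_le_left)
    (continuous_snd.continuousAt.mono_left inf_le_left)
    ((eventually_principal.2 fun p hp => sameMoments_of_moments_eq (Eq.symm hp)).filter_mono
      inf_le_right)
  rw [eventually_inf_principal, nhds_prod_eq, eventually_prod_iff] at hR
  obtain ⟨pa, ha, pb, hb, hab⟩ := hR
  let coe : (Fin 3 → Fin 10 → ℝ) → Fin 3 → Fin 10 → ℂ := fun μ a n => Complex.ofRealHom (μ a n)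
  have hcoe : Continuous coe := by
    refine continuous_pi fun a => continuous_pi fun n => Complex.continuous_ofReal.comp ?_
    fun_prop
  let cpt : (Fin 6 → Fin 3 ⊕ Fin 3 → ℝ) → Fin 6 → Fin 3 ⊕ Fin 3 → ℂ :=
    fun x i j => Complex.ofRealHom (x i j)
  have hcpt : Continuous cpt := by
    refine continuous_pi fun a => continuous_pi fun n => Complex.continuous_ofReal.comp ?_
    fun_prop
  have hb0 : cpt (realBase ℝ) = realBase ℂ := by
    ext i j; exact (realBase_map i j).symm
  have hm0 : moments complexBase = coe (moments (realBase ℝ)) := by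
    rw [moments_complexBase, ← hb0]
    ext a n
    exact moments_map _ _ a n
  have him : ∀ᶠ d in 𝓝 complexBase,
      (d 0 (Sum.inr 2) * starRingEnd ℂ (d 0 (Sum.inr 1))).im ≠ 0 := by
    have hc : Continuous fun d : Fin 6 → Fin 3 ⊕ Fin 3 → ℂ =>
        (d 0 (Sum.inr 2) * starRingEnd ℂ (d 0 (Sum.inr 1))).im := by
      refine Complex.continuous_im.comp (Continuous.mul (by fun_prop) ?_)
      exact Complex.continuous_conj.comp (by fun_prop)
    exact hc.continuousAt.eventually_ne (by simp [complexBase])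
  -- Openness of the complex moment map at `complexBase`, pulled back to real moments. The non-zero
  -- imaginary part keeps the first linear form away from multiples of real ones.
  have hA : ∀ᶠ μ in 𝓝 (moments (realBase ℝ)), ∃ d, (pa d ∧
      (d 0 (Sum.inr 2) * starRingEnd ℂ (d 0 (Sum.inr 1))).im ≠ 0) ∧ moments d = coe μ := by
    refine hcoe.continuousAt.eventually (p := fun ν => ∃ d, (pa d ∧
      (d 0 (Sum.inr 2) * starRingEnd ℂ (d 0 (Sum.inr 1))).im ≠ 0) ∧ moments d = ν) ?_
    rw [← hm0, ← map_moments_nhds _ cubic_eq_zero_of_complexBase, eventually_map]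
    filter_upwards [ha, him] with d h1 h2 using ⟨d, ⟨h1, h2⟩, rfl⟩
  have hB : ∀ᶠ μ in 𝓝 (moments (realBase ℝ)), ∃ x, pb (cpt x) ∧ moments x = μ := by
    rw [← map_moments_nhds _ cubic_eq_zero_of_realBase, eventually_map]
    rw [← hb0] at hb
    filter_upwards [hcpt.continuousAt.eventually hb] with x h1 using ⟨x, h1, rfl⟩
  filter_upwards [hA, hB] with μ h1 h2 f hfμ hf
  obtain ⟨d, ⟨hd, hdim⟩, hdm⟩ := h1
  obtain ⟨x, hx, hxm⟩ := h2
  have hcx : moments (cpt x) = coe μ := by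
    ext a n
    rw [← hxm]
    exact moments_map _ _ a n
  obtain ⟨R⟩ := hab hd hx (hdm.trans hcx.symm)
  refine hasConjugatePair_of_residualPair hf R (hxm.trans hfμ.symm) (hdm.trans ?_) hdim
  ext a n
  rw [cubicMoments_map, hfμ]

/-- This makes the open set non-empty. The quadric may be given any weights that keep it non-zero;
all are taken to be 1. -/
theorem exists_realBase_polyVec : ∃ f : PolyVec ℝ 2 degrees2333,
    cubicMoments f = moments (realBase ℝ) ∧ ∀ j, f j ≠ 0 := by
  let D : WaringData ℝ 2 4 6 :=
    { form := fun i => linForm fun b => realBase ℝ i (Sum.inr b)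
      lam := fun i => Fin.cons 1 fun a => realBase ℝ i (Sum.inl a) }
  have hD : D.points = realBase ℝ := by
    ext i c
    rcases c with a | b
    · simp [WaringData.points, D]
    · simp [WaringData.points, D, linCoeff_linForm]
  let f : PolyVec ℝ 2 degrees2333 := fun j =>
    ⟨∑ i, D.lam i j • (D.form i : MvPolynomial (Fin 3) ℝ) ^ degrees2333 j,
      Submodule.sum_mem _ fun i _ => Submodule.smul_mem _ _ (by
        simpa using ((mem_homogeneousSubmodule _ _).1 (D.form i).2).pow (degrees2333 j))⟩
  have hf : ∀ j β, ∑ i, β i = degrees2333 j → ∑ i, D.lam i j * ∏ b, realBase ℝ i (Sum.inr b) ^ β b =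
      polarCoeff (f j : MvPolynomial (Fin 3) ℝ) β := fun j => by
    rw [← hD]
    exact (D.eq_sum_pow_iff f j).1 rfl
  have hm : cubicMoments f = moments (realBase ℝ) := by
    ext a n
    rw [moments_apply]
    exact (hf a.succ _ (by rw [sum_cubicExp, degrees2333_succ])).symm
  refine ⟨f, hm, fun j h0 => ?_⟩
  obtain rfl | ⟨a, rfl⟩ := Fin.eq_zero_or_eq_succ j
  · have := hf 0 ![2, 0, 0] rfl
    rw [h0] at this
    simp [Fin.sum_univ_succ, Fin.prod_univ_three, D, realBase, polarCoeff] at this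
    norm_num at this
  · have h1 : ∀ n, moments (realBase ℝ) a n = 0 := fun n => by
      rw [← hm, cubicMoments, h0]
      simp [polarCoeff]
    fin_cases a
    · have := h1 1
      simp [moments_apply, Fin.sum_univ_succ, Fin.prod_univ_three, realBase, cubicExp] at this
      norm_num at this
    · have := h1 2
      simp [moments_apply, Fin.sum_univ_succ, Fin.prod_univ_three, realBase, cubicExp] at this
      norm_num at this
    · have := h1 0
      simp [moments_apply, Fin.sum_univ_succ, Fin.prod_univ_three, realBase, cubicExp] at this
      norm_num at this

theorem PolyVec.continuous_coeff {n r : ℕ} {d : Fin r → ℕ} (j : Fin r) (m : Fin (n + 1) →₀ ℕ) :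
    Continuous[PolyVec.euclideanTopology n d, inferInstance] fun f : PolyVec ℝ n d =>
      coeff m (f j : MvPolynomial (Fin (n + 1)) ℝ) := by
  let _ := PolyVec.euclideanTopology n d
  exact (continuous_apply (A := fun _ : Fin r × (Fin (n + 1) →₀ ℕ) => ℝ) (j, m)).comp
    (continuous_induced_dom (f := fun (f : PolyVec ℝ n d) (p : Fin r × (Fin (n + 1) →₀ ℕ)) =>
      coeff p.2 (f p.1 : MvPolynomial (Fin (n + 1)) ℝ)))

/-- The lines through an open set of vectors form an open set of the projective space. -/
theorem isOpen_projectivization {n r : ℕ} {d : Fin r → ℕ} {V : Set (PolyVec ℝ n d)}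
    (hV : IsOpen[PolyVec.euclideanTopology n d] V) :
    IsOpen[PolyVec.projectiveTopology n d]
      {x | ∃ (f : PolyVec ℝ n d) (hf : f ≠ 0), f ∈ V ∧ Projectivization.mk ℝ f hf = x} := by
  let _ := PolyVec.euclideanTopology n d
  rw [isOpen_coinduced]
  have hc : ∀ c : ℝ, Continuous fun g : PolyVec ℝ n d => c • g := fun c => by
    refine continuous_induced_rng.2 (continuous_pi fun p => ?_)
    exact (PolyVec.continuous_coeff p.1 p.2).const_smul c
  -- The cone over the lines meeting `V` is the union of the scalings of `V`, away from zero.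
  have e : (fun f : {f : PolyVec ℝ n d // f ≠ 0} => Projectivization.mk ℝ f.1 f.2) ⁻¹'
      {x | ∃ (f : PolyVec ℝ n d) (hf : f ≠ 0), f ∈ V ∧ Projectivization.mk ℝ f hf = x} =
      Subtype.val ⁻¹' ⋃ c : ℝˣ, (fun g : PolyVec ℝ n d => (c : ℝ) • g) ⁻¹' V := by
    ext ⟨g, hg⟩
    simp only [Set.mem_preimage, Set.mem_ofPred_eq, Set.mem_iUnion]
    constructor
    · rintro ⟨f, hf, hfV, h⟩
      obtain ⟨c, rfl⟩ := (Projectivization.mk_eq_mk_iff ℝ f g hf hg).1 h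
      exact ⟨c, hfV⟩
    · rintro ⟨c, hcV⟩
      exact ⟨(c : ℝ) • g, smul_ne_zero c.ne_zero hg, hcV,
        (Projectivization.mk_eq_mk_iff ℝ _ _ _ _).2 ⟨c, rfl⟩⟩
  rw [e]
  exact (isOpen_iUnion fun c : ℝˣ => hV.preimage (hc c)).preimage continuous_subtype_val

theorem isOpen_ne_zero {n r : ℕ} {d : Fin r → ℕ} (j : Fin r) :
    IsOpen[PolyVec.euclideanTopology n d] {f : PolyVec ℝ n d | f j ≠ 0} := by
  let _ := PolyVec.euclideanTopology n d
  have e : {f : PolyVec ℝ n d | f j ≠ 0} =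
      ⋃ m, {f | coeff m (f j : MvPolynomial (Fin (n + 1)) ℝ) ≠ 0} := by
    ext f
    simp only [Set.mem_ofPred_eq, Set.mem_iUnion, ← MvPolynomial.ne_zero_iff, ne_eq,
      Submodule.coe_eq_zero]
  rw [e]
  refine isOpen_iUnion fun m => isOpen_ne.preimage ?_
  exact PolyVec.continuous_coeff j m

end OpenSet

/-! ### Conclusion -/

theorem theorem3p1 :
    ∃ U : Set (ℙ ℝ (PolyVec ℝ 2 degrees2333)),
      U.Nonempty ∧ IsOpen[PolyVec.projectiveTopology 2 degrees2333] U ∧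
      ∀ (f : PolyVec ℝ 2 degrees2333) (hf : f ≠ 0), Projectivization.mk ℝ f hf ∈ U →
        HasWaringRank (f.map Complex.ofRealHom) 6 ∧
        HasWaringRank f 6 ∧
        WaringIdentifiable f ∧
        ¬ WaringIdentifiable (f.map Complex.ofRealHom) ∧
        ∃ (D : WaringData ℝ 2 4 6) (E : WaringData ℂ 2 4 6),
          D.IsDecompositionOf f ∧
          E.IsDecompositionOf (f.map Complex.ofRealHom) ∧
          E.IsSelfConjugate degrees2333 ∧
          ¬ E.IsReal degrees2333 ∧
          ∀ G : WaringData ℂ 2 4 6, G.IsDecompositionOf (f.map Complex.ofRealHom) →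
            WaringData.Equivalent degrees2333 G (D.map Complex.ofRealHom) ∨
              WaringData.Equivalent degrees2333 G E := by
  obtain ⟨N, hN, hNo, h0⟩ := eventually_nhds_iff.1 eventually_hasConjugatePair
  let V : Set (PolyVec ℝ 2 degrees2333) := {f | cubicMoments f ∈ N} ∩ ⋂ j, {f | f j ≠ 0}
  have hV : IsOpen[PolyVec.euclideanTopology 2 degrees2333] V := by
    let _ := PolyVec.euclideanTopology 2 degrees2333
    refine IsOpen.inter (hNo.preimage ?_) (isOpen_iInter_of_finite isOpen_ne_zero)
    refine continuous_pi fun a => continuous_pi fun n => Continuous.div_const ?_ _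
    exact PolyVec.continuous_coeff a.succ (Finsupp.equivFunOnFinite.symm (cubicExp n))
  refine ⟨_, ?_, isOpen_projectivization hV, fun f hf ⟨g, hg, hgV, hgf⟩ => ?_⟩
  · obtain ⟨f, hfm, hf⟩ := exists_realBase_polyVec
    exact ⟨_, f, fun h => hf 0 (congrFun h 0),
      ⟨show cubicMoments f ∈ N from hfm ▸ h0, Set.mem_iInter.2 hf⟩, rfl⟩
  · obtain ⟨c, rfl⟩ := (Projectivization.mk_eq_mk_iff ℝ f g hf hg).1 hgf.symm
    obtain ⟨D, E, h⟩ := hN _ hgV.1 g rfl (Set.mem_iInter.1 hgV.2)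
    have h := h.smul c.ne_zero
    exact ⟨h.hasWaringRank_complex, h.hasWaringRank_real, h.waringIdentifiable_real,
      h.not_waringIdentifiable_complex, _, _, h.left, h.right, h.isSelfConjugate, h.not_isReal,
      h.equivalent⟩
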